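/- **Setting.** Let $\mathbb D$ be the open unit disk. A one-parameter semigroup in $\mathbb D$ is a family $(\phi_t)_{t\ge0}$ of holomorphic self-maps of $\mathbb D$ with $\phi_0=\mathrm{id}$, $\phi_s\circ\phi_t=\phi_{s+t}$ and $\phi_t(z)\to z$ as $t\to0^+$ for all $z\in\mathbb D$; its infinitesimal generator is the holomorphic function $G:\mathbb D\to\mathbb C$ with $\frac{d}{dt}\phi_t(z)=G(\phi_t(z))$ for all $z\in\mathbb D$, $t\ge0$. A point $\sigma\in\partial\mathbb D$ is a boundary regular fixed point (BRFP) of $(\phi_t)$ if, for all $t\ge0$, $\phi_t$ has angular limit $\sigma$ and a finite angular derivative at $\sigma$; the spectral value at $\sigma$ is the angular limit $\angle\lim_{z\to\sigma}G(z)/(\sigma-z)$. If $\tau\in\mathbb D$ is the Denjoy–Wolff point (DW-point) of $(\phi_t)$, the spectral value $\lambda(G)\in\mathbb C$ at $\tau$ is defined by $\phi_t'(\tau)=e^{-\lambda(G)t}$ for all $t\ge0$. Let $n\ge1$, let $\sigma_1,\dots,\sigma_n\in\partial\mathbb D$ be pairwise distinct, $F=\{\sigma_1,\dots,\sigma_n\}$,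 $\Lambda=(\lambda_1,\dots,\lambda_n)\in(-\infty,0)^n$, and let $\tau\in\mathbb D\setminus\{0\}$. Let $\mathrm{Gen}_\tau(F,\Lambda)$ be the class of all infinitesimal generators $G$ that are either $\equiv0$ or have DW-point $\tau$, and whose semigroups have BRFPs $\sigma_1,\dots,\sigma_n$ with spectral values $\lambda_k'$ satisfying $\lambda_k\le\lambda'_k\le0$; let $\mathrm{Gen}'_\tau(F,\Lambda)$ be the subclass with $\lambda'_k=\lambda_k$ for all $k$. Put $$\alpha_k=\frac{|\tau-\sigma_k|^2}{2|\lambda_k|},\quad A=\sum_{k=1}^n\alpha_k,\quad B=\sum_{k=1}^n\frac{\operatorname{Im}(\overline{\sigma_k}\tau)}{|\lambda_k|},\quad p_0(z)=\sum_{k=1}^n\alpha_k\frac{\sigma_k+z}{\sigma_k-z},$$ $$Z=\{\zeta\in\mathbb C:|2\tau^{-1}A\,\zeta-1|\le1\},\qquad \ell_\zeta=\frac{\tau}{\zeta}-A,\qquad a_\zeta=\frac{1+|\tau|^2}{1-|\tau|^2}\operatorname{Re}\ell_\zeta+i\operatorname{Im}\ell_\zeta+p_0(\tau)\quad(\zeta\ne0),$$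 $$\Omega_\zeta=\Big\{\omega\in\mathbb C\setminus\{0\}:\Big|\frac{1-|\tau|^2}{\omega}-a_\zeta\Big|\le\frac{2|\tau|}{1-|\tau|^2}\operatorname{Re}\ell_\zeta\Big\}\ (\zeta\in Z\setminus\{0\}),\qquad\Omega_0=\{0\},$$ $$G_{\zeta,s}(z)=\frac{(\tau-z)(1-\overline\tau z)}{\frac{s+z}{s-z}\operatorname{Re}\ell_\zeta+i\operatorname{Im}\ell_\zeta+p_0(z)}\ (\zeta\in\operatorname{int}Z,\ s\in\partial\mathbb D),\qquad G_\zeta(z)=\frac{(\tau-z)(1-\overline\tau z)}{i\operatorname{Im}\ell_\zeta+p_0(z)}\ (\zeta\in\partial Z\setminus\{0\}).$$ **Theorem.** Every $G\in\mathrm{Gen}_\tau(F,\Lambda)$ has a unique spectral value $\lambda(G)$ at $\tau$ (with $\lambda(0)=0$), and the following hold. 1. The value region $V=\{(G(0),\lambda(G)):G\in\mathrm{Gen}_\tau(F,\Lambda)\}$ equals $\{(\zeta,\omega)\in\mathbb C^2:\zeta\in Z,\ \omega\in\Omega_\zeta\}$. Here $Z$ is the closed disk of centre $\tau/(2A)$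 and radius $|\tau|/(2A)$, and $\Omega_\zeta$ is a closed disk of positive radius if $\zeta\in\operatorname{int}Z$ and a single point if $\zeta\in\partial Z$. 2. Each boundary point of $V$ is delivered by exactly one $G\in\mathrm{Gen}_\tau(F,\Lambda)$, and this $G$ is one of the functions $G_{\zeta,s}$ ($\zeta\in\operatorname{int}Z$, $s\in\partial\mathbb D$), $G_\zeta$ ($\zeta\in\partial Z\setminus\{0\}$), or $0$. Conversely, all these functions belong to $\mathrm{Gen}_\tau(F,\Lambda)$ and deliver boundary points of $V$. Moreover $G_\zeta\in\mathrm{Gen}'_\tau(F,\Lambda)$, and $G_{\zeta,s}\in\mathrm{Gen}'_\tau(F,\Lambda)$ if $s\notin F$. 3. For every $G\in\mathrm{Gen}_\tau(F,\Lambda)$, $G\not\equiv0$, with $\lambda=\lambda(G)$, one has $G(0)\ne0$, $\lambda\ne0$ and the sharp inequalities $$\text{(a)}\quad\operatorname{Re}\frac{\tau}{G(0)}\ge A,$$ $$\text{(b)}\quad\frac{1-|\tau|}{1+|\tau|}\Big[\operatorname{Re}\frac{\tau}{G(0)}-A\Big]\le\operatorname{Re}\frac{1-|\tau|^2}{\lambda}-\frac{1-|\tau|^2}{2}\sum_{k=1}^n\frac1{|\lambda_k|}\le\frac{1+|\tau|}{1-|\tau|}\Big[\operatorname{Re}\frac{\tau}{G(0)}-A\Big],$$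 $$\text{(c)}\quad\Big|\operatorname{Im}\Big(\frac{1-|\tau|^2}{\lambda}-\frac{\tau}{G(0)}\Big)-B\Big|\le\frac{2|\tau|}{1-|\tau|^2}\Big[\operatorname{Re}\frac{\tau}{G(0)}-A\Big].$$ Equality holds in (a) if and only if $G=G_\zeta$ for some $\zeta\in\partial Z\setminus\{0\}$. In each of the other inequalities it holds if and only if $G=G_\zeta$ for some $\zeta\in\partial Z\setminus\{0\}$, or $G=G_{\zeta,s}$ for some $\zeta\in\operatorname{int}Z$ with: $s=-\tau/|\tau|$ for the left inequality in (b); $s=\tau/|\tau|$ for the right inequality in (b); $s=\frac{\tau}{|\tau|}\cdot\frac{2|\tau|\pm i(1-|\tau|^2)}{1+|\tau|^2}$ (either sign) for (c). -/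

import Mathlib

open Set Filter Topology Complex

namespace HolGen

noncomputable section

/-- The open unit disk. Functions on it are represented by functions `ℂ → ℂ`, of which only the
values on the disk matter. -/
abbrev unitDisk : Set ℂ := Metric.ball 0 1

/-! ### Angular limits and boundary fixed points -/

/-- The Stolz region with vertex `σ` and aperture `M`. -/
def stolz (σ : ℂ) (M : ℝ) : Set ℂ := {z | ‖z‖ < 1 ∧ ‖z - σ‖ < M * (1 - ‖z‖)}

/-- `f` has the (finite) angular limit `L` at the boundary point `σ`. -/
def HasAngularLimit (f : ℂ → ℂ) (σ L : ℂ) : Prop :=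
  ∀ M : ℝ, Tendsto f (𝓝[stolz σ M] σ) (𝓝 L)

/-- `σ` is a boundary fixed point of `φ` with finite angular derivative `d`. -/
def HasBoundaryFixedPoint (φ : ℂ → ℂ) (σ d : ℂ) : Prop :=
  ‖σ‖ = 1 ∧ HasAngularLimit φ σ σ ∧ HasAngularLimit (fun z => (φ z - σ) / (z - σ)) σ d

/-- `σ` is a boundary regular fixed point of `φ`. -/
def IsBRFP (φ : ℂ → ℂ) (σ : ℂ) : Prop := ∃ d : ℂ, HasBoundaryFixedPoint φ σ d

/-- `τ` is the Denjoy-Wolff point of the holomorphic self-map `φ ≠ id` of the disk. -/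
def IsDWPoint (φ : ℂ → ℂ) (τ : ℂ) : Prop :=
  (τ ∈ unitDisk ∧ φ τ = τ ∧ ‖deriv φ τ‖ ≤ 1) ∨
  ((∀ z ∈ unitDisk, φ z ≠ z) ∧ ∃ d : ℝ, d ≤ 1 ∧ HasBoundaryFixedPoint φ τ d)

/-! ### One-parameter semigroups and infinitesimal generators -/

/-- `(φ t)`, `t ≥ 0`, is a one-parameter semigroup of holomorphic self-maps of the disk. -/
structure IsOneParamSemigroup (φ : ℝ → ℂ → ℂ) : Prop where
  holo : ∀ t, 0 ≤ t → DifferentiableOn ℂ (φ t) unitDisk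
  mapsTo : ∀ t, 0 ≤ t → MapsTo (φ t) unitDisk unitDisk
  zero : ∀ z ∈ unitDisk, φ 0 z = z
  comp : ∀ s t, 0 ≤ s → 0 ≤ t → ∀ z ∈ unitDisk, φ s (φ t z) = φ (s + t) z
  cont : ∀ z ∈ unitDisk, Tendsto (fun t => φ t z) (𝓝[>] 0) (𝓝 z)

/-- `G` is the infinitesimal generator of the one-parameter semigroup `(φ t)`. -/
structure IsGeneratorOf (G : ℂ → ℂ) (φ : ℝ → ℂ → ℂ) : Prop where
  semigroup : IsOneParamSemigroup φ
  holo : DifferentiableOn ℂ G unitDisk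
  flow : ∀ z ∈ unitDisk, ∀ t, 0 ≤ t →
    HasDerivWithinAt (fun s => φ s z) (G (φ t z)) (Ici 0) t

/-- `τ` is the Denjoy-Wolff point of `(φ t)`: the common one of all the elements other than the
identity. By convention, every point qualifies for the trivial semigroup. -/
def IsSemigroupDWPoint (φ : ℝ → ℂ → ℂ) (τ : ℂ) : Prop :=
  ∀ t, 0 ≤ t → ¬ EqOn (φ t) id unitDisk → IsDWPoint (φ t) τ

/-- `σ` is a boundary regular fixed point of the semigroup `(φ t)` with generator `G`, and `l` is
its spectral value there. -/
def HasBRFPWithSpectralValue (G : ℂ → ℂ) (φ : ℝ → ℂ → ℂ) (σ : ℂ) (l : ℝ) : Prop :=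
  (∀ t, 0 ≤ t → IsBRFP (φ t) σ) ∧ HasAngularLimit (fun z => G z / (σ - z)) σ l

/-- `w` is the spectral value at the Denjoy-Wolff point `τ`, lying inside the disk, of the
semigroup generated by `G`. -/
def HasSpectralValue (G : ℂ → ℂ) (τ w : ℂ) : Prop :=
  ∃ φ : ℝ → ℂ → ℂ, IsGeneratorOf G φ ∧ ∀ t : ℝ, 0 ≤ t → deriv (φ t) τ = exp (-(w * t))

variable {n : ℕ}

/-- The class `Gen_τ(F, Λ)`: generators with Denjoy-Wolff point `τ` and boundary regular fixed
points `σ k`, with spectral values between `lam k` and `0`. -/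
def Gen (τ : ℂ) (σ : Fin n → ℂ) (lam : Fin n → ℝ) : Set (ℂ → ℂ) :=
  {G | ∃ φ : ℝ → ℂ → ℂ, IsGeneratorOf G φ ∧ IsSemigroupDWPoint φ τ ∧
    ∀ k, ∃ l : ℝ, lam k ≤ l ∧ l ≤ 0 ∧ HasBRFPWithSpectralValue G φ (σ k) l}

/-- The class `Gen'_τ(F, Λ)`: the spectral values at `σ k` are exactly `lam k`. -/
def GenExact (τ : ℂ) (σ : Fin n → ℂ) (lam : Fin n → ℝ) : Set (ℂ → ℂ) :=
  {G | ∃ φ : ℝ → ℂ → ℂ, IsGeneratorOf G φ ∧ IsSemigroupDWPoint φ τ ∧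
    ∀ k, HasBRFPWithSpectralValue G φ (σ k) (lam k)}

/-! ### The value region -/

/-- The pair `(G(0), λ(G))` equals `P`. -/
def Delivers (τ : ℂ) (G : ℂ → ℂ) (P : ℂ × ℂ) : Prop :=
  G 0 = P.1 ∧ HasSpectralValue G τ P.2

/-- The value region of `G ↦ (G(0), λ(G))` on `Gen_τ(F, Λ)`. -/
def valueRegion (τ : ℂ) (σ : Fin n → ℂ) (lam : Fin n → ℝ) : Set (ℂ × ℂ) :=
  {P | ∃ G ∈ Gen τ σ lam, Delivers τ G P}

/-- The numbers `α_k`. -/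
def alpha (τ : ℂ) (σ : Fin n → ℂ) (lam : Fin n → ℝ) (k : Fin n) : ℝ :=
  ‖τ - σ k‖ ^ 2 / (2 * |lam k|)

/-- `A = ∑ α_k`. -/
def sumAlpha (τ : ℂ) (σ : Fin n → ℂ) (lam : Fin n → ℝ) : ℝ := ∑ k, alpha τ σ lam k

/-- `B = ∑ Im(conj(σ_k) τ) / |λ_k|`. -/
def sumB (τ : ℂ) (σ : Fin n → ℂ) (lam : Fin n → ℝ) : ℝ :=
  ∑ k, ((starRingEnd ℂ) (σ k) * τ).im / |lam k|

/-- The function `p₀(z; F, Λ)`. -/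
def p₀ (τ : ℂ) (σ : Fin n → ℂ) (lam : Fin n → ℝ) (z : ℂ) : ℂ :=
  ∑ k, (alpha τ σ lam k : ℂ) * ((σ k + z) / (σ k - z))

/-- The set `Z`. -/
def regionZ (τ : ℂ) (σ : Fin n → ℂ) (lam : Fin n → ℝ) : Set ℂ :=
  {ζ | ‖2 * τ⁻¹ * (sumAlpha τ σ lam : ℂ) * ζ - 1‖ ≤ 1}

/-- `ℓ_ζ` (used for `ζ ≠ 0`). -/
def ell (τ : ℂ) (σ : Fin n → ℂ) (lam : Fin n → ℝ) (ζ : ℂ) : ℂ :=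
  τ / ζ - (sumAlpha τ σ lam : ℂ)

/-- `a_ζ` (used for `ζ ≠ 0`). -/
def centerA (τ : ℂ) (σ : Fin n → ℂ) (lam : Fin n → ℝ) (ζ : ℂ) : ℂ :=
  (((1 + ‖τ‖ ^ 2) / (1 - ‖τ‖ ^ 2) * (ell τ σ lam ζ).re : ℝ) : ℂ)
    + I * ((ell τ σ lam ζ).im : ℂ) + p₀ τ σ lam τ

open Classical in
/-- The set `Ω_ζ`. -/
def regionΩ (τ : ℂ) (σ : Fin n → ℂ) (lam : Fin n → ℝ) (ζ : ℂ) : Set ℂ :=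
  if ζ = 0 then {0} else
    {ω | ω ≠ 0 ∧ ‖((1 - ‖τ‖ ^ 2 : ℝ) : ℂ) / ω - centerA τ σ lam ζ‖
      ≤ 2 * ‖τ‖ / (1 - ‖τ‖ ^ 2) * (ell τ σ lam ζ).re}

/-! ### The extremal generators -/

/-- The function `G_{ζ,s}`. -/
def extremalInt (τ : ℂ) (σ : Fin n → ℂ) (lam : Fin n → ℝ) (ζ s z : ℂ) : ℂ :=
  (τ - z) * (1 - (starRingEnd ℂ) τ * z) /
    ((s + z) / (s - z) * ((ell τ σ lam ζ).re : ℂ) + I * ((ell τ σ lam ζ).im : ℂ) + p₀ τ σ lam z)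

/-- The function `G_ζ`. -/
def extremalBdry (τ : ℂ) (σ : Fin n → ℂ) (lam : Fin n → ℝ) (ζ z : ℂ) : ℂ :=
  (τ - z) * (1 - (starRingEnd ℂ) τ * z) /
    (I * ((ell τ σ lam ζ).im : ℂ) + p₀ τ σ lam z)

/-- `G = G_{ζ,s}` on the disk for some interior point `ζ` of `Z`. -/
def IsExtremalInt (τ : ℂ) (σ : Fin n → ℂ) (lam : Fin n → ℝ) (s : ℂ) (G : ℂ → ℂ) : Prop :=
  ∃ ζ ∈ interior (regionZ τ σ lam), EqOn G (extremalInt τ σ lam ζ s) unitDisk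

/-- `G = G_ζ` on the disk for some boundary point `ζ ≠ 0` of `Z`. -/
def IsExtremalBdry (τ : ℂ) (σ : Fin n → ℂ) (lam : Fin n → ℝ) (G : ℂ → ℂ) : Prop :=
  ∃ ζ ∈ frontier (regionZ τ σ lam), ζ ≠ 0 ∧ EqOn G (extremalBdry τ σ lam ζ) unitDisk

/-- `G` is, on the disk, one of the functions `G_{ζ,s}`, `G_ζ`, or `0`. -/
def IsExtremal (τ : ℂ) (σ : Fin n → ℂ) (lam : Fin n → ℝ) (G : ℂ → ℂ) : Prop :=
  (∃ s : ℂ, ‖s‖ = 1 ∧ IsExtremalInt τ σ lam s G) ∨ IsExtremalBdry τ σ lam G ∨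
    EqOn G 0 unitDisk

end

end HolGen

open HolGen

/-!
By the Berkson-Porta formula the generators with Denjoy-Wolff point `τ` are the functions
`(τ - z) * (1 - conj τ * z) * p z` with `p ≠ 0` in the Carathéodory class. A boundary regular fixed
point `σ k` with spectral value at least `lam k` means that the Herglotz measure of `1 / p` has an
atom of mass at least `alpha k` at `σ k`. Julia's lemma allows these atoms to be subtracted one
after the other, so that `1 / p = f + p₀` with an arbitrary Carathéodory remainder `f`. The value
`G 0` fixes `f 0` and the spectral value at `τ` fixes `f τ`, hence the value region consists of `0`
and the image of the set of pairs `(f 0, f τ)`, described by the Schwarz-Pick inequality, under an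
open embedding. Equality in Schwarz-Pick forces `f` to be a Herglotz function with a single pole or
an imaginary constant; these remainders give the extremal generators.
-/

namespace HolGen

open scoped ComplexConjugate

/-- The involutive automorphism of the unit disk interchanging `0` and `τ`; it transports statements
based at the origin to the point `τ`. -/
noncomputable def diskInvolution (τ z : ℂ) : ℂ := (τ - z) / (1 - conj τ * z)

theorem one_sub_sq_norm_pos {z : ℂ} (hz : z ∈ unitDisk) : 0 < 1 - ‖z‖ ^ 2 := by
  nlinarith [norm_nonneg z, mem_ball_zero_iff.mp hz]

theorem one_sub_mul_ne_zero {w z : ℂ} (hw : ‖w‖ ≤ 1) (hz : z ∈ unitDisk) : 1 - w * z ≠ 0 := by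
  refine sub_ne_zero.mpr fun h => absurd (congrArg norm h) ?_
  rw [norm_one, norm_mul]
  nlinarith [norm_nonneg z, mem_ball_zero_iff.mp hz]

theorem one_sub_conj_mul_ne_zero {τ z : ℂ} (hτ : τ ∈ unitDisk) (hz : z ∈ unitDisk) :
    1 - conj τ * z ≠ 0 :=
  one_sub_mul_ne_zero (by rw [RCLike.norm_conj]; exact (mem_ball_zero_iff.mp hτ).le) hz

theorem one_sub_conj_mul_self (τ : ℂ) : 1 - conj τ * τ = ((1 - ‖τ‖ ^ 2 : ℝ) : ℂ) := by
  rw [conj_mul']; push_cast; rfl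

theorem sq_norm_one_sub_conj_mul (τ z : ℂ) :
    ‖1 - conj τ * z‖ ^ 2 = ‖τ - z‖ ^ 2 + (1 - ‖τ‖ ^ 2) * (1 - ‖z‖ ^ 2) := by
  simp only [Complex.sq_norm, normSq_apply, sub_re, sub_im, mul_re, mul_im, conj_re, conj_im,
    one_re, one_im]
  ring

theorem norm_sub_lt_norm_one_sub_conj_mul {τ z : ℂ} (hτ : τ ∈ unitDisk) (hz : z ∈ unitDisk) :
    ‖τ - z‖ < ‖1 - conj τ * z‖ := by
  refine lt_of_pow_lt_pow_left₀ 2 (norm_nonneg _) ?_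
  rw [sq_norm_one_sub_conj_mul]
  exact lt_add_of_pos_right _ (mul_pos (one_sub_sq_norm_pos hτ) (one_sub_sq_norm_pos hz))

theorem mapsTo_diskInvolution {τ : ℂ} (hτ : τ ∈ unitDisk) :
    MapsTo (diskInvolution τ) unitDisk unitDisk := fun z hz => by
  rw [mem_ball_zero_iff, diskInvolution, norm_div,
    div_lt_one (norm_pos_iff.mpr (one_sub_conj_mul_ne_zero hτ hz))]
  exact norm_sub_lt_norm_one_sub_conj_mul hτ hz

theorem one_sub_conj_mul_diskInvolution {τ z : ℂ} (hτ : τ ∈ unitDisk) (hz : z ∈ unitDisk) :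
    1 - conj τ * diskInvolution τ z = (1 - conj τ * τ) / (1 - conj τ * z) := by
  have hne := one_sub_conj_mul_ne_zero hτ hz
  rw [diskInvolution, eq_div_iff hne, sub_mul, mul_assoc, div_mul_cancel₀ _ hne]
  ring

theorem sub_diskInvolution {τ z : ℂ} (hτ : τ ∈ unitDisk) (hz : z ∈ unitDisk) :
    τ - diskInvolution τ z = z * (1 - conj τ * diskInvolution τ z) := by
  have hne := one_sub_conj_mul_ne_zero hτ hz
  rw [one_sub_conj_mul_diskInvolution hτ hz, diskInvolution, mul_div_assoc', eq_div_iff hne,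
    sub_mul, div_mul_cancel₀ _ hne]
  ring

theorem diskInvolution_diskInvolution {τ z : ℂ} (hτ : τ ∈ unitDisk) (hz : z ∈ unitDisk) :
    diskInvolution τ (diskInvolution τ z) = z := by
  have hne := one_sub_conj_mul_ne_zero hτ (mapsTo_diskInvolution hτ hz)
  rw [diskInvolution, sub_diskInvolution hτ hz, mul_div_cancel_right₀ _ hne]

@[simp] theorem diskInvolution_self (τ : ℂ) : diskInvolution τ τ = 0 := by simp [diskInvolution]

@[simp] theorem diskInvolution_zero (τ : ℂ) : diskInvolution τ 0 = τ := by simp [diskInvolution]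

theorem hasDerivAt_diskInvolution {τ z : ℂ} (hτ : τ ∈ unitDisk) (hz : z ∈ unitDisk) :
    HasDerivAt (diskInvolution τ) (-(1 - conj τ * τ) / (1 - conj τ * z) ^ 2) z := by
  refine (((hasDerivAt_id z).const_sub τ).div
    (((hasDerivAt_id z).const_mul (conj τ)).const_sub 1)
    (one_sub_conj_mul_ne_zero hτ hz)).congr_deriv ?_
  simp only [id]
  ring

theorem differentiableOn_diskInvolution {τ : ℂ} (hτ : τ ∈ unitDisk) :
    DifferentiableOn ℂ (diskInvolution τ) unitDisk := fun _ hz =>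
  (hasDerivAt_diskInvolution hτ hz).differentiableAt.differentiableWithinAt

/-! ### The Carathéodory class -/

/-- The Carathéodory class: holomorphic functions on the unit disk with nonnegative real part. The
constants on the imaginary axis are included. -/
structure IsCaratheodory (f : ℂ → ℂ) : Prop where
  holo : DifferentiableOn ℂ f unitDisk
  re_nonneg : ∀ z ∈ unitDisk, 0 ≤ (f z).re

theorem IsCaratheodory.add {f g : ℂ → ℂ} (hf : IsCaratheodory f) (hg : IsCaratheodory g) :
    IsCaratheodory fun z => f z + g z :=
  ⟨hf.holo.add hg.holo, fun z hz => add_nonneg (hf.re_nonneg z hz) (hg.re_nonneg z hz)⟩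

theorem IsCaratheodory.comp {f g : ℂ → ℂ} (hf : IsCaratheodory f)
    (hg : DifferentiableOn ℂ g unitDisk) (hmaps : MapsTo g unitDisk unitDisk) :
    IsCaratheodory (f ∘ g) :=
  ⟨hf.holo.comp hg hmaps, fun z hz => hf.re_nonneg (g z) (hmaps hz)⟩

theorem sq_norm_add_conj (u w : ℂ) : ‖u + conj w‖ ^ 2 = ‖u - w‖ ^ 2 + 4 * (u.re * w.re) := by
  simp only [Complex.sq_norm, normSq_apply, sub_re, sub_im, add_re, add_im, conj_re, conj_im]
  ring

/-- The Cayley map of the right half-plane onto the unit disk that takes `w` to `0`. -/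
noncomputable def cayley (w u : ℂ) : ℂ := (u - w) / (u + conj w)

@[simp] theorem cayley_self (w : ℂ) : cayley w w = 0 := by simp [cayley]

theorem add_conj_ne_zero {u w : ℂ} (hu : 0 < u.re) (hw : 0 < w.re) : u + conj w ≠ 0 := fun h => by
  have hre := congrArg re h
  rw [add_re, conj_re, zero_re] at hre
  exact (add_pos hu hw).ne' hre

theorem norm_cayley_lt_one {u w : ℂ} (hu : 0 < u.re) (hw : 0 < w.re) : ‖cayley w u‖ < 1 := by
  rw [cayley, norm_div, div_lt_one (norm_pos_iff.mpr (add_conj_ne_zero hu hw))]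
  refine lt_of_pow_lt_pow_left₀ 2 (norm_nonneg _) ?_
  rw [sq_norm_add_conj]
  linarith [mul_pos hu hw]

theorem differentiableOn_cayley_comp {f : ℂ → ℂ} (hf : DifferentiableOn ℂ f unitDisk)
    (hpos : ∀ z ∈ unitDisk, 0 < (f z).re) :
    DifferentiableOn ℂ (fun z => cayley (f 0) (f z)) unitDisk :=
  (hf.sub_const _).div (hf.add_const _) fun z hz =>
    add_conj_ne_zero (hpos z hz) (hpos 0 (by simp))

theorem norm_sub_apply_zero_le_of_re_pos {f : ℂ → ℂ} (hf : DifferentiableOn ℂ f unitDisk)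
    (hpos : ∀ z ∈ unitDisk, 0 < (f z).re) {z : ℂ} (hz : z ∈ unitDisk) :
    ‖f z - f 0‖ ≤ ‖z‖ * ‖f z + conj (f 0)‖ := by
  have hpos0 := hpos 0 (by simp)
  have hschwarz : ‖cayley (f 0) (f z)‖ ≤ ‖z‖ :=
    Complex.norm_le_norm_of_mapsTo_ball (differentiableOn_cayley_comp hf hpos)
      (fun w hw => mem_closedBall_zero_iff.mpr (norm_cayley_lt_one (hpos w hw) hpos0).le)
      (cayley_self _) (mem_ball_zero_iff.mp hz)
  rwa [cayley, norm_div,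
    div_le_iff₀ (norm_pos_iff.mpr (add_conj_ne_zero (hpos z hz) hpos0))] at hschwarz

namespace IsCaratheodory

variable {f : ℂ → ℂ} {z w : ℂ}

theorem norm_sub_apply_zero_le (hf : IsCaratheodory f) (hz : z ∈ unitDisk) :
    ‖f z - f 0‖ ≤ ‖z‖ * ‖f z + conj (f 0)‖ := by
  have hshift : ∀ ε : ℝ, 0 < ε → ‖f z - f 0‖ ≤ ‖z‖ * ‖f z + conj (f 0) + 2 * (ε : ℂ)‖ := by
    intro ε hε
    have h := norm_sub_apply_zero_le_of_re_pos (f := fun z => f z + (ε : ℂ)) (hf.holo.add_const _)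
      (fun w hw => by rw [add_re, ofReal_re]; linarith [hf.re_nonneg w hw]) hz
    rw [add_sub_add_right_eq_sub, map_add, conj_ofReal] at h
    convert h using 3
    ring
  have hcont : Continuous fun ε : ℝ => ‖z‖ * ‖f z + conj (f 0) + 2 * (ε : ℂ)‖ := by fun_prop
  simpa using ge_of_tendsto (hcont.continuousWithinAt (s := Ioi 0) (x := 0))
    (eventually_nhdsWithin_of_forall hshift)

theorem schwarzPick (hf : IsCaratheodory f) (hz : z ∈ unitDisk) (hw : w ∈ unitDisk) :
    ‖f z - f w‖ * ‖1 - conj w * z‖ ≤ ‖w - z‖ * ‖f z + conj (f w)‖ := by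
  have h := (hf.comp (differentiableOn_diskInvolution hw)
    (mapsTo_diskInvolution hw)).norm_sub_apply_zero_le (mapsTo_diskInvolution hw hz)
  rwa [Function.comp_apply, Function.comp_apply, diskInvolution_diskInvolution hw hz,
    diskInvolution_zero, diskInvolution, norm_div, div_mul_eq_mul_div,
    le_div_iff₀ (norm_pos_iff.mpr (one_sub_conj_mul_ne_zero hw hz))] at h

theorem harnack (hf : IsCaratheodory f) (hz : z ∈ unitDisk) (hw : w ∈ unitDisk) :
    (1 - ‖w‖ ^ 2) * (1 - ‖z‖ ^ 2) * ‖f z + conj (f w)‖ ^ 2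
      ≤ 4 * ((f z).re * (f w).re) * ‖1 - conj w * z‖ ^ 2 := by
  have h := pow_le_pow_left₀ (by positivity) (hf.schwarzPick hz hw) 2
  rw [mul_pow, mul_pow, ← sub_eq_of_eq_add (sq_norm_add_conj (f z) (f w)),
    ← sub_eq_of_eq_add (sq_norm_one_sub_conj_mul w z)] at h
  linarith

theorem eqOn_const_of_re_eq_zero (hf : IsCaratheodory f) (hw : w ∈ unitDisk)
    (h0 : (f w).re = 0) : EqOn f (fun _ => f w) unitDisk := by
  intro z hz
  have hnorm : ‖f z + conj (f w)‖ = ‖f z - f w‖ := by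
    rw [← pow_left_inj₀ (norm_nonneg _) (norm_nonneg _) two_ne_zero, sq_norm_add_conj, h0]
    ring
  have h := hf.schwarzPick hz hw
  rw [hnorm] at h
  have hlt := norm_sub_lt_norm_one_sub_conj_mul hw hz
  refine sub_eq_zero.mp (norm_le_zero_iff.mp ?_)
  nlinarith

theorem re_pos_of_re_apply_pos (hf : IsCaratheodory f) (hw : w ∈ unitDisk) (hpos : 0 < (f w).re)
    (hz : z ∈ unitDisk) : 0 < (f z).re := by
  refine (hf.re_nonneg z hz).lt_of_ne' fun h => hpos.ne' ?_
  rw [hf.eqOn_const_of_re_eq_zero hz h hw, h]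

end IsCaratheodory

/-! ### Extremal functions of the Carathéodory class -/

theorem re_add_div_sub (s z : ℂ) :
    ((s + z) / (s - z)).re = (‖s‖ ^ 2 - ‖z‖ ^ 2) / ‖s - z‖ ^ 2 := by
  simpa [herglotzRieszKernel, poissonKernel] using
    (congrFun (poissonKernel_eq_re_herglotzRieszKernel (c := 0) (w := z)) s).symm

theorem conj_eq_re_sub_I_mul_im (L : ℂ) : conj L = L.re - I * L.im := by
  apply Complex.ext <;> simp

/-- For `‖κ‖ ≤ 1` and `0 < L.re`, the function of the Carathéodory class with value `L` at `0` whose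
composition with `cayley L` is `z ↦ κ * z`. For `‖κ‖ = 1` these are the extremal functions in the
Schwarz lemma, with a simple pole at `conj κ`. -/
noncomputable def herglotz (L κ z : ℂ) : ℂ := (1 + κ * z) / (1 - κ * z) * L.re + I * L.im

@[simp] theorem herglotz_zero (L κ : ℂ) : herglotz L κ 0 = L := by
  simp [herglotz, mul_comm I]

theorem herglotz_of_re_eq_zero {L : ℂ} (hL : L.re = 0) (κ : ℂ) : herglotz L κ = fun _ => L := by
  funext z
  rw [herglotz, hL, ofReal_zero, mul_zero, zero_add]
  apply Complex.ext <;> simp [hL]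

theorem eq_herglotz_iff {L κ z u : ℂ} (hκz : 1 - κ * z ≠ 0) :
    u = herglotz L κ z ↔ u - L = κ * z * (u + conj L) := by
  have hL : L = L.re + I * L.im := by simp [mul_comm I]
  rw [herglotz, conj_eq_re_sub_I_mul_im, div_mul_eq_mul_div, div_add' _ _ _ hκz, eq_div_iff hκz]
  constructor <;> intro h
  · linear_combination h - hL
  · linear_combination h + hL

theorem herglotz_re (L κ z : ℂ) :
    (herglotz L κ z).re = (1 - ‖κ * z‖ ^ 2) / ‖1 - κ * z‖ ^ 2 * L.re := by
  rw [herglotz, add_re, re_mul_ofReal, re_add_div_sub, norm_one, one_pow, re_mul_ofReal, I_re,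
    zero_mul, add_zero]

theorem isCaratheodory_herglotz {L κ : ℂ} (hL : 0 ≤ L.re) (hκ : ‖κ‖ ≤ 1) :
    IsCaratheodory (herglotz L κ) where
  holo := by
    unfold herglotz
    exact ((DifferentiableOn.div (by fun_prop) (by fun_prop)
      fun z hz => one_sub_mul_ne_zero hκ hz).mul_const _).add_const _
  re_nonneg z hz := by
    rw [herglotz_re]
    have hz1 := mem_ball_zero_iff.mp hz
    have hκz : ‖κ * z‖ ≤ 1 := by rw [norm_mul]; nlinarith [norm_nonneg κ, norm_nonneg z]
    have : 0 ≤ 1 - ‖κ * z‖ ^ 2 := by nlinarith [norm_nonneg (κ * z)]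
    positivity

theorem exists_herglotz_eq {L u τ : ℂ} (hτ : τ ∈ unitDisk) (hτ0 : τ ≠ 0)
    (hu : ‖u - L‖ ≤ ‖τ‖ * ‖u + conj L‖) : ∃ κ : ℂ, ‖κ‖ ≤ 1 ∧ herglotz L κ τ = u := by
  rcases eq_or_ne (u + conj L) 0 with h0 | h0
  · rw [h0, norm_zero, mul_zero, norm_le_zero_iff] at hu
    exact ⟨0, by simp, ((eq_herglotz_iff (by simp)).mpr (by rw [hu]; ring)).symm⟩
  · have hκ : ‖(u - L) / (τ * (u + conj L))‖ ≤ 1 := by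
      rw [norm_div, norm_mul]
      exact div_le_one_of_le₀ hu (by positivity)
    refine ⟨_, hκ, ((eq_herglotz_iff (one_sub_mul_ne_zero hκ hτ)).mpr ?_).symm⟩
    field_simp

theorem herglotz_inj {L κ κ' z : ℂ} (hL : 0 < L.re) (hκ : ‖κ‖ ≤ 1) (hκ' : ‖κ'‖ ≤ 1)
    (hz : z ∈ unitDisk) (hz0 : z ≠ 0) : herglotz L κ z = herglotz L κ' z ↔ κ = κ' := by
  refine ⟨fun h => ?_, fun h => by rw [h]⟩
  have hre := (isCaratheodory_herglotz hL.le hκ).re_pos_of_re_apply_pos (w := 0) (by simp)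
    (by simpa using hL) hz
  have e := (eq_herglotz_iff (L := L) (one_sub_mul_ne_zero hκ hz)).mp rfl
  have e' := (eq_herglotz_iff (one_sub_mul_ne_zero hκ' hz)).mp h
  exact mul_right_cancel₀ hz0 (mul_right_cancel₀ (add_conj_ne_zero hre hL) (e.symm.trans e'))

theorem norm_herglotz_sub {L κ z : ℂ} (hκ : ‖κ‖ = 1) (hz : z ∈ unitDisk) :
    ‖herglotz L κ z - L‖ = ‖z‖ * ‖herglotz L κ z + conj L‖ := by
  rw [(eq_herglotz_iff (L := L) (one_sub_mul_ne_zero hκ.le hz)).mp rfl, norm_mul, norm_mul, hκ,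
    one_mul]

theorem IsCaratheodory.exists_eqOn_herglotz {f : ℂ → ℂ} (hf : IsCaratheodory f) {τ : ℂ}
    (hτ : τ ∈ unitDisk) (hτ0 : τ ≠ 0) (hpos : 0 < (f 0).re)
    (heq : ‖f τ - f 0‖ = ‖τ‖ * ‖f τ + conj (f 0)‖) :
    ∃ κ : ℂ, ‖κ‖ = 1 ∧ EqOn f (herglotz (f 0) κ) unitDisk := by
  have hpos' : ∀ z ∈ unitDisk, 0 < (f z).re := fun z =>
    hf.re_pos_of_re_apply_pos (by simp) hpos
  have hden : ∀ z ∈ unitDisk, f z + conj (f 0) ≠ 0 := fun z hz =>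
    add_conj_ne_zero (hpos' z hz) hpos
  have hslope : ‖dslope (fun z => cayley (f 0) (f z)) 0 τ‖ = 1 / 1 := by
    rw [dslope_of_ne _ hτ0, slope_def_field, cayley_self, sub_zero, sub_zero, cayley, norm_div,
      norm_div, heq, mul_div_cancel_right₀ _ (norm_ne_zero_iff.mpr (hden τ hτ)), div_one,
      div_self (norm_ne_zero_iff.mpr hτ0)]
  obtain ⟨κ, hκ, hlin⟩ := Complex.affine_of_mapsTo_ball_of_exists_norm_dslope_eq_div'
    (differentiableOn_cayley_comp hf.holo hpos') (fun z hz => by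
      rw [cayley_self, mem_closedBall_zero_iff]
      exact (norm_cayley_lt_one (hpos' z hz) hpos).le) ⟨τ, hτ, hslope⟩
  rw [div_one] at hκ
  refine ⟨κ, hκ, fun z hz => (eq_herglotz_iff (one_sub_mul_ne_zero hκ.le hz)).mpr ?_⟩
  have hz' := hlin hz
  simp only [cayley_self, zero_add, sub_zero, smul_eq_mul] at hz'
  rw [← div_eq_iff (hden z hz), mul_comm κ]
  exact hz'

section

variable {r : ℝ} (L u : ℂ)

theorem sq_norm_sub_sub_sq_eq (hr0 : 0 ≤ r) (hr : r < 1) :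
    (1 - r ^ 2) * (‖u - (((1 + r ^ 2) / (1 - r ^ 2) * L.re : ℝ) + I * L.im)‖ ^ 2
      - (2 * r / (1 - r ^ 2) * L.re) ^ 2) = ‖u - L‖ ^ 2 - (r * ‖u + conj L‖) ^ 2 := by
  have hpos : 0 < 1 - r ^ 2 := by nlinarith
  rw [mul_pow r]
  simp only [Complex.sq_norm, normSq_apply, sub_re, sub_im, add_re, add_im, conj_re, conj_im,
    ofReal_re, ofReal_im, mul_re, mul_im, I_re, I_im]
  field_simp
  ring

variable {L}

theorem norm_sub_le_mul_iff (hr0 : 0 ≤ r) (hr : r < 1) (hL : 0 ≤ L.re) :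
    ‖u - L‖ ≤ r * ‖u + conj L‖ ↔
      ‖u - (((1 + r ^ 2) / (1 - r ^ 2) * L.re : ℝ) + I * L.im)‖
        ≤ 2 * r / (1 - r ^ 2) * L.re := by
  have hpos : 0 < 1 - r ^ 2 := by nlinarith
  rw [← pow_le_pow_iff_left₀ (norm_nonneg _) (by positivity) two_ne_zero, ← sub_nonpos,
    ← sq_norm_sub_sub_sq_eq L u hr0 hr, mul_nonpos_iff_pos_imp_nonpos,
    ← pow_le_pow_iff_left₀ (norm_nonneg _) (by positivity) two_ne_zero, ← sub_nonpos (b := _ ^ 2)]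
  simp [hpos, hpos.le]

end

/-! ### Julia's lemma -/

section

variable {σ z : ℂ}

theorem norm_one_sub_conj_mul_of_norm_eq_one (hσ : ‖σ‖ = 1) (z : ℂ) :
    ‖1 - conj σ * z‖ = ‖σ - z‖ := by
  rw [← pow_left_inj₀ (norm_nonneg _) (norm_nonneg _) two_ne_zero, sq_norm_one_sub_conj_mul, hσ]
  ring

theorem conj_mul_self_of_norm_eq_one (hσ : ‖σ‖ = 1) : conj σ * σ = 1 := by
  rw [conj_mul', hσ, ofReal_one, one_pow]

theorem sub_ne_zero_of_norm_eq_one (hσ : ‖σ‖ = 1) (hz : z ∈ unitDisk) : σ - z ≠ 0 :=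
  sub_ne_zero.mpr fun h => (mem_ball_zero_iff.mp hz).ne (h ▸ hσ)

theorem add_div_sub_eq (hσ : ‖σ‖ = 1) (z : ℂ) :
    (σ + z) / (σ - z) = (1 + conj σ * z) / (1 - conj σ * z) := by
  have h := conj_mul_self_of_norm_eq_one hσ
  rw [← mul_div_mul_left _ _ (left_ne_zero_of_mul_eq_one h), mul_add, mul_sub, h]

theorem re_add_div_sub_pos (hσ : ‖σ‖ = 1) (hz : z ∈ unitDisk) :
    0 < ((σ + z) / (σ - z)).re := by
  rw [re_add_div_sub, hσ, one_pow]
  exact div_pos (one_sub_sq_norm_pos hz)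
    (pow_pos (norm_pos_iff.mpr (sub_ne_zero_of_norm_eq_one hσ hz)) 2)

theorem ofReal_mul_mem_unitDisk (hσ : ‖σ‖ = 1) {r : ℝ} (hr : r ∈ Ioo (0 : ℝ) 1) :
    (r : ℂ) * σ ∈ unitDisk := by
  rw [mem_ball_zero_iff, norm_mul, hσ, mul_one, Complex.norm_of_nonneg hr.1.le]
  exact hr.2

namespace IsCaratheodory

variable {f : ℂ → ℂ}

theorem harnack_radial (hf : IsCaratheodory f) (hσ : ‖σ‖ = 1) (hz : z ∈ unitDisk) {r : ℝ}
    (hr : r ∈ Ioo (0 : ℝ) 1) :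
    (1 + r) * (1 - ‖z‖ ^ 2) * ‖((1 - r : ℝ) : ℂ) * f z + conj (((1 - r : ℝ) : ℂ) * f (r * σ))‖ ^ 2
      ≤ 4 * ((f z).re * (((1 - r : ℝ) : ℂ) * f (r * σ)).re) * ‖1 - conj (r * σ) * z‖ ^ 2 := by
  have hr1 : 0 < 1 - r := sub_pos.mpr hr.2
  have h := mul_le_mul_of_nonneg_left (hf.harnack hz (ofReal_mul_mem_unitDisk hσ hr)) hr1.le
  rw [norm_mul, hσ, mul_one, Complex.norm_of_nonneg hr.1.le] at h
  rw [map_mul, conj_ofReal, ← mul_add, norm_mul, Complex.norm_of_nonneg hr1.le, re_ofReal_mul]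
  linarith

theorem julia (hf : IsCaratheodory f) (hσ : ‖σ‖ = 1) {β : ℝ}
    (hlim : Tendsto (fun r : ℝ => ((1 - r : ℝ) : ℂ) * f (r * σ)) (𝓝[<] 1) (𝓝 (β : ℂ)))
    (hz : z ∈ unitDisk) : β / 2 * ((σ + z) / (σ - z)).re ≤ (f z).re := by
  rcases le_or_gt β 0 with hβ | hβ
  · exact (mul_nonpos_of_nonpos_of_nonneg (by linarith) (re_add_div_sub_pos hσ hz).le).trans
      (hf.re_nonneg z hz)
  have hleft : Tendsto (fun r : ℝ => (1 + r) * (1 - ‖z‖ ^ 2) *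
        ‖((1 - r : ℝ) : ℂ) * f z + conj (((1 - r : ℝ) : ℂ) * f (r * σ))‖ ^ 2) (𝓝[<] 1)
      (𝓝 ((1 + 1) * (1 - ‖z‖ ^ 2) * ‖((1 - 1 : ℝ) : ℂ) * f z + conj (β : ℂ)‖ ^ 2)) := by
    have hfirst : Continuous fun r : ℝ => (1 + r) * (1 - ‖z‖ ^ 2) := by fun_prop
    have hsecond : Continuous fun r : ℝ => ((1 - r : ℝ) : ℂ) * f z := by fun_prop
    exact hfirst.continuousWithinAt.tendsto.mul
      ((hsecond.continuousWithinAt.tendsto.add ((continuous_conj.tendsto _).comp hlim)).norm.pow 2)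
  have hright : Tendsto (fun r : ℝ => 4 * ((f z).re * (((1 - r : ℝ) : ℂ) * f (r * σ)).re) *
        ‖1 - conj (r * σ) * z‖ ^ 2) (𝓝[<] 1)
      (𝓝 (4 * ((f z).re * (β : ℂ).re) * ‖1 - conj ((1 : ℝ) * σ) * z‖ ^ 2)) := by
    have hlast : Continuous fun r : ℝ => ‖1 - conj (r * σ) * z‖ ^ 2 := by fun_prop
    exact ((((continuous_re.tendsto _).comp hlim).const_mul _).const_mul _).mul
      hlast.continuousWithinAt.tendsto
  have h := le_of_tendsto_of_tendsto hleft hright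
    (eventually_of_mem (Ioo_mem_nhdsLT one_pos) fun r hr => hf.harnack_radial hσ hz hr)
  simp only [sub_self, ofReal_zero, zero_mul, zero_add, conj_ofReal, ofReal_one, one_mul,
    ofReal_re, norm_one_sub_conj_mul_of_norm_eq_one hσ, Complex.norm_of_nonneg hβ.le] at h
  have hden : 0 < ‖σ - z‖ := norm_pos_iff.mpr (sub_ne_zero_of_norm_eq_one hσ hz)
  rw [re_add_div_sub, hσ, one_pow, mul_div_assoc', div_le_iff₀ (by positivity)]
  exact le_of_mul_le_mul_left (by linarith) hβ

end IsCaratheodory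

end

/-! ### Linearization along solutions of differential equations -/

section

variable {v v' a A : ℝ → ℂ} {T M ε δ : ℝ}

theorem norm_le_mul_exp_of_norm_deriv_sub_le (hM : ∀ t ∈ Icc 0 T, ‖a t‖ ≤ M)
    (hv : ∀ t ∈ Icc 0 T, HasDerivWithinAt v (v' t) (Icc 0 T) t)
    (hlin : ∀ t ∈ Icc 0 T, ‖v t‖ ≤ δ → ‖v' t - a t * v t‖ ≤ ε * ‖v t‖) (hε : ε < 1)
    (hM0 : 0 ≤ M) (hne : v 0 ≠ 0) (hsmall : ‖v 0‖ * Real.exp ((M + 1) * T) ≤ δ) :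
    ∀ t ∈ Icc 0 T, ‖v t‖ ≤ ‖v 0‖ * Real.exp ((M + 1) * t) := by
  have hbound (t : ℝ) : HasDerivAt (fun t => ‖v 0‖ * Real.exp ((M + 1) * t))
      ((M + 1) * (‖v 0‖ * Real.exp ((M + 1) * t))) t :=
    ((((hasDerivAt_id t).const_mul (M + 1)).exp).const_mul ‖v 0‖).congr_deriv (by
      simp only [id]; ring)
  refine image_norm_le_of_norm_deriv_right_lt_deriv_boundary
    (fun t ht => (hv t ht).continuousWithinAt)
    (fun t ht => (hv t (Ico_subset_Icc_self ht)).mono_of_mem_nhdsWithin (Icc_mem_nhdsGE_of_mem ht))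
    (by simp) hbound fun t ht htouch => ?_
  have ht' := Ico_subset_Icc_self ht
  have hvδ : ‖v t‖ ≤ δ := by
    rw [htouch]
    exact hsmall.trans' (by gcongr; exact ht'.2)
  have hvpos : 0 < ‖v t‖ := by
    rw [htouch]
    exact mul_pos (norm_pos_iff.mpr hne) (Real.exp_pos _)
  rw [← htouch]
  calc ‖v' t‖ ≤ ‖v' t - a t * v t‖ + ‖a t * v t‖ := norm_le_norm_sub_add _ _
    _ ≤ ε * ‖v t‖ + M * ‖v t‖ := by
        rw [norm_mul]; gcongr; exacts [hlin t ht' hvδ, hM t ht']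
    _ < (M + 1) * ‖v t‖ := by nlinarith

theorem norm_div_sub_exp_le (hT : 0 ≤ T)
    (hA : ∀ t ∈ Icc 0 T, HasDerivWithinAt A (a t) (Icc 0 T) t) (hA0 : A 0 = 0)
    (hM : ∀ t ∈ Icc 0 T, ‖a t‖ ≤ M)
    (hv : ∀ t ∈ Icc 0 T, HasDerivWithinAt v (v' t) (Icc 0 T) t)
    (hlin : ∀ t ∈ Icc 0 T, ‖v t‖ ≤ δ → ‖v' t - a t * v t‖ ≤ ε * ‖v t‖) (hε0 : 0 ≤ ε) (hε : ε < 1)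
    (hne : v 0 ≠ 0) (hsmall : ‖v 0‖ * Real.exp ((M + 1) * T) ≤ δ) :
    ‖v T / v 0 - exp (A T)‖ ≤ Real.exp (M * T) ^ 2 * Real.exp ((M + 1) * T) * T * ε := by
  have hM0 : 0 ≤ M := (norm_nonneg _).trans (hM 0 (left_mem_Icc.mpr hT))
  have hvle (t) (ht : t ∈ Icc 0 T) : ‖v t‖ ≤ ‖v 0‖ * Real.exp ((M + 1) * T) := by
    refine (norm_le_mul_exp_of_norm_deriv_sub_le hM hv hlin hε hM0 hne hsmall t ht).trans ?_
    gcongr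
    exact ht.2
  have hAle (t) (ht : t ∈ Icc 0 T) : ‖A t‖ ≤ M * T := by
    have h := norm_image_sub_le_of_norm_deriv_le_segment' hA
      (fun x hx => hM x (Ico_subset_Icc_self hx)) t ht
    rw [hA0, sub_zero, sub_zero] at h
    exact h.trans (by gcongr; exact ht.2)
  have hderiv (t) (ht : t ∈ Icc 0 T) : HasDerivWithinAt (fun s => exp (-A s) * v s)
      (exp (-A t) * (v' t - a t * v t)) (Icc 0 T) t :=
    (((hA t ht).neg.cexp).mul (hv t ht)).congr_deriv (by simp only [Pi.neg_apply]; ring)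
  have hexp {u : ℂ} (hu : ‖u‖ ≤ M * T) : ‖exp u‖ ≤ Real.exp (M * T) :=
    (norm_exp_le_exp_norm u).trans (Real.exp_le_exp.mpr hu)
  have hderiv_le (t) (ht : t ∈ Ico 0 T) : ‖exp (-A t) * (v' t - a t * v t)‖ ≤
      Real.exp (M * T) * (ε * (‖v 0‖ * Real.exp ((M + 1) * T))) := by
    have ht' := Ico_subset_Icc_self ht
    rw [norm_mul]
    gcongr
    · exact hexp (by rw [norm_neg]; exact hAle t ht')
    · exact (hlin t ht' ((hvle t ht').trans hsmall)).trans (by gcongr; exact hvle t ht')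
  have hvar := norm_image_sub_le_of_norm_deriv_le_segment' hderiv hderiv_le T (right_mem_Icc.mpr hT)
  simp only [hA0, neg_zero, exp_zero, one_mul, sub_zero] at hvar
  have hid : v T / v 0 - exp (A T) = exp (A T) * (exp (-A T) * v T - v 0) / v 0 := by
    rw [mul_sub, ← mul_assoc, ← exp_add, add_neg_cancel, exp_zero, one_mul, sub_div,
      mul_div_cancel_right₀ _ hne]
  rw [hid, norm_div, norm_mul, div_le_iff₀ (norm_pos_iff.mpr hne)]
  calc _ ≤ Real.exp (M * T) *
        (Real.exp (M * T) * (ε * (‖v 0‖ * Real.exp ((M + 1) * T))) * T) := by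
        gcongr; exact hexp (hAle T (right_mem_Icc.mpr hT))
    _ = _ := by ring

theorem tendsto_div_of_linearized {ι : Type*} {l : Filter ι} {v v' : ι → ℝ → ℂ} (hT : 0 ≤ T)
    (hA : ∀ t ∈ Icc 0 T, HasDerivWithinAt A (a t) (Icc 0 T) t) (hA0 : A 0 = 0)
    (hM : ∀ t ∈ Icc 0 T, ‖a t‖ ≤ M)
    (hv : ∀ᶠ i in l, v i 0 ≠ 0 ∧ ∀ t ∈ Icc 0 T, HasDerivWithinAt (v i) (v' i t) (Icc 0 T) t)
    (hlin : ∀ ε > 0, ∃ δ > 0, ∀ᶠ i in l, ∀ t ∈ Icc 0 T,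
      ‖v i t‖ ≤ δ → ‖v' i t - a t * v i t‖ ≤ ε * ‖v i t‖)
    (h0 : Tendsto (fun i => v i 0) l (𝓝 0)) :
    Tendsto (fun i => v i T / v i 0) l (𝓝 (exp (A T))) := by
  rw [Metric.tendsto_nhds]
  intro η hη
  set K := Real.exp (M * T) ^ 2 * Real.exp ((M + 1) * T) * T
  have hK : Tendsto (fun ε => K * ε) (𝓝[>] 0) (𝓝 0) := by
    simpa using ((continuous_const_mul K).tendsto 0).mono_left nhdsWithin_le_nhds
  obtain ⟨ε, ⟨hε0, hε1⟩, hKε⟩ :=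
    (Filter.Eventually.and (Ioo_mem_nhdsGT one_pos) (hK.eventually_lt_const hη)).exists
  obtain ⟨δ, hδ, hlin⟩ := hlin ε hε0
  have hsmall : ∀ᶠ i in l, ‖v i 0‖ * Real.exp ((M + 1) * T) < δ := by
    have h := h0.norm.mul_const (Real.exp ((M + 1) * T))
    rw [norm_zero, zero_mul] at h
    exact h.eventually_lt_const hδ
  filter_upwards [hv, hlin, hsmall] with i ⟨hne, hderiv⟩ hlin hsmall
  rw [dist_eq]
  exact (norm_div_sub_exp_le hT hA hA0 hM hderiv hlin (le_of_lt hε0) hε1 hne hsmall.le).trans_lt hKε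

end

/-! ### The flow of a dissipative holomorphic vector field -/

theorem norm_le_of_dissipative {F : ℂ → ℂ} {x : ℝ → ℂ} {T : ℝ}
    (hF : ∀ w, (conj w * F w).re ≤ 0)
    (hx : ∀ t ∈ Icc 0 T, HasDerivWithinAt x (F (x t)) (Icc 0 T) t) :
    ∀ t ∈ Icc 0 T, ‖x t‖ ≤ ‖x 0‖ := by
  intro t ht
  have hderiv : ∀ s ∈ Icc 0 T, HasDerivWithinAt (fun s => ‖x s‖ ^ 2)
      (2 * (conj (x s) * F (x s)).re) (Icc 0 T) s := fun s hs =>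
    (hx s hs).norm_sq.congr_deriv (by rw [Complex.inner, mul_comm (F (x s))])
  have hanti : AntitoneOn (fun s => ‖x s‖ ^ 2) (Icc 0 T) := by
    refine antitoneOn_of_deriv_nonpos (convex_Icc 0 T)
      (fun s hs => (hderiv s hs).continuousWithinAt) (fun s hs => ?_) fun s hs => ?_
    · exact ((hderiv s (interior_subset hs)).mono interior_subset).differentiableWithinAt
    · rw [interior_Icc] at hs
      rw [((hderiv s (Ioo_subset_Icc_self hs)).hasDerivAt (Icc_mem_nhds hs.1 hs.2)).deriv]
      linarith [hF (x s)]
  exact (pow_le_pow_iff_left₀ (norm_nonneg _) (norm_nonneg _) two_ne_zero).mp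
    (hanti (left_mem_Icc.mpr (ht.1.trans ht.2)) ht ht.1)

theorem exists_solution_Icc_of_hasCompactSupport {H : ℂ → ℂ} (hH : ContDiff ℝ 1 H)
    (hsupp : HasCompactSupport H) (w₀ : ℂ) {T : ℝ} (hT : 0 ≤ T) :
    ∃ x : ℝ → ℂ, x 0 = w₀ ∧ ∀ t ∈ Icc 0 T, HasDerivWithinAt x (H (x t)) (Icc 0 T) t := by
  obtain ⟨K, hK⟩ := hH.lipschitzWith_of_hasCompactSupport hsupp one_ne_zero
  obtain ⟨L, hL⟩ := hsupp.exists_bound_of_continuous hH.continuous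
  have hL0 : 0 ≤ L := (norm_nonneg _).trans (hL 0)
  have hpl : IsPicardLindelof (fun _ => H) (tmin := 0) (tmax := T) ⟨0, left_mem_Icc.mpr hT⟩ w₀
      ⟨L * T, by positivity⟩ 0 ⟨L, hL0⟩ K := by
    refine IsPicardLindelof.of_time_independent (fun x _ => hL x) hK.lipschitzOnWith ?_
    change L * max (T - 0) (0 - 0) ≤ L * T - 0
    simp [hT]
  exact hpl.exists_eq_forall_mem_Icc_hasDerivWithinAt₀

section

variable {F : ℂ → ℂ} {w₀ : ℂ} {T r : ℝ}

-- Cut `F` off outside the disk of radius `(2 * ‖w₀‖ + 1) / 3`: dissipativity keeps the solution of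
-- the modified equation in the disk of radius `‖w₀‖`, where nothing was changed.
theorem exists_solution_Icc (hF : DifferentiableOn ℂ F unitDisk)
    (hdis : ∀ w ∈ unitDisk, (conj w * F w).re ≤ 0) (hw : w₀ ∈ unitDisk) (hT : 0 ≤ T) :
    ∃ x : ℝ → ℂ, x 0 = w₀ ∧ ∀ t ∈ Icc 0 T, ‖x t‖ ≤ ‖w₀‖ ∧
      HasDerivWithinAt x (F (x t)) (Icc 0 T) t := by
  have hw1 := mem_ball_zero_iff.mp hw
  let χ : ContDiffBump (0 : ℂ) := ⟨(2 * ‖w₀‖ + 1) / 3, (‖w₀‖ + 2) / 3, by positivity, by linarith⟩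
  have hχ : tsupport (χ : ℂ → ℝ) ⊆ unitDisk := by
    rw [χ.tsupport_eq]
    exact Metric.closedBall_subset_ball (by change (‖w₀‖ + 2) / 3 < 1; linarith)
  have hsmooth : ContDiff ℝ 1 fun w => χ w • F w := by
    refine contDiff_iff_contDiffAt.mpr fun w => ?_
    by_cases hw : w ∈ tsupport (χ : ℂ → ℝ)
    · have hFw := hF.analyticAt (Metric.isOpen_ball.mem_nhds (hχ hw))
      exact χ.contDiff.contDiffAt.smul (hFw.contDiffAt.restrict_scalars ℝ)
    · refine (contDiffAt_const (c := (0 : ℂ))).congr_of_eventuallyEq ?_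
      filter_upwards [notMem_tsupport_iff_eventuallyEq.mp hw] with u hu
      rw [hu, Pi.zero_apply, zero_smul]
  obtain ⟨x, hx0, hx⟩ := exists_solution_Icc_of_hasCompactSupport hsmooth
    χ.hasCompactSupport.smul_right w₀ hT
  have hdis' (w : ℂ) : (conj w * χ w • F w).re ≤ 0 := by
    rw [mul_smul_comm, smul_re]
    by_cases hw : w ∈ unitDisk
    · exact mul_nonpos_of_nonneg_of_nonpos χ.nonneg (hdis w hw)
    · rw [image_eq_zero_of_notMem_tsupport fun h => hw (hχ h), zero_smul]
  have hle := norm_le_of_dissipative hdis' hx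
  rw [hx0] at hle
  refine ⟨x, hx0, fun t ht => ⟨hle t ht, ?_⟩⟩
  have hone : χ (x t) = 1 := χ.one_of_mem_closedBall (by
    rw [mem_closedBall_zero_iff]
    change ‖x t‖ ≤ (2 * ‖w₀‖ + 1) / 3
    linarith [hle t ht])
  simpa only [hone, one_smul] using hx t ht

theorem exists_lipschitzOnWith_closedBall (hF : DifferentiableOn ℂ F unitDisk) (hr : r < 1) :
    ∃ K : NNReal, LipschitzOnWith K F (Metric.closedBall 0 r) := by
  have hsub : Metric.closedBall (0 : ℂ) r ⊆ unitDisk := Metric.closedBall_subset_ball hr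
  exact (((hF.contDiffOn Metric.isOpen_ball).restrict_scalars ℝ).mono hsub).exists_lipschitzOnWith
    one_ne_zero (convex_closedBall 0 r) (isCompact_closedBall 0 r)

theorem eqOn_of_solution (hF : DifferentiableOn ℂ F unitDisk) (hr : r < 1) {x y : ℝ → ℂ}
    (hx : ∀ t ∈ Icc 0 T, ‖x t‖ ≤ r ∧ HasDerivWithinAt x (F (x t)) (Icc 0 T) t)
    (hy : ∀ t ∈ Icc 0 T, ‖y t‖ ≤ r ∧ HasDerivWithinAt y (F (y t)) (Icc 0 T) t)
    (h0 : x 0 = y 0) : EqOn x y (Icc 0 T) := by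
  obtain ⟨K, hK⟩ := exists_lipschitzOnWith_closedBall hF hr
  have hright : ∀ z : ℝ → ℂ,
      (∀ t ∈ Icc 0 T, ‖z t‖ ≤ r ∧ HasDerivWithinAt z (F (z t)) (Icc 0 T) t) →
      ∀ t ∈ Ico 0 T, HasDerivWithinAt z (F (z t)) (Ici t) t := fun z hz t ht =>
    (hz t (Ico_subset_Icc_self ht)).2.mono_of_mem_nhdsWithin (Icc_mem_nhdsGE_of_mem ht)
  exact ODE_solution_unique_of_mem_Icc_right (v := fun _ => F)
    (s := fun _ => Metric.closedBall 0 r) (fun _ _ => hK)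
    (fun t ht => (hx t ht).2.continuousWithinAt) (hright x hx)
    (fun t ht => mem_closedBall_zero_iff.mpr (hx t (Ico_subset_Icc_self ht)).1)
    (fun t ht => (hy t ht).2.continuousWithinAt) (hright y hy)
    (fun t ht => mem_closedBall_zero_iff.mpr (hy t (Ico_subset_Icc_self ht)).1) h0

theorem exists_solution_Ici (hF : DifferentiableOn ℂ F unitDisk)
    (hdis : ∀ w ∈ unitDisk, (conj w * F w).re ≤ 0) (hw : w₀ ∈ unitDisk) :
    ∃ x : ℝ → ℂ, x 0 = w₀ ∧ ∀ t, 0 ≤ t → ‖x t‖ ≤ ‖w₀‖ ∧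
      HasDerivWithinAt x (F (x t)) (Ici 0) t := by
  choose! X hX0 hX using fun (T : ℝ) (hT : 0 ≤ T) => exists_solution_Icc hF hdis hw hT
  have hglue (s T : ℝ) (hs : 0 ≤ s) (hsT : s ≤ T) : X s s = X T s := by
    refine eqOn_of_solution hF (mem_ball_zero_iff.mp hw) (hX s hs) (fun t ht => ?_)
      ((hX0 s hs).trans (hX0 T (hs.trans hsT)).symm) (right_mem_Icc.mpr hs)
    have h := hX T (hs.trans hsT) t ⟨ht.1, ht.2.trans hsT⟩
    exact ⟨h.1, h.2.mono (Icc_subset_Icc_right hsT)⟩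
  refine ⟨fun t => X t t, hX0 0 le_rfl, fun t ht => ?_⟩
  have ht1 : t ≤ t + 1 := (lt_add_one t).le
  obtain ⟨hle, hderiv⟩ := hX (t + 1) (ht.trans ht1) t ⟨ht, ht1⟩
  rw [← hglue t (t + 1) ht ht1] at hle hderiv
  have hmem : Icc 0 (t + 1) ∈ 𝓝[Ici 0] t := by
    rw [← Ici_inter_Iic]
    exact inter_mem_nhdsWithin _ (Iic_mem_nhds (lt_add_one t))
  refine ⟨hle, (hderiv.mono_of_mem_nhdsWithin hmem).congr_of_eventuallyEq ?_
    (hglue t (t + 1) ht ht1)⟩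
  filter_upwards [hmem] with s hs
  exact hglue s (t + 1) hs.1 hs.2

theorem exists_forall_norm_sub_sub_le (hF : DifferentiableOn ℂ F unitDisk) (hr : r < 1) {ε : ℝ}
    (hε : 0 < ε) : ∃ δ > 0, ∀ a ∈ Metric.closedBall (0 : ℂ) r, ∀ b ∈ Metric.closedBall (0 : ℂ) r,
      ‖b - a‖ ≤ δ → ‖F b - F a - deriv F a * (b - a)‖ ≤ ε * ‖b - a‖ := by
  have hsub : Metric.closedBall (0 : ℂ) r ⊆ unitDisk := Metric.closedBall_subset_ball hr
  obtain ⟨δ, hδ, hcont⟩ := Metric.uniformContinuousOn_iff_le.mp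
    ((isCompact_closedBall (0 : ℂ) r).uniformContinuousOn_of_continuous
      ((hF.deriv Metric.isOpen_ball).continuousOn.mono hsub)) ε hε
  refine ⟨δ, hδ, fun a ha b hb hab => ?_⟩
  have h := ((convex_closedBall 0 r).inter
    (convex_closedBall a ‖b - a‖)).norm_image_sub_le_of_norm_hasDerivWithin_le
    (f := fun w => F w - deriv F a * w) (f' := fun w => deriv F w - deriv F a)
    (C := ε) (x := a) (y := b) (fun w hw => ?_) (fun w hw => ?_) ⟨ha, by simp⟩
    ⟨hb, by simp [dist_eq_norm]⟩
  · exact h.trans_eq' (congrArg norm (by ring))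
  · have hFw := hF.differentiableAt (Metric.isOpen_ball.mem_nhds (hsub hw.1))
    exact (hFw.hasDerivAt.sub (hasDerivAt_const_mul (deriv F a))).hasDerivWithinAt
  · rw [← dist_eq_norm]
    exact hcont w hw.1 a ha ((Metric.mem_closedBall.mp hw.2).trans hab)

end

/-- `ψ t w` is the value at time `t` of a solution of `x' = F x` that starts at the point `w` of the
disk and never exceeds its initial modulus. -/
structure IsContractiveFlow (F : ℂ → ℂ) (ψ : ℝ → ℂ → ℂ) : Prop where
  zero : ∀ w ∈ unitDisk, ψ 0 w = w
  norm_le : ∀ w ∈ unitDisk, ∀ t, 0 ≤ t → ‖ψ t w‖ ≤ ‖w‖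
  flow : ∀ w ∈ unitDisk, ∀ t, 0 ≤ t → HasDerivWithinAt (fun s => ψ s w) (F (ψ t w)) (Ici 0) t

theorem tendsto_sub_nhds_zero (s : Set ℂ) (q : ℂ) : Tendsto (fun z => z - q) (𝓝[s] q) (𝓝 0) := by
  simpa using ((continuous_sub_right q).tendsto q).mono_left nhdsWithin_le_nhds

namespace IsContractiveFlow

variable {F : ℂ → ℂ} {ψ : ℝ → ℂ → ℂ} {w : ℂ} {t : ℝ}

theorem mapsTo (h : IsContractiveFlow F ψ) (ht : 0 ≤ t) : MapsTo (ψ t) unitDisk unitDisk :=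
  fun w hw => mem_ball_zero_iff.mpr ((h.norm_le w hw t ht).trans_lt (mem_ball_zero_iff.mp hw))

theorem comp (h : IsContractiveFlow F ψ) (hF : DifferentiableOn ℂ F unitDisk) {s : ℝ} (hs : 0 ≤ s)
    (ht : 0 ≤ t) (hw : w ∈ unitDisk) : ψ s (ψ t w) = ψ (s + t) w := by
  have hwt := h.mapsTo ht hw
  refine eqOn_of_solution hF (x := fun u => ψ u (ψ t w)) (y := fun u => ψ (u + t) w)
    (mem_ball_zero_iff.mp hw) (fun u hu => ⟨?_, ?_⟩) (fun u hu => ⟨?_, ?_⟩)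
    (by simp only [zero_add, h.zero _ hwt]) (right_mem_Icc.mpr hs)
  · exact (h.norm_le _ hwt u hu.1).trans (h.norm_le w hw t ht)
  · exact (h.flow _ hwt u hu.1).mono Icc_subset_Ici_self
  · exact h.norm_le w hw _ (add_nonneg hu.1 ht)
  · have hshift := (h.flow w hw (u + t) (add_nonneg hu.1 ht)).scomp u
      ((hasDerivAt_id u).add_const t).hasDerivWithinAt
      (fun x (hx : x ∈ Icc 0 s) => mem_Ici.mpr (add_nonneg hx.1 ht))
    rwa [one_smul] at hshift

theorem differentiableAt (h : IsContractiveFlow F ψ) (hF : DifferentiableOn ℂ F unitDisk)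
    (ht : 0 ≤ t) (hw : w ∈ unitDisk) : DifferentiableAt ℂ (ψ t) w := by
  obtain ⟨r, hwr, hr⟩ := exists_between (mem_ball_zero_iff.mp hw)
  have hsub : Metric.closedBall (0 : ℂ) r ⊆ unitDisk := Metric.closedBall_subset_ball hr
  have hball : ∀ᶠ z in 𝓝[≠] w, z ∈ Metric.closedBall (0 : ℂ) r := nhdsWithin_le_nhds
    (mem_of_superset (Metric.isOpen_ball.mem_nhds (mem_ball_zero_iff.mpr hwr))
      Metric.ball_subset_closedBall)
  have hin (z) (hz : z ∈ Metric.closedBall (0 : ℂ) r) (s) (hs : 0 ≤ s) :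
      ψ s z ∈ Metric.closedBall (0 : ℂ) r :=
    mem_closedBall_zero_iff.mpr ((h.norm_le z (hsub hz) s hs).trans (mem_closedBall_zero_iff.mp hz))
  have hwr' : w ∈ Metric.closedBall (0 : ℂ) r := mem_closedBall_zero_iff.mpr hwr.le
  have hderiv := (hF.deriv Metric.isOpen_ball).continuousOn
  obtain ⟨M, hM⟩ := (isCompact_closedBall (0 : ℂ) r).exists_bound_of_continuousOn (hderiv.mono hsub)
  have hpath : Continuous fun s : ℝ => ψ (max s 0) w :=
    ContinuousOn.comp_continuous (s := Ici 0) (g := fun s => ψ s w)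
      (fun s hs => (h.flow w hw s hs).continuousWithinAt) (by fun_prop) fun s => le_max_right s 0
  have hcoef : Continuous fun s : ℝ => deriv F (ψ (max s 0) w) :=
    hderiv.comp_continuous hpath fun s => h.mapsTo (le_max_right s 0) hw
  have hlim := tendsto_div_of_linearized (l := 𝓝[≠] w) (v := fun z s => ψ s z - ψ s w)
    (v' := fun z s => F (ψ s z) - F (ψ s w)) (M := M) ht
    (fun s _ => (hcoef.integral_hasStrictDerivAt 0 s).hasDerivAt.hasDerivWithinAt)
    intervalIntegral.integral_same (fun s _ => hM _ (hin w hwr' _ (le_max_right s 0))) ?_ ?_ ?_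
  · refine (hasDerivAt_iff_tendsto_slope.mpr (hlim.congr' ?_)).differentiableAt
    filter_upwards [hball] with z hz
    rw [slope_def_field, h.zero w hw, h.zero z (hsub hz)]
  · filter_upwards [hball, self_mem_nhdsWithin] with z hz hne
    simp only [h.zero w hw, h.zero z (hsub hz)]
    exact ⟨sub_ne_zero.mpr hne, fun s hs => ((h.flow z (hsub hz) s hs.1).sub
      (h.flow w hw s hs.1)).mono Icc_subset_Ici_self⟩
  · intro ε hε
    obtain ⟨δ, hδ, hlin⟩ := exists_forall_norm_sub_sub_le hF hr hε
    refine ⟨δ, hδ, hball.mono fun z hz s hs => ?_⟩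
    rw [max_eq_left hs.1]
    exact hlin _ (hin w hwr' s hs.1) _ (hin z hz s hs.1)
  · refine (tendsto_sub_nhds_zero _ w).congr' (hball.mono fun z hz => ?_)
    simp only [h.zero w hw, h.zero z (hsub hz)]

theorem isGeneratorOf (h : IsContractiveFlow F ψ) (hF : DifferentiableOn ℂ F unitDisk) :
    IsGeneratorOf F ψ where
  semigroup :=
    { holo := fun _ ht _ hw => (h.differentiableAt hF ht hw).differentiableWithinAt
      mapsTo := fun _ ht => h.mapsTo ht
      zero := h.zero
      comp := fun _ _ hs ht _ hw => h.comp hF hs ht hw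
      cont := fun w hw => by
        have hcont := (h.flow w hw 0 le_rfl).continuousWithinAt.tendsto
        rw [h.zero w hw] at hcont
        exact hcont.mono_left (nhdsWithin_mono _ Ioi_subset_Ici_self) }
  holo := hF
  flow := h.flow

end IsContractiveFlow

theorem exists_isGeneratorOf_of_dissipative {F : ℂ → ℂ} (hF : DifferentiableOn ℂ F unitDisk)
    (hdis : ∀ w ∈ unitDisk, (conj w * F w).re ≤ 0) : ∃ ψ : ℝ → ℂ → ℂ, IsGeneratorOf F ψ := by
  choose! X hX0 hX using fun (w : ℂ) (hw : w ∈ unitDisk) => exists_solution_Ici hF hdis hw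
  have hflow : IsContractiveFlow F fun t w => X w t :=
    ⟨hX0, fun w hw t ht => (hX w hw t ht).1, fun w hw t ht => (hX w hw t ht).2⟩
  exact ⟨_, hflow.isGeneratorOf hF⟩

theorem IsGeneratorOf.conj_diskInvolution {F G : ℂ → ℂ} {ψ : ℝ → ℂ → ℂ} (hψ : IsGeneratorOf F ψ)
    {τ : ℂ} (hτ : τ ∈ unitDisk) (hG : DifferentiableOn ℂ G unitDisk)
    (hFG : ∀ w ∈ unitDisk, deriv (diskInvolution τ) w * F w = G (diskInvolution τ w)) :
    IsGeneratorOf G fun t z => diskInvolution τ (ψ t (diskInvolution τ z)) := by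
  have hmaps := mapsTo_diskInvolution hτ
  have hholo := differentiableOn_diskInvolution hτ
  have hinv (z) (hz : z ∈ unitDisk) := diskInvolution_diskInvolution hτ hz
  refine ⟨⟨fun t ht => ?_, fun t ht => ?_, fun z hz => ?_, fun s t hs ht z hz => ?_,
    fun z hz => ?_⟩, hG, fun z hz t ht => ?_⟩
  · exact hholo.comp ((hψ.semigroup.holo t ht).comp hholo hmaps)
      ((hψ.semigroup.mapsTo t ht).comp hmaps)
  · exact hmaps.comp ((hψ.semigroup.mapsTo t ht).comp hmaps)
  · rw [hψ.semigroup.zero _ (hmaps hz), hinv z hz]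
  · rw [hinv _ (hψ.semigroup.mapsTo t ht (hmaps hz)), hψ.semigroup.comp s t hs ht _ (hmaps hz)]
  · have hcont := (hasDerivAt_diskInvolution hτ (hmaps hz)).continuousAt.tendsto.comp
      (hψ.semigroup.cont _ (hmaps hz))
    rwa [hinv z hz] at hcont
  · have hw := hψ.semigroup.mapsTo t ht (hmaps hz)
    rw [← hFG _ hw]
    exact (hasDerivAt_diskInvolution hτ hw).differentiableAt.hasDerivAt.comp_hasDerivWithinAt t
      (hψ.flow _ (hmaps hz) t ht)

/-- The Berkson-Porta vector field with datum `p`: for `p` in the Carathéodory class, these are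
the generators of the semigroups that fix `τ`. -/
noncomputable def berksonPorta (τ : ℂ) (p : ℂ → ℂ) (z : ℂ) : ℂ :=
  (τ - z) * (1 - conj τ * z) * p z

theorem differentiableOn_berksonPorta {p : ℂ → ℂ} (hp : DifferentiableOn ℂ p unitDisk) (τ : ℂ) :
    DifferentiableOn ℂ (berksonPorta τ p) unitDisk := by
  unfold berksonPorta
  exact DifferentiableOn.mul (by fun_prop) hp

theorem deriv_diskInvolution_mul_eq_berksonPorta {τ w : ℂ} (hτ : τ ∈ unitDisk) (hw : w ∈ unitDisk)
    (p : ℂ → ℂ) :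
    deriv (diskInvolution τ) w * (((-(1 - ‖τ‖ ^ 2) : ℝ) : ℂ) * (w * p (diskInvolution τ w))) =
      berksonPorta τ p (diskInvolution τ w) := by
  have hne := one_sub_conj_mul_ne_zero hτ hw
  rw [berksonPorta, sub_diskInvolution hτ hw, one_sub_conj_mul_diskInvolution hτ hw,
    (hasDerivAt_diskInvolution hτ hw).deriv, ofReal_neg, ← one_sub_conj_mul_self]
  field_simp

theorem re_conj_mul_ofReal_mul (c : ℝ) (w p : ℂ) :
    (conj w * ((c : ℂ) * (w * p))).re = c * (‖w‖ ^ 2 * p.re) := by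
  rw [mul_left_comm, ← mul_assoc (conj w), conj_mul', ← ofReal_pow, re_ofReal_mul, re_ofReal_mul]

theorem exists_isGeneratorOf_of_berksonPorta {τ : ℂ} (hτ : τ ∈ unitDisk) {p : ℂ → ℂ}
    (hp : IsCaratheodory p) : ∃ φ : ℝ → ℂ → ℂ, IsGeneratorOf (berksonPorta τ p) φ := by
  have hmaps := mapsTo_diskInvolution hτ
  have hcomp := hp.comp (differentiableOn_diskInvolution hτ) hmaps
  obtain ⟨ψ, hψ⟩ := exists_isGeneratorOf_of_dissipative
    ((differentiableOn_id.mul hcomp.holo).const_mul ((-(1 - ‖τ‖ ^ 2) : ℝ) : ℂ))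
    fun w hw => by
      rw [Pi.mul_apply, id, re_conj_mul_ofReal_mul]
      exact mul_nonpos_of_nonpos_of_nonneg (neg_nonpos.mpr (one_sub_sq_norm_pos hτ).le)
        (mul_nonneg (by positivity) (hcomp.re_nonneg w hw))
  exact ⟨_, hψ.conj_diskInvolution hτ (differentiableOn_berksonPorta hp.holo τ)
    fun w hw => deriv_diskInvolution_mul_eq_berksonPorta hτ hw p⟩

theorem IsGeneratorOf.congr {G G' : ℂ → ℂ} {φ : ℝ → ℂ → ℂ} (hg : IsGeneratorOf G φ)
    (h : EqOn G' G unitDisk) : IsGeneratorOf G' φ where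
  semigroup := hg.semigroup
  holo := hg.holo.congr h
  flow z hz t ht := by
    rw [h (hg.semigroup.mapsTo t ht hz)]
    exact hg.flow z hz t ht

/-! ### Semigroups near a zero of the generator -/

theorem IsGeneratorOf.tendsto_div_of_isLittleO {G : ℂ → ℂ} {φ : ℝ → ℂ → ℂ} (hg : IsGeneratorOf G φ)
    {q c : ℂ} (hG : (fun z => G z - c * (z - q)) =o[𝓝[unitDisk] q] fun z => z - q)
    {T : ℝ} (hT : 0 ≤ T) :
    Tendsto (fun z => (φ T z - q) / (z - q)) (𝓝[unitDisk \ {q}] q) (𝓝 (exp (c * T))) := by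
  have hlim := tendsto_div_of_linearized (l := 𝓝[unitDisk \ {q}] q) (v := fun z t => φ t z - q)
    (v' := fun z t => G (φ t z)) (a := fun _ => c) (A := fun t : ℝ => c * t) (M := ‖c‖) hT
    (fun t _ => ?_) (by simp) (fun _ _ => le_rfl) ?_ ?_ ?_
  · refine hlim.congr' (eventually_nhdsWithin_of_forall fun z hz => ?_)
    rw [hg.semigroup.zero z hz.1]
  · simpa using ((ofRealCLM.hasDerivAt (x := t)).const_mul c).hasDerivWithinAt
  · refine eventually_nhdsWithin_of_forall fun z hz => ?_
    rw [hg.semigroup.zero z hz.1]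
    exact ⟨sub_ne_zero.mpr hz.2, fun t ht =>
      ((hg.flow z hz.1 t ht.1).mono Icc_subset_Ici_self).sub_const q⟩
  · intro ε hε
    obtain ⟨δ, hδ, hball⟩ := Metric.mem_nhdsWithin_iff.mp (hG.def hε)
    refine ⟨δ / 2, half_pos hδ, eventually_nhdsWithin_of_forall fun z hz t ht hle => ?_⟩
    exact hball ⟨mem_ball_iff_norm.mpr (hle.trans_lt (half_lt_self hδ)),
      hg.semigroup.mapsTo t ht.1 hz.1⟩
  · refine (tendsto_sub_nhds_zero _ q).congr' (eventually_nhdsWithin_of_forall fun z hz => ?_)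
    simp only [hg.semigroup.zero z hz.1]

theorem IsGeneratorOf.apply_eq_self {G : ℂ → ℂ} {φ : ℝ → ℂ → ℂ} (hg : IsGeneratorOf G φ)
    {τ : ℂ} (hτ : τ ∈ unitDisk) (h0 : G τ = 0) {T : ℝ} (hT : 0 ≤ T) : φ T τ = τ := by
  have hderiv : ∀ t ∈ Icc 0 T, HasDerivWithinAt (fun s => φ s τ) (G (φ t τ)) (Icc 0 T) t :=
    fun t ht => (hg.flow τ hτ t ht.1).mono Icc_subset_Ici_self
  obtain ⟨s, hs, hmax⟩ := isCompact_Icc.exists_isMaxOn (nonempty_Icc.mpr hT)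
    (f := fun t => ‖φ t τ‖) (fun t ht => (hderiv t ht).continuousWithinAt.norm)
  have hτs : ‖τ‖ ≤ ‖φ s τ‖ := by
    simpa [hg.semigroup.zero τ hτ] using hmax (left_mem_Icc.mpr hT)
  exact eqOn_of_solution hg.holo (mem_ball_zero_iff.mp (hg.semigroup.mapsTo s hs.1 hτ))
    (x := fun t => φ t τ) (y := fun _ => τ) (fun t ht => ⟨hmax ht, hderiv t ht⟩)
    (fun t _ => ⟨hτs, by rw [h0]; exact hasDerivWithinAt_const _ _ _⟩)
    (hg.semigroup.zero τ hτ) (right_mem_Icc.mpr hT)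

theorem IsGeneratorOf.hasDerivAt_of_zero {G : ℂ → ℂ} {φ : ℝ → ℂ → ℂ} (hg : IsGeneratorOf G φ)
    {τ : ℂ} (hτ : τ ∈ unitDisk) (h0 : G τ = 0) {T : ℝ} (hT : 0 ≤ T) :
    HasDerivAt (φ T) (exp (deriv G τ * T)) τ := by
  have hnhds : unitDisk ∈ 𝓝 τ := Metric.isOpen_ball.mem_nhds hτ
  have hG : (fun z => G z - deriv G τ * (z - τ)) =o[𝓝[unitDisk] τ] fun z => z - τ := by
    have h := (hg.holo.differentiableAt hnhds).hasDerivAt.hasDerivWithinAt.isLittleO (s := unitDisk)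
    simpa only [h0, sub_zero, smul_eq_mul, mul_comm] using h
  have h := hg.tendsto_div_of_isLittleO hG hT
  rw [sdiff_eq, inter_comm, nhdsWithin_inter_of_mem' (mem_nhdsWithin_of_mem_nhds hnhds)] at h
  refine hasDerivAt_iff_tendsto_slope.mpr (h.congr fun z => ?_)
  rw [slope_def_field, hg.apply_eq_self hτ h0 hT]

theorem eq_of_exp_mul_eq {a b : ℂ} (h : ∀ t : ℝ, 0 ≤ t → exp (a * t) = exp (b * t)) : a = b := by
  have hderiv (c : ℂ) : HasDerivWithinAt (fun t : ℝ => exp (c * t)) c (Ici 0) 0 := by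
    simpa using ((ofRealCLM.hasDerivAt (x := 0)).const_mul c).cexp.hasDerivWithinAt
  exact (uniqueDiffOn_Ici (0 : ℝ) 0 self_mem_Ici).eq_deriv _ (hderiv a)
    ((hderiv b).congr h (h 0 le_rfl))

theorem IsGeneratorOf.hasSpectralValue_iff {G : ℂ → ℂ} {φ : ℝ → ℂ → ℂ} (hg : IsGeneratorOf G φ)
    {τ : ℂ} (hτ : τ ∈ unitDisk) (h0 : G τ = 0) (w : ℂ) :
    HasSpectralValue G τ w ↔ w = -deriv G τ := by
  refine ⟨?_, ?_⟩
  · rintro ⟨φ', hg', hw⟩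
    refine neg_eq_iff_eq_neg.mp (eq_of_exp_mul_eq fun t ht => ?_)
    rw [← (hg'.hasDerivAt_of_zero hτ h0 ht).deriv, hw t ht, neg_mul]
  · rintro rfl
    refine ⟨φ, hg, fun t ht => ?_⟩
    rw [(hg.hasDerivAt_of_zero hτ h0 ht).deriv, neg_mul, neg_neg]

/-! ### The Berkson-Porta representation -/

theorem deriv_diskInvolution_mul_berksonPorta {τ w : ℂ} (hτ : τ ∈ unitDisk) (hw : w ∈ unitDisk)
    (p : ℂ → ℂ) :
    deriv (diskInvolution τ) w * berksonPorta τ p w =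
      ((-(1 - ‖τ‖ ^ 2) : ℝ) : ℂ) * (diskInvolution τ w * p w) := by
  have hne := one_sub_conj_mul_ne_zero hτ hw
  rw [berksonPorta, diskInvolution, (hasDerivAt_diskInvolution hτ hw).deriv, ofReal_neg,
    ← one_sub_conj_mul_self]
  field_simp

theorem exists_eq_berksonPorta {G : ℂ → ℂ} (hG : DifferentiableOn ℂ G unitDisk) {τ : ℂ}
    (hτ : τ ∈ unitDisk) (h0 : G τ = 0) :
    ∃ p : ℂ → ℂ, DifferentiableOn ℂ p unitDisk ∧ EqOn G (berksonPorta τ p) unitDisk := by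
  have hne (z) (hz : z ∈ unitDisk) := one_sub_conj_mul_ne_zero hτ hz
  refine ⟨fun z => -dslope G τ z / (1 - conj τ * z), ?_, fun z hz => ?_⟩
  · exact ((Complex.differentiableOn_dslope (Metric.isOpen_ball.mem_nhds hτ)).mpr hG).neg.div
      (by fun_prop) hne
  · have hslope := sub_smul_dslope G τ z
    rw [h0, sub_zero, smul_eq_mul] at hslope
    rw [berksonPorta, mul_assoc, mul_div_cancel₀ _ (hne z hz), ← hslope]
    ring

theorem IsGeneratorOf.re_conj_mul_nonpos {F : ℂ → ℂ} {ψ : ℝ → ℂ → ℂ} (hψ : IsGeneratorOf F ψ)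
    (hfix : ∀ t, 0 ≤ t → ψ t 0 = 0) {w : ℂ} (hw : w ∈ unitDisk) : (conj w * F w).re ≤ 0 := by
  have hmax : IsMaxOn (fun t => ‖ψ t w‖ ^ 2) (Ici 0) 0 := fun t ht => by
    have hle := Complex.norm_le_norm_of_mapsTo_ball (hψ.semigroup.holo t ht)
      ((hψ.semigroup.mapsTo t ht).mono_right Metric.ball_subset_closedBall) (hfix t ht)
      (mem_ball_zero_iff.mp hw)
    simpa only [mem_ofPred_eq, hψ.semigroup.zero w hw] using
      pow_le_pow_left₀ (norm_nonneg _) hle 2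
  have hcone : (1 : ℝ) ∈ posTangentConeAt (Ici 0) 0 :=
    mem_posTangentConeAt_of_segment_subset ((convex_Ici 0).segment_subset self_mem_Ici (by simp))
  have hderiv := hmax.localize.hasFDerivWithinAt_nonpos
    (hψ.flow w hw 0 le_rfl).norm_sq.hasFDerivWithinAt hcone
  simp only [hψ.semigroup.zero w hw, Complex.inner, ContinuousLinearMap.toSpanSingleton_apply,
    one_smul] at hderiv
  rw [mul_comm]
  linarith

theorem isCaratheodory_of_re_nonneg_of_ne {p : ℂ → ℂ} (hp : DifferentiableOn ℂ p unitDisk) {τ : ℂ}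
    (hre : ∀ z ∈ unitDisk, z ≠ τ → 0 ≤ (p z).re) : IsCaratheodory p := by
  refine ⟨hp, fun z hz => ?_⟩
  rcases eq_or_ne z τ with rfl | hzτ
  · have hnhds := Metric.isOpen_ball.mem_nhds hz
    have hcont : Tendsto (fun w => (p w).re) (𝓝[≠] z) (𝓝 (p z).re) :=
      (continuous_re.tendsto _).comp
        ((hp.differentiableAt hnhds).continuousAt.tendsto.mono_left nhdsWithin_le_nhds)
    refine ge_of_tendsto hcont ?_
    filter_upwards [self_mem_nhdsWithin, mem_nhdsWithin_of_mem_nhds hnhds] with w hne hw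
    exact hre w hw hne
  · exact hre z hz hzτ

theorem IsGeneratorOf.apply_eq_zero {G : ℂ → ℂ} {φ : ℝ → ℂ → ℂ} (hg : IsGeneratorOf G φ)
    {τ : ℂ} (hτ : τ ∈ unitDisk) (hfix : ∀ t, 0 ≤ t → φ t τ = τ) : G τ = 0 := by
  have hflow := hg.flow τ hτ 0 le_rfl
  rw [hfix 0 le_rfl] at hflow
  exact (uniqueDiffOn_Ici (0 : ℝ) 0 self_mem_Ici).eq_deriv _ hflow
    ((hasDerivWithinAt_const (0 : ℝ) (Ici 0) τ).congr hfix (hfix 0 le_rfl))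

theorem IsGeneratorOf.exists_berksonPorta {G : ℂ → ℂ} {φ : ℝ → ℂ → ℂ} (hg : IsGeneratorOf G φ)
    {τ : ℂ} (hτ : τ ∈ unitDisk) (hfix : ∀ t, 0 ≤ t → φ t τ = τ) :
    ∃ p : ℂ → ℂ, IsCaratheodory p ∧ EqOn G (berksonPorta τ p) unitDisk := by
  obtain ⟨p, hp, hGp⟩ := exists_eq_berksonPorta hg.holo hτ (hg.apply_eq_zero hτ hfix)
  have hmaps := mapsTo_diskInvolution hτ
  have hconj : IsGeneratorOf (fun w => ((-(1 - ‖τ‖ ^ 2) : ℝ) : ℂ) * (w * p (diskInvolution τ w)))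
      fun t z => diskInvolution τ (φ t (diskInvolution τ z)) :=
    hg.conj_diskInvolution hτ ((differentiableOn_id.mul
      (hp.comp (differentiableOn_diskInvolution hτ) hmaps)).const_mul _) fun w hw => by
        rw [hGp hw, deriv_diskInvolution_mul_berksonPorta hτ hw,
          diskInvolution_diskInvolution hτ hw]
  refine ⟨p, isCaratheodory_of_re_nonneg_of_ne (τ := τ) hp fun z hz hzτ => ?_, hGp⟩
  have hle := hconj.re_conj_mul_nonpos (fun t ht => by simp [hfix t ht]) (hmaps hz)
  rw [re_conj_mul_ofReal_mul, diskInvolution_diskInvolution hτ hz] at hle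
  have hne : diskInvolution τ z ≠ 0 :=
    div_ne_zero (sub_ne_zero.mpr hzτ.symm) (one_sub_conj_mul_ne_zero hτ hz)
  have hpos := one_sub_sq_norm_pos hτ
  have hmul := nonneg_of_neg_nonpos (neg_mul (1 - ‖τ‖ ^ 2) _ ▸ hle)
  exact nonneg_of_mul_nonneg_right (nonneg_of_mul_nonneg_right hmul hpos)
    (pow_pos (norm_pos_iff.mpr hne) 2)

theorem hasDerivAt_berksonPorta {τ : ℂ} {p : ℂ → ℂ} (hp : DifferentiableAt ℂ p τ) :
    HasDerivAt (berksonPorta τ p) (-(((1 - ‖τ‖ ^ 2 : ℝ) : ℂ) * p τ)) τ := by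
  have h := (((hasDerivAt_id τ).const_sub τ).mul
    (((hasDerivAt_id τ).const_mul (conj τ)).const_sub 1)).mul hp.hasDerivAt
  refine h.congr_deriv ?_
  simp only [id, sub_self, Pi.mul_apply, zero_mul, mul_one, add_zero]
  rw [← one_sub_conj_mul_self]
  ring

theorem isSemigroupDWPoint_of_berksonPorta {τ : ℂ} (hτ : τ ∈ unitDisk) {p : ℂ → ℂ}
    (hp : IsCaratheodory p) {φ : ℝ → ℂ → ℂ} (hg : IsGeneratorOf (berksonPorta τ p) φ) :
    IsSemigroupDWPoint φ τ := by
  intro t ht _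
  have h0 : berksonPorta τ p τ = 0 := by simp [berksonPorta]
  refine Or.inl ⟨hτ, hg.apply_eq_self hτ h0 ht, ?_⟩
  have hpτ := hp.holo.differentiableAt (Metric.isOpen_ball.mem_nhds hτ)
  rw [(hg.hasDerivAt_of_zero hτ h0 ht).deriv, (hasDerivAt_berksonPorta hpτ).deriv, norm_exp,
    Real.exp_le_one_iff, re_mul_ofReal, neg_re, re_ofReal_mul, neg_mul, neg_nonpos]
  exact mul_nonneg (mul_nonneg (one_sub_sq_norm_pos hτ).le (hp.re_nonneg τ hτ)) ht

theorem IsSemigroupDWPoint.apply_eq_self {φ : ℝ → ℂ → ℂ} {τ : ℂ} (h : IsSemigroupDWPoint φ τ)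
    (hτ : τ ∈ unitDisk) {t : ℝ} (ht : 0 ≤ t) : φ t τ = τ := by
  by_cases hid : EqOn (φ t) id unitDisk
  · exact hid hτ
  · rcases h t ht hid with hfix | ⟨-, d, -, hbdry, -⟩
    · exact hfix.2.1
    · exact absurd hbdry (mem_ball_zero_iff.mp hτ).ne

theorem hasSpectralValue_iff_of_berksonPorta {τ : ℂ} (hτ : τ ∈ unitDisk) {p : ℂ → ℂ}
    {φ : ℝ → ℂ → ℂ} (hg : IsGeneratorOf (berksonPorta τ p) φ) (hp : IsCaratheodory p) (w : ℂ) :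
    HasSpectralValue (berksonPorta τ p) τ w ↔ w = ((1 - ‖τ‖ ^ 2 : ℝ) : ℂ) * p τ := by
  have hpτ := hp.holo.differentiableAt (Metric.isOpen_ball.mem_nhds hτ)
  rw [hg.hasSpectralValue_iff hτ (by simp [berksonPorta]), (hasDerivAt_berksonPorta hpτ).deriv,
    neg_neg]

/-! ### Boundary regular fixed points -/

theorem hasAngularLimit_of_tendsto {f : ℂ → ℂ} {σ L : ℂ}
    (h : Tendsto f (𝓝[unitDisk] σ) (𝓝 L)) : HasAngularLimit f σ L :=
  fun _ => h.mono_left (nhdsWithin_mono _ fun _ hz => mem_ball_zero_iff.mpr hz.1)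

section

variable {σ : ℂ}

theorem hasBoundaryFixedPoint_of_tendsto (hσ : ‖σ‖ = 1) {f : ℂ → ℂ} {d : ℂ}
    (h : Tendsto (fun z => (f z - σ) / (z - σ)) (𝓝[unitDisk] σ) (𝓝 d)) :
    HasBoundaryFixedPoint f σ d := by
  refine ⟨hσ, hasAngularLimit_of_tendsto ?_, hasAngularLimit_of_tendsto h⟩
  have hlim := (h.mul (tendsto_sub_nhds_zero unitDisk σ)).add_const σ
  rw [mul_zero, zero_add] at hlim
  refine hlim.congr' (eventually_nhdsWithin_of_forall fun z hz => ?_)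
  have hne : z - σ ≠ 0 := sub_ne_zero.mpr (sub_ne_zero.mp (sub_ne_zero_of_norm_eq_one hσ hz)).symm
  rw [div_mul_cancel₀ _ hne, sub_add_cancel]

theorem IsGeneratorOf.hasBRFPWithSpectralValue {G : ℂ → ℂ} {φ : ℝ → ℂ → ℂ}
    (hg : IsGeneratorOf G φ) (hσ : ‖σ‖ = 1) {l : ℝ}
    (h : Tendsto (fun z => G z / (σ - z)) (𝓝[unitDisk] σ) (𝓝 (l : ℂ))) :
    HasBRFPWithSpectralValue G φ σ l := by
  refine ⟨fun t ht => ⟨exp (-l * t), hasBoundaryFixedPoint_of_tendsto hσ ?_⟩,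
    hasAngularLimit_of_tendsto h⟩
  have hlittle : (fun z => G z - -(l : ℂ) * (z - σ)) =o[𝓝[unitDisk] σ] fun z => z - σ := by
    have hquot := (Asymptotics.isLittleO_one_iff ℂ).mpr (tendsto_sub_nhds_zero_iff.mpr h)
    have hmul := hquot.mul_isBigO (Asymptotics.isBigO_refl (fun z => σ - z) (𝓝[unitDisk] σ))
    refine (hmul.congr' (eventually_nhdsWithin_of_forall fun z hz => ?_)
      (Eventually.of_forall fun z => one_mul _)).trans_isBigO ?_
    · have hne := sub_ne_zero_of_norm_eq_one hσ hz
      field_simp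
      ring
    · exact Asymptotics.isBigO_of_le _ fun z => (norm_sub_rev _ _).le
  have hσ' : σ ∉ unitDisk := fun hmem => (mem_ball_zero_iff.mp hmem).ne hσ
  simpa only [sdiff_singleton_eq_self hσ'] using hg.tendsto_div_of_isLittleO hlittle ht

theorem sub_mul_one_sub_conj_mul_of_norm_eq_one (hσ : ‖σ‖ = 1) (τ : ℂ) :
    (τ - σ) * (1 - conj τ * σ) = -(σ * ((‖τ - σ‖ ^ 2 : ℝ) : ℂ)) := by
  rw [ofReal_pow, ← mul_conj', map_sub]
  linear_combination (-(τ - σ)) * conj_mul_self_of_norm_eq_one hσ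

end

section

variable {σ : ℂ}

theorem tendsto_ofReal_mul_nhdsWithin_stolz (hσ : ‖σ‖ = 1) :
    Tendsto (fun r : ℝ => (r : ℂ) * σ) (𝓝[<] 1) (𝓝[stolz σ 2] σ) := by
  refine tendsto_nhdsWithin_iff.mpr ⟨?_, ?_⟩
  · have hcont : Continuous fun r : ℝ => (r : ℂ) * σ := by fun_prop
    simpa only [ofReal_one, one_mul] using hcont.continuousWithinAt (x := 1) (s := Iio 1) |>.tendsto
  · filter_upwards [Ioo_mem_nhdsLT one_pos] with r hr
    have hnorm : ‖(r : ℂ) * σ‖ = r := by rw [norm_mul, hσ, mul_one, Complex.norm_of_nonneg hr.1.le]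
    have hdist : ‖(r : ℂ) * σ - σ‖ = 1 - r := by
      rw [← sub_one_mul, norm_mul, hσ, mul_one, norm_sub_rev, ← ofReal_one, ← ofReal_sub,
        Complex.norm_of_nonneg (sub_pos.mpr hr.2).le]
    refine ⟨by rw [hnorm]; exact hr.2, ?_⟩
    rw [hnorm, hdist]
    linarith [hr.2]

theorem tendsto_one_sub_ofReal :
    Tendsto (fun r : ℝ => ((1 - r : ℝ) : ℂ)) (𝓝[<] 1) (𝓝 0) := by
  have hcont : Continuous fun r : ℝ => ((1 - r : ℝ) : ℂ) := by fun_prop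
  simpa only [sub_self, ofReal_zero] using hcont.continuousWithinAt (x := 1) (s := Iio 1) |>.tendsto

theorem one_sub_ofReal_ne_zero {r : ℝ} (hr : r < 1) : ((1 - r : ℝ) : ℂ) ≠ 0 :=
  ofReal_ne_zero.mpr (sub_pos.mpr hr).ne'

theorem tendsto_div_one_sub_of_hasAngularLimit {τ : ℂ} (hτ : τ ∈ unitDisk) (hσ : ‖σ‖ = 1)
    {p G : ℂ → ℂ} (hG : EqOn G (berksonPorta τ p) unitDisk) {l : ℝ}
    (hl : HasAngularLimit (fun z => G z / (σ - z)) σ l) :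
    Tendsto (fun r : ℝ => p (r * σ) / ((1 - r : ℝ) : ℂ)) (𝓝[<] 1)
      (𝓝 ((-l / ‖τ - σ‖ ^ 2 : ℝ) : ℂ)) := by
  have hσ0 : σ ≠ 0 := norm_ne_zero_iff.mp (by rw [hσ]; exact one_ne_zero)
  have hd : ((‖τ - σ‖ ^ 2 : ℝ) : ℂ) ≠ 0 := by
    rw [norm_sub_rev]
    exact ofReal_ne_zero.mpr
      (pow_ne_zero 2 (norm_ne_zero_iff.mpr (sub_ne_zero_of_norm_eq_one hσ hτ)))
  have hne : -(σ * ((‖τ - σ‖ ^ 2 : ℝ) : ℂ)) ≠ 0 := neg_ne_zero.mpr (mul_ne_zero hσ0 hd)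
  have hfactor : Tendsto (fun r : ℝ => (τ - r * σ) * (1 - conj τ * (r * σ))) (𝓝[<] 1)
      (𝓝 (-(σ * ((‖τ - σ‖ ^ 2 : ℝ) : ℂ)))) := by
    have hcont : Continuous fun r : ℝ => (τ - r * σ) * (1 - conj τ * (r * σ)) := by fun_prop
    simpa only [ofReal_one, one_mul, sub_mul_one_sub_conj_mul_of_norm_eq_one hσ] using
      hcont.continuousWithinAt (x := 1) (s := Iio 1) |>.tendsto
  have hquot := (((hl 2).comp (tendsto_ofReal_mul_nhdsWithin_stolz hσ)).div hfactor hne).mul_const σ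
  have hval : (l : ℂ) / -(σ * ((‖τ - σ‖ ^ 2 : ℝ) : ℂ)) * σ = ((-l / ‖τ - σ‖ ^ 2 : ℝ) : ℂ) := by
    rw [ofReal_div]
    push_cast at hd ⊢
    field_simp
  rw [hval] at hquot
  refine hquot.congr' ?_
  filter_upwards [hfactor.eventually_ne hne, Ioo_mem_nhdsLT one_pos] with r hr hr1
  have h1r := one_sub_ofReal_ne_zero hr1.2
  have hsub : σ - r * σ = ((1 - r : ℝ) : ℂ) * σ := by push_cast; ring
  simp only [Function.comp, Pi.div_apply]
  rw [hG (ofReal_mul_mem_unitDisk hσ hr1), berksonPorta, hsub]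
  generalize (τ - r * σ) * (1 - conj τ * (r * σ)) = N at hr
  field_simp

end

/-! ### The class `Gen` in terms of Carathéodory functions -/

namespace IsCaratheodory

variable {f : ℂ → ℂ} {σ : ℂ} {b : ℝ}

theorem inv (hf : IsCaratheodory f) (hne : ∀ z ∈ unitDisk, f z ≠ 0) : IsCaratheodory f⁻¹ where
  holo := hf.holo.inv hne
  re_nonneg z hz := by
    rw [Pi.inv_apply, inv_re]
    exact div_nonneg (hf.re_nonneg z hz) (normSq_nonneg _)

theorem one_sub_sq_norm_mul_re_le (hf : IsCaratheodory f) {z : ℂ} (hz : z ∈ unitDisk) :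
    (1 - ‖z‖ ^ 2) * (f 0).re ≤ 4 * (f z).re := by
  rcases (hf.re_nonneg 0 (by simp)).eq_or_lt with h0 | h0
  · rw [← h0, mul_zero]
    linarith [hf.re_nonneg z hz]
  have hharnack := hf.harnack hz (w := 0) (by simp)
  simp only [norm_zero, map_zero, zero_mul, sub_zero, norm_one, one_pow, mul_one, ne_eq,
    OfNat.ofNat_ne_zero, not_false_eq_true, zero_pow, one_mul] at hharnack
  have hsum : (f 0).re ≤ ‖f z + conj (f 0)‖ := by
    refine le_trans ?_ (re_le_norm _)
    rw [add_re, conj_re]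
    linarith [hf.re_nonneg z hz]
  have hsq := mul_le_mul_of_nonneg_left (pow_le_pow_left₀ h0.le hsum 2)
    (one_sub_sq_norm_pos hz).le
  refine le_of_mul_le_mul_right ?_ h0
  linarith

theorem tendsto_zero_of_tendsto_div
    (hlim : Tendsto (fun r : ℝ => f (r * σ) / ((1 - r : ℝ) : ℂ)) (𝓝[<] 1) (𝓝 (b : ℂ))) :
    Tendsto (fun r : ℝ => f (r * σ)) (𝓝[<] 1) (𝓝 0) := by
  have hmul := hlim.mul tendsto_one_sub_ofReal
  rw [mul_zero] at hmul
  refine hmul.congr' ?_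
  filter_upwards [self_mem_nhdsWithin] with r hr
  exact div_mul_cancel₀ _ (one_sub_ofReal_ne_zero hr)

theorem re_apply_zero_pos_of_tendsto_div (hf : IsCaratheodory f) (hσ : ‖σ‖ = 1)
    (hlim : Tendsto (fun r : ℝ => f (r * σ) / ((1 - r : ℝ) : ℂ)) (𝓝[<] 1) (𝓝 (b : ℂ)))
    (hne : ¬ EqOn f 0 unitDisk) : 0 < (f 0).re := by
  refine (hf.re_nonneg 0 (by simp)).lt_of_ne fun h0 => hne ?_
  have hconst := hf.eqOn_const_of_re_eq_zero (w := 0) (by simp) h0.symm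
  have hzero : f 0 = 0 := by
    refine tendsto_nhds_unique (tendsto_const_nhds.congr' ?_) (tendsto_zero_of_tendsto_div hlim)
    filter_upwards [Ioo_mem_nhdsLT one_pos] with r hr
    exact (hconst (ofReal_mul_mem_unitDisk hσ hr)).symm
  exact fun z hz => (hconst hz).trans hzero

theorem pos_of_tendsto_div (hf : IsCaratheodory f) (hpos : 0 < (f 0).re) (hσ : ‖σ‖ = 1)
    (hlim : Tendsto (fun r : ℝ => f (r * σ) / ((1 - r : ℝ) : ℂ)) (𝓝[<] 1) (𝓝 (b : ℂ))) :
    0 < b := by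
  have hbound : ∀ᶠ r : ℝ in 𝓝[<] 1,
      (f 0).re / 4 ≤ (f (r * σ) / ((1 - r : ℝ) : ℂ)).re := by
    filter_upwards [Ioo_mem_nhdsLT one_pos] with r hr
    have h := hf.one_sub_sq_norm_mul_re_le (ofReal_mul_mem_unitDisk hσ hr)
    rw [norm_mul, hσ, mul_one, Complex.norm_of_nonneg hr.1.le] at h
    rw [div_ofReal_re, le_div_iff₀ (sub_pos.mpr hr.2)]
    nlinarith [mul_pos (mul_pos hr.1 (sub_pos.mpr hr.2)) hpos]
  have hle := ge_of_tendsto ((continuous_re.tendsto _).comp hlim) hbound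
  rw [ofReal_re] at hle
  linarith

theorem sub_sum {ι : Type*} (hf : IsCaratheodory f) {σ : ι → ℂ} (hσ : ∀ k, ‖σ k‖ = 1)
    (hinj : Function.Injective σ) {a β : ι → ℝ}
    (hlim : ∀ k, Tendsto (fun r : ℝ => ((1 - r : ℝ) : ℂ) * f (r * σ k)) (𝓝[<] 1)
      (𝓝 (β k : ℂ))) (ha : ∀ k, 2 * a k ≤ β k) (s : Finset ι) :
    IsCaratheodory fun z => f z - ∑ k ∈ s, (a k : ℂ) * ((σ k + z) / (σ k - z)) := by
  classical
  induction s using Finset.induction_on with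
  | empty => simpa only [Finset.sum_empty, sub_zero] using hf
  | insert k s hk ih =>
    refine ⟨hf.holo.sub (DifferentiableOn.fun_sum fun j _ => DifferentiableOn.const_mul
      (DifferentiableOn.div (by fun_prop) (by fun_prop)
        fun z hz => sub_ne_zero_of_norm_eq_one (hσ j) hz) _), fun z hz => ?_⟩
    -- The poles already removed at the other points do not affect the radial limit at `σ k`.
    have hregular : Tendsto (fun r : ℝ => ∑ j ∈ s, (a j : ℂ) *
        ((σ j + r * σ k) / (σ j - r * σ k))) (𝓝[<] 1)
        (𝓝 (∑ j ∈ s, (a j : ℂ) * ((σ j + (1 : ℝ) * σ k) / (σ j - (1 : ℝ) * σ k)))) := by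
      refine tendsto_nhdsWithin_of_tendsto_nhds (tendsto_finsetSum _ fun j hj =>
        (Tendsto.div (Continuous.tendsto (by fun_prop) 1) (Continuous.tendsto (by fun_prop) 1)
          ?_).const_mul _)
      rw [ofReal_one, one_mul]
      exact sub_ne_zero.mpr fun h => hk (hinj h ▸ hj)
    have hlim' := (hlim k).sub (tendsto_one_sub_ofReal.mul hregular)
    rw [zero_mul, sub_zero] at hlim'
    have hjulia := ih.julia (hσ k) (hlim'.congr fun r => (mul_sub _ _ _).symm) hz
    have hpoisson := mul_le_mul_of_nonneg_right (ha k) (re_add_div_sub_pos (hσ k) hz).le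
    rw [Finset.sum_insert hk, add_comm, ← sub_sub, sub_re, re_ofReal_mul]
    linarith

end IsCaratheodory

/-- Data of the class `Gen τ σ lam`: an interior fixed point `τ ≠ 0`, and finitely many (at least
one) distinct boundary points `σ k` carrying negative lower bounds `lam k` for the spectral
values. -/
structure IsAdmissible {n : ℕ} (τ : ℂ) (σ : Fin n → ℂ) (lam : Fin n → ℝ) : Prop where
  pos : 0 < n
  mem : τ ∈ unitDisk
  ne_zero : τ ≠ 0
  norm_eq : ∀ k, ‖σ k‖ = 1
  inj : Function.Injective σ
  neg : ∀ k, lam k < 0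

/-- The function with Berkson-Porta datum `1 / (f + p₀)`. In the nontrivial elements of
`Gen τ σ lam` the remainder `f` is a Carathéodory function, with value `ell τ σ lam (G 0)` at `0`;
in the extremal ones it is a Herglotz function or an imaginary constant. -/
noncomputable def genOfRemainder {n : ℕ} (τ : ℂ) (σ : Fin n → ℂ) (lam : Fin n → ℝ)
    (f : ℂ → ℂ) : ℂ → ℂ :=
  berksonPorta τ (f + p₀ τ σ lam)⁻¹

theorem eqOn_genOfRemainder_congr {n : ℕ} {τ : ℂ} {σ : Fin n → ℂ} {lam : Fin n → ℝ}
    {f g : ℂ → ℂ} {U : Set ℂ} (h : EqOn f g U) :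
    EqOn (genOfRemainder τ σ lam f) (genOfRemainder τ σ lam g) U := fun z hz => by
  simp only [genOfRemainder, berksonPorta, Pi.inv_apply, Pi.add_apply, h hz]

namespace IsAdmissible

variable {n : ℕ} {τ : ℂ} {σ : Fin n → ℂ} {lam : Fin n → ℝ} {f G : ℂ → ℂ}

theorem norm_sub_pos (h : IsAdmissible τ σ lam) (k : Fin n) : 0 < ‖τ - σ k‖ := by
  rw [norm_sub_rev]
  exact norm_pos_iff.mpr (sub_ne_zero_of_norm_eq_one (h.norm_eq k) h.mem)

theorem alpha_pos (h : IsAdmissible τ σ lam) (k : Fin n) : 0 < alpha τ σ lam k :=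
  div_pos (pow_pos (h.norm_sub_pos k) 2) (mul_pos two_pos (abs_pos.mpr (h.neg k).ne))

theorem neg_div_two_mul_alpha (h : IsAdmissible τ σ lam) (k : Fin n) :
    -(‖τ - σ k‖ ^ 2 / (2 * alpha τ σ lam k)) = lam k := by
  have hlam := (h.neg k).ne
  have hd := (h.norm_sub_pos k).ne'
  rw [alpha, abs_of_neg (h.neg k)]
  field_simp

theorem sumAlpha_pos (h : IsAdmissible τ σ lam) : 0 < sumAlpha τ σ lam :=
  Finset.sum_pos (fun k _ => h.alpha_pos k) ⟨⟨0, h.pos⟩, Finset.mem_univ _⟩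

theorem p₀_zero (h : IsAdmissible τ σ lam) : p₀ τ σ lam 0 = (sumAlpha τ σ lam : ℂ) := by
  rw [p₀, sumAlpha, ofReal_sum]
  refine Finset.sum_congr rfl fun k _ => ?_
  have hne : σ k ≠ 0 := norm_ne_zero_iff.mp (by rw [h.norm_eq k]; exact one_ne_zero)
  rw [add_zero, sub_zero, div_self hne, mul_one]

theorem p₀_re_pos (h : IsAdmissible τ σ lam) {z : ℂ} (hz : z ∈ unitDisk) :
    0 < (p₀ τ σ lam z).re := by
  rw [p₀, re_sum]
  refine Finset.sum_pos (fun k _ => ?_) ⟨⟨0, h.pos⟩, Finset.mem_univ _⟩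
  rw [re_ofReal_mul]
  exact mul_pos (h.alpha_pos k) (re_add_div_sub_pos (h.norm_eq k) hz)

theorem isCaratheodory_p₀ (h : IsAdmissible τ σ lam) : IsCaratheodory (p₀ τ σ lam) where
  holo := DifferentiableOn.fun_sum fun k _ => DifferentiableOn.const_mul
    (DifferentiableOn.div (by fun_prop) (by fun_prop)
      fun _ hz => sub_ne_zero_of_norm_eq_one (h.norm_eq k) hz) _
  re_nonneg _ hz := (h.p₀_re_pos hz).le

theorem add_p₀_ne_zero (h : IsAdmissible τ σ lam) (hf : IsCaratheodory f) {z : ℂ}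
    (hz : z ∈ unitDisk) : f z + p₀ τ σ lam z ≠ 0 := fun h0 => by
  have hre := congrArg re h0
  rw [add_re, zero_re] at hre
  linarith [hf.re_nonneg z hz, h.p₀_re_pos hz]

theorem isCaratheodory_inv_add_p₀ (h : IsAdmissible τ σ lam) (hf : IsCaratheodory f) :
    IsCaratheodory (f + p₀ τ σ lam)⁻¹ :=
  (hf.add h.isCaratheodory_p₀).inv fun _ hz => h.add_p₀_ne_zero hf hz

theorem exists_eqOn_genOfRemainder (h : IsAdmissible τ σ lam) (hG : G ∈ Gen τ σ lam)
    (hG0 : ¬ EqOn G 0 unitDisk) :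
    ∃ f, IsCaratheodory f ∧ EqOn G (genOfRemainder τ σ lam f) unitDisk := by
  obtain ⟨φ, hg, hdw, hbrfp⟩ := hG
  obtain ⟨p, hp, hGp⟩ := hg.exists_berksonPorta h.mem fun t ht => hdw.apply_eq_self h.mem ht
  choose l hlam _ hbrfp using hbrfp
  have hlim := fun k =>
    tendsto_div_one_sub_of_hasAngularLimit h.mem (h.norm_eq k) hGp (hbrfp k).2
  have hp0 : 0 < (p 0).re :=
    hp.re_apply_zero_pos_of_tendsto_div (h.norm_eq ⟨0, h.pos⟩) (hlim _) fun hp0 =>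
      hG0 fun z hz => by
        rw [hGp hz, berksonPorta, hp0 hz, Pi.zero_apply, mul_zero]
  have hpne : ∀ z ∈ unitDisk, p z ≠ 0 := fun z hz hz0 => by
    have hpos := hp.re_pos_of_re_apply_pos (w := 0) (by simp) hp0 hz
    rw [hz0, zero_re] at hpos
    exact hpos.false
  have hb := fun k => hp.pos_of_tendsto_div hp0 (h.norm_eq k) (hlim k)
  have hbound : ∀ k, 2 * alpha τ σ lam k ≤ (-l k / ‖τ - σ k‖ ^ 2)⁻¹ := fun k => by
    have hsq := pow_pos (h.norm_sub_pos k) 2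
    have hl : 0 < -l k := (div_pos_iff_of_pos_right hsq).mp (hb k)
    rw [alpha, inv_div, mul_div_assoc', mul_div_mul_left _ _ two_ne_zero, abs_of_neg (h.neg k)]
    exact div_le_div_of_nonneg_left hsq.le hl (neg_le_neg (hlam k))
  have hpoles := (hp.inv hpne).sub_sum h.norm_eq h.inj (fun k => by
    refine (ofReal_inv _ ▸ (hlim k).inv₀ (ofReal_ne_zero.mpr (hb k).ne')).congr fun r => ?_
    rw [inv_div, div_eq_mul_inv, Pi.inv_apply]) hbound Finset.univ
  refine ⟨_, hpoles, fun z hz => ?_⟩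
  simp only [genOfRemainder, berksonPorta, Pi.inv_apply, Pi.add_apply, p₀, sub_add_cancel, inv_inv]
  exact hGp hz

theorem exists_isGeneratorOf (h : IsAdmissible τ σ lam) (hf : IsCaratheodory f) :
    ∃ φ, IsGeneratorOf (genOfRemainder τ σ lam f) φ ∧ IsSemigroupDWPoint φ τ := by
  have hp := h.isCaratheodory_inv_add_p₀ hf
  obtain ⟨φ, hφ⟩ := exists_isGeneratorOf_of_berksonPorta h.mem hp
  exact ⟨φ, hφ, isSemigroupDWPoint_of_berksonPorta h.mem hp hφ⟩

theorem genOfRemainder_zero (h : IsAdmissible τ σ lam) (f : ℂ → ℂ) :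
    genOfRemainder τ σ lam f 0 = τ / (f 0 + sumAlpha τ σ lam) := by
  simp only [genOfRemainder, berksonPorta, sub_zero, mul_zero, mul_one, Pi.inv_apply, Pi.add_apply,
    h.p₀_zero, div_eq_mul_inv]

theorem hasSpectralValue_genOfRemainder_iff (h : IsAdmissible τ σ lam) (hf : IsCaratheodory f)
    {w : ℂ} : HasSpectralValue (genOfRemainder τ σ lam f) τ w ↔
      w = ((1 - ‖τ‖ ^ 2 : ℝ) : ℂ) / (f τ + p₀ τ σ lam τ) := by
  have hp := h.isCaratheodory_inv_add_p₀ hf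
  obtain ⟨φ, hφ⟩ := exists_isGeneratorOf_of_berksonPorta h.mem hp
  rw [genOfRemainder, hasSpectralValue_iff_of_berksonPorta h.mem hφ hp, Pi.inv_apply, Pi.add_apply,
    div_eq_mul_inv]

end IsAdmissible

/-! ### Generators with a Herglotz remainder -/

theorem tendsto_sub_mul_cayley {κ σ : ℂ} (hσ : ‖σ‖ = 1) :
    Tendsto (fun z => (σ - z) * ((1 + κ * z) / (1 - κ * z))) (𝓝[unitDisk] σ)
      (𝓝 (2 * (if κ * σ = 1 then 1 else 0) * σ)) := by
  split_ifs with hκ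
  · have hcont : ContinuousWithinAt (fun z => σ + z) unitDisk σ := by fun_prop
    rw [mul_one, two_mul]
    refine hcont.tendsto.congr' (eventually_nhdsWithin_of_forall fun z hz => ?_)
    have hσz := sub_ne_zero_of_norm_eq_one hσ hz
    have hκ' : κ = conj σ := by
      rw [← mul_one κ, ← conj_mul_self_of_norm_eq_one hσ, mul_left_comm, hκ, mul_one]
    simp only [hκ', ← add_div_sub_eq hσ, mul_div_cancel₀ _ hσz]
  · have hcont : ContinuousAt (fun z => (σ - z) * ((1 + κ * z) / (1 - κ * z))) σ :=
      ContinuousAt.mul (by fun_prop) (ContinuousAt.div (by fun_prop) (by fun_prop)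
        (sub_ne_zero.mpr (Ne.symm hκ)))
    simpa only [sub_self, zero_mul, mul_zero] using hcont.continuousWithinAt.tendsto

theorem tendsto_sub_mul_herglotz {L κ σ : ℂ} (hσ : ‖σ‖ = 1) :
    Tendsto (fun z => (σ - z) * herglotz L κ z) (𝓝[unitDisk] σ)
      (𝓝 (2 * ((if κ * σ = 1 then L.re else 0 : ℝ) : ℂ) * σ)) := by
  have hzero : Tendsto (fun z => (σ - z) * (I * (L.im : ℂ))) (𝓝[unitDisk] σ) (𝓝 0) := by
    have hcont : ContinuousWithinAt (fun z => (σ - z) * (I * (L.im : ℂ))) unitDisk σ := by fun_prop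
    simpa only [sub_self, zero_mul] using hcont.tendsto
  convert ((tendsto_sub_mul_cayley (κ := κ) hσ).mul_const (L.re : ℂ)).add hzero using 2 with z
  · rw [herglotz]
    ring
  · split_ifs
    · ring
    · simp

theorem tendsto_sub_mul_p₀ {n : ℕ} {σ : Fin n → ℂ} (hσ : ∀ k, ‖σ k‖ = 1)
    (hinj : Function.Injective σ) (τ : ℂ) (lam : Fin n → ℝ) (k : Fin n) :
    Tendsto (fun z => (σ k - z) * p₀ τ σ lam z) (𝓝[unitDisk] (σ k))
      (𝓝 (2 * (alpha τ σ lam k : ℂ) * σ k)) := by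
  have hterm := fun j => (tendsto_sub_mul_cayley (κ := conj (σ j)) (hσ k)).const_mul
    (alpha τ σ lam j : ℂ)
  have hite : ∀ j, conj (σ j) * σ k = 1 ↔ j = k := fun j => by
    have hj := conj_mul_self_of_norm_eq_one (hσ j)
    refine ⟨fun h => (hinj ?_), fun h => h ▸ hj⟩
    exact mul_left_cancel₀ (left_ne_zero_of_mul_eq_one hj) (hj.trans h.symm)
  have hsum := tendsto_finsetSum Finset.univ fun j _ => hterm j
  simp only [hite, mul_ite, ite_mul, mul_one, mul_zero, zero_mul, Finset.sum_ite_eq',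
    Finset.mem_univ, if_true] at hsum
  rw [mul_left_comm, ← mul_assoc] at hsum
  refine hsum.congr fun z => ?_
  rw [p₀, Finset.mul_sum]
  refine Finset.sum_congr rfl fun j _ => ?_
  rw [add_div_sub_eq (hσ j)]
  ring

theorem tendsto_berksonPorta_inv_div {τ σ : ℂ} (hσ : ‖σ‖ = 1) {q : ℂ → ℂ} {c : ℝ} (hc : c ≠ 0)
    (hq : Tendsto (fun z => (σ - z) * q z) (𝓝[unitDisk] σ) (𝓝 (2 * (c : ℂ) * σ))) :
    Tendsto (fun z => berksonPorta τ q⁻¹ z / (σ - z)) (𝓝[unitDisk] σ)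
      (𝓝 ((-(‖τ - σ‖ ^ 2 / (2 * c)) : ℝ) : ℂ)) := by
  have hσ0 : σ ≠ 0 := norm_ne_zero_iff.mp (by rw [hσ]; exact one_ne_zero)
  have hc' : (c : ℂ) ≠ 0 := ofReal_ne_zero.mpr hc
  have hcont : ContinuousWithinAt (fun z => (τ - z) * (1 - conj τ * z)) unitDisk σ := by fun_prop
  have hdiv := hcont.tendsto.div hq (mul_ne_zero (mul_ne_zero two_ne_zero hc') hσ0)
  rw [sub_mul_one_sub_conj_mul_of_norm_eq_one hσ] at hdiv
  convert hdiv using 2 with z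
  · rw [berksonPorta, Pi.inv_apply, Pi.div_apply, ← div_eq_mul_inv, div_div, mul_comm (q z)]
  · push_cast
    field_simp

namespace IsAdmissible

variable {n : ℕ} {τ : ℂ} {σ : Fin n → ℂ} {lam : Fin n → ℝ} {G : ℂ → ℂ} {L κ : ℂ}

theorem exists_isGeneratorOf_of_eqOn_herglotz (h : IsAdmissible τ σ lam) (hL : 0 ≤ L.re)
    (hκ : ‖κ‖ ≤ 1) (hG : EqOn G (genOfRemainder τ σ lam (herglotz L κ)) unitDisk) :
    ∃ φ, IsGeneratorOf G φ ∧ IsSemigroupDWPoint φ τ ∧ ∀ k, HasBRFPWithSpectralValue G φ (σ k)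
      (-(‖τ - σ k‖ ^ 2 / (2 * (alpha τ σ lam k + if κ * σ k = 1 then L.re else 0)))) := by
  obtain ⟨φ, hφ, hdw⟩ := h.exists_isGeneratorOf (isCaratheodory_herglotz hL hκ)
  refine ⟨φ, hφ.congr hG, hdw, fun k => (hφ.congr hG).hasBRFPWithSpectralValue (h.norm_eq k) ?_⟩
  have hpole : Tendsto (fun z => (σ k - z) * (herglotz L κ + p₀ τ σ lam) z) (𝓝[unitDisk] (σ k))
      (𝓝 (2 * ((alpha τ σ lam k + if κ * σ k = 1 then L.re else 0 : ℝ) : ℂ) * σ k)) := by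
    convert (tendsto_sub_mul_herglotz (L := L) (κ := κ) (h.norm_eq k)).add
      (tendsto_sub_mul_p₀ h.norm_eq h.inj τ lam k) using 2
    · rw [Pi.add_apply, mul_add]
    · push_cast
      ring
  have hmass : 0 ≤ if κ * σ k = 1 then L.re else 0 := by split_ifs <;> simp [hL]
  refine (tendsto_berksonPorta_inv_div (h.norm_eq k)
    (add_pos_of_pos_of_nonneg (h.alpha_pos k) hmass).ne' hpole).congr'
    (eventually_nhdsWithin_of_forall fun z hz => ?_)
  simp only [hG hz, genOfRemainder]

theorem mem_gen_of_eqOn_herglotz (h : IsAdmissible τ σ lam) (hL : 0 ≤ L.re) (hκ : ‖κ‖ ≤ 1)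
    (hG : EqOn G (genOfRemainder τ σ lam (herglotz L κ)) unitDisk) : G ∈ Gen τ σ lam := by
  obtain ⟨φ, hφ, hdw, hbrfp⟩ := h.exists_isGeneratorOf_of_eqOn_herglotz hL hκ hG
  refine ⟨φ, hφ, hdw, fun k => ⟨_, ?_, ?_, hbrfp k⟩⟩
  all_goals
    have hα := h.alpha_pos k
    have hmass : 0 ≤ if κ * σ k = 1 then L.re else 0 := by split_ifs <;> simp [hL]
  · rw [← h.neg_div_two_mul_alpha k, neg_le_neg_iff]
    exact div_le_div_of_nonneg_left (by positivity) (by positivity) (by linarith)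
  · exact neg_nonpos.mpr (by positivity)

theorem mem_genExact_of_eqOn_herglotz (h : IsAdmissible τ σ lam) (hL : 0 ≤ L.re) (hκ : ‖κ‖ ≤ 1)
    (hmass : ∀ k, κ * σ k = 1 → L.re = 0)
    (hG : EqOn G (genOfRemainder τ σ lam (herglotz L κ)) unitDisk) : G ∈ GenExact τ σ lam := by
  obtain ⟨φ, hφ, hdw, hbrfp⟩ := h.exists_isGeneratorOf_of_eqOn_herglotz hL hκ hG
  refine ⟨φ, hφ, hdw, fun k => ?_⟩
  have hk := hbrfp k
  rwa [ite_eq_right_iff.mpr (hmass k), add_zero, h.neg_div_two_mul_alpha k] at hk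

end IsAdmissible

section

variable {G : ℂ → ℂ} {τ : ℂ}

theorem isGeneratorOf_id_of_eqOn_zero (hG : EqOn G 0 unitDisk) : IsGeneratorOf G fun _ => id where
  semigroup := ⟨fun _ _ => differentiableOn_id, fun _ _ => mapsTo_id _, fun _ _ => rfl,
    fun _ _ _ _ _ _ => rfl, fun _ _ => tendsto_const_nhds⟩
  holo := (differentiableOn_const 0).congr hG
  flow z hz t _ := by
    simp only [id_eq, hG hz, Pi.zero_apply]
    exact hasDerivWithinAt_const _ _ _

theorem hasSpectralValue_iff_of_eqOn_zero (hτ : τ ∈ unitDisk) (hG : EqOn G 0 unitDisk) {w : ℂ} :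
    HasSpectralValue G τ w ↔ w = 0 := by
  have hd : HasDerivAt G 0 τ := (hasDerivAt_const τ (0 : ℂ)).congr_of_eventuallyEq
    (mem_of_superset (Metric.isOpen_ball.mem_nhds hτ) hG)
  rw [(isGeneratorOf_id_of_eqOn_zero hG).hasSpectralValue_iff hτ (hG hτ), hd.deriv, neg_zero]

theorem hasSpectralValue_congr {G' : ℂ → ℂ} (h : EqOn G G' unitDisk) {w : ℂ} :
    HasSpectralValue G τ w ↔ HasSpectralValue G' τ w :=
  exists_congr fun _ => and_congr_left fun _ => ⟨fun hg => hg.congr h.symm, fun hg => hg.congr h⟩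

theorem IsAdmissible.mem_gen_of_eqOn_zero {n : ℕ} {σ : Fin n → ℂ} {lam : Fin n → ℝ}
    (h : IsAdmissible τ σ lam) (hG : EqOn G 0 unitDisk) : G ∈ Gen τ σ lam := by
  have hg := isGeneratorOf_id_of_eqOn_zero hG
  refine ⟨_, hg, fun _ _ hne => absurd (eqOn_refl _ _) hne, fun k => ⟨0, (h.neg k).le, le_rfl,
    hg.hasBRFPWithSpectralValue (h.norm_eq k) (tendsto_const_nhds.congr'
      (eventually_nhdsWithin_of_forall fun z hz => ?_))⟩⟩
  simp only [hG hz, Pi.zero_apply, zero_div, ofReal_zero]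

end

/-! ### The Schwarz-Pick region -/

/-- The pairs `(L, u)` of values at `0` and at a point `τ` with `‖τ‖ = r` taken by Carathéodory
functions, as described by the Schwarz-Pick inequality. -/
def schwarzPickRegion (r : ℝ) : Set (ℂ × ℂ) :=
  {Q | 0 ≤ Q.1.re ∧ ‖Q.2 - Q.1‖ ≤ r * ‖Q.2 + conj Q.1‖}

theorem IsCaratheodory.mem_schwarzPickRegion {f : ℂ → ℂ} (hf : IsCaratheodory f) {z : ℂ}
    (hz : z ∈ unitDisk) : (f 0, f z) ∈ schwarzPickRegion ‖z‖ :=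
  ⟨hf.re_nonneg 0 (by simp), hf.norm_sub_apply_zero_le hz⟩

section

variable {r : ℝ} {Q : ℂ × ℂ}

theorem isClosed_schwarzPickRegion (r : ℝ) : IsClosed (schwarzPickRegion r) := by
  rw [schwarzPickRegion, ofPred_and]
  exact IsClosed.inter (isClosed_le (by fun_prop) (by fun_prop))
    (isClosed_le (by fun_prop) (by fun_prop))

theorem sq_norm_sub_le_of_mem_schwarzPickRegion (hQ : Q ∈ schwarzPickRegion r) :
    ‖Q.2 - Q.1‖ ^ 2 ≤ r ^ 2 * (‖Q.2 - Q.1‖ ^ 2 + 4 * (Q.2.re * Q.1.re)) := by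
  rw [← sq_norm_add_conj, ← mul_pow]
  exact pow_le_pow_left₀ (norm_nonneg _) hQ.2 2

theorem re_snd_nonneg_of_mem_schwarzPickRegion (hr0 : 0 ≤ r) (hr : r < 1)
    (hQ : Q ∈ schwarzPickRegion r) : 0 ≤ Q.2.re := by
  by_contra! hneg
  have hsq := sq_norm_sub_le_of_mem_schwarzPickRegion hQ
  have hprod : r ^ 2 * (Q.2.re * Q.1.re) ≤ 0 :=
    mul_nonpos_of_nonneg_of_nonpos (sq_nonneg r) (mul_nonpos_of_nonpos_of_nonneg hneg.le hQ.1)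
  have hr2 : 0 < 1 - r ^ 2 := by nlinarith
  have hzero : Q.2 - Q.1 = 0 := norm_eq_zero.mp (pow_eq_zero_iff two_ne_zero |>.mp
    (le_antisymm (by nlinarith) (sq_nonneg _)))
  rw [sub_eq_zero.mp hzero] at hneg
  exact hneg.not_ge hQ.1

theorem mul_norm_le_of_mem_schwarzPickRegion (hr0 : 0 ≤ r) (hQ : Q ∈ schwarzPickRegion r) :
    (1 - r) * ‖Q‖ ≤ (1 + r) * ‖Q.1‖ ∧ (1 - r) * ‖Q‖ ≤ (1 + r) * ‖Q.2‖ := by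
  have hsum : ‖Q.2 - Q.1‖ ≤ r * (‖Q.2‖ + ‖Q.1‖) :=
    hQ.2.trans (mul_le_mul_of_nonneg_left
      ((norm_add_le _ _).trans_eq (by rw [Complex.norm_conj])) hr0)
  have h21 := norm_le_norm_add_norm_sub' Q.2 Q.1
  have h12 := norm_le_norm_add_norm_sub Q.2 Q.1
  rw [Prod.norm_def]
  constructor <;> rcases max_cases ‖Q.1‖ ‖Q.2‖ with ⟨h, _⟩ | ⟨h, _⟩ <;> rw [h]
  all_goals nlinarith [norm_nonneg Q.1, norm_nonneg Q.2]

theorem re_fst_pos_of_norm_lt (hr0 : 0 ≤ r) (hr : r < 1) (hL : 0 ≤ Q.1.re)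
    (hlt : ‖Q.2 - Q.1‖ < r * ‖Q.2 + conj Q.1‖) : 0 < Q.1.re := by
  refine hL.lt_of_ne' fun h0 => ?_
  have hsq := pow_lt_pow_left₀ hlt (norm_nonneg _) two_ne_zero
  rw [mul_pow, sq_norm_add_conj, h0, mul_zero, mul_zero, add_zero] at hsq
  exact (mul_le_of_le_one_left (sq_nonneg _) (pow_le_one₀ hr0 hr.le)).not_gt hsq

theorem norm_lt_of_translate_mem_schwarzPickRegion (hr0 : 0 < r) (hr : r < 1) {t : ℝ} (ht : 0 < t)
    (hQ : Q - ((t : ℂ), (t : ℂ)) ∈ schwarzPickRegion r) :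
    ‖Q.2 - Q.1‖ < r * ‖Q.2 + conj Q.1‖ := by
  have hL := hQ.1
  have hu := re_snd_nonneg_of_mem_schwarzPickRegion hr0.le hr hQ
  have hsq := sq_norm_sub_le_of_mem_schwarzPickRegion hQ
  simp only [Prod.fst_sub, Prod.snd_sub, sub_re, ofReal_re, sub_sub_sub_cancel_right]
    at hL hu hsq
  refine lt_of_pow_lt_pow_left₀ 2 (by positivity) (hsq.trans_lt ?_)
  rw [mul_pow, sq_norm_add_conj]
  exact mul_lt_mul_of_pos_left (by nlinarith) (pow_pos hr0 2)

theorem mem_interior_schwarzPickRegion_iff (hr0 : 0 < r) (hr : r < 1) :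
    Q ∈ interior (schwarzPickRegion r) ↔ 0 ≤ Q.1.re ∧ ‖Q.2 - Q.1‖ < r * ‖Q.2 + conj Q.1‖ := by
  constructor
  · refine fun hQ => ⟨(interior_subset hQ).1, ?_⟩
    -- The region is strictly shrunk by the translations to the right along `(1, 1)`.
    have hcont : ContinuousAt (fun t : ℝ => Q - ((t : ℂ), (t : ℂ))) 0 := by fun_prop
    have hnhds := hcont.preimage_mem_nhds
      ((mem_interior_iff_mem_nhds (s := schwarzPickRegion r)).mp (by
        simpa only [ofReal_zero, Prod.mk_zero_zero, sub_zero] using hQ))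
    obtain ⟨t, hmem, ht⟩ := Filter.nonempty_of_mem
      (inter_mem (nhdsWithin_le_nhds hnhds) (self_mem_nhdsWithin (s := Ioi 0)))
    exact norm_lt_of_translate_mem_schwarzPickRegion hr0 hr ht hmem
  · rintro ⟨hL, hlt⟩
    have hopen : IsOpen {Q : ℂ × ℂ | 0 < Q.1.re ∧ ‖Q.2 - Q.1‖ < r * ‖Q.2 + conj Q.1‖} := by
      rw [ofPred_and]
      exact IsOpen.inter (isOpen_lt (by fun_prop) (by fun_prop))
        (isOpen_lt (by fun_prop) (by fun_prop))
    refine interior_maximal ?_ hopen ⟨re_fst_pos_of_norm_lt hr0.le hr hL hlt, hlt⟩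
    exact fun Q hQ => ⟨hQ.1.le, hQ.2.le⟩

theorem mem_frontier_schwarzPickRegion_iff (hr0 : 0 < r) (hr : r < 1) :
    Q ∈ frontier (schwarzPickRegion r) ↔
      0 ≤ Q.1.re ∧ ‖Q.2 - Q.1‖ = r * ‖Q.2 + conj Q.1‖ := by
  rw [(isClosed_schwarzPickRegion r).frontier_eq, Set.mem_sdiff,
    mem_interior_schwarzPickRegion_iff hr0 hr, schwarzPickRegion, mem_ofPred_eq,
    eq_iff_le_not_lt]
  tauto

end

theorem IsCaratheodory.exists_eqOn_herglotz_of_mem_frontier {f : ℂ → ℂ} (hf : IsCaratheodory f)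
    {τ : ℂ} (hτ : τ ∈ unitDisk) (hτ0 : τ ≠ 0)
    (hfr : (f 0, f τ) ∈ frontier (schwarzPickRegion ‖τ‖)) :
    ∃ κ : ℂ, ‖κ‖ = 1 ∧ EqOn f (herglotz (f 0) κ) unitDisk := by
  have hz0 : (0 : ℂ) ∈ unitDisk := by simp
  rcases (hf.re_nonneg 0 hz0).eq_or_lt' with hre | hpos
  · exact ⟨1, norm_one, herglotz_of_re_eq_zero hre 1 ▸ hf.eqOn_const_of_re_eq_zero hz0 hre⟩
  · exact hf.exists_eqOn_herglotz hτ hτ0 hpos ((mem_frontier_schwarzPickRegion_iff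
      (norm_pos_iff.mpr hτ0) (mem_ball_zero_iff.mp hτ)).mp hfr).2

theorem IsCaratheodory.eqOn_of_mem_frontier {f g : ℂ → ℂ} (hf : IsCaratheodory f)
    (hg : IsCaratheodory g) {τ : ℂ} (hτ : τ ∈ unitDisk) (hτ0 : τ ≠ 0)
    (heq : (f 0, f τ) = (g 0, g τ)) (hfr : (f 0, f τ) ∈ frontier (schwarzPickRegion ‖τ‖)) :
    EqOn f g unitDisk := by
  obtain ⟨κ, hκ, hfκ⟩ := hf.exists_eqOn_herglotz_of_mem_frontier hτ hτ0 hfr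
  obtain ⟨κ', hκ', hgκ⟩ := hg.exists_eqOn_herglotz_of_mem_frontier hτ hτ0 (heq ▸ hfr)
  obtain ⟨h0, h1⟩ := Prod.mk.inj heq
  rw [← h0] at hgκ
  refine hfκ.trans (EqOn.trans ?_ hgκ.symm)
  rcases (hf.re_nonneg 0 (by simp)).eq_or_lt' with hre | hpos
  · rw [herglotz_of_re_eq_zero hre, herglotz_of_re_eq_zero hre]
    exact eqOn_refl _ _
  · rw [hfκ hτ, hgκ hτ, herglotz_inj hpos hκ.le hκ'.le hτ hτ0] at h1
    rw [h1]
    exact eqOn_refl _ _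

/-! ### The value region as an image of the Schwarz-Pick region -/

/-- The map `z ↦ K / (z + c)`, as a homeomorphism of `{-c}ᶜ` onto `{0}ᶜ`. -/
noncomputable def divAdd (K c : ℂ) (hK : K ≠ 0) : OpenPartialHomeomorph ℂ ℂ where
  toFun z := K / (z + c)
  invFun w := K / w - c
  source := {z | z + c ≠ 0}
  target := {0}ᶜ
  map_source' _ hz := div_ne_zero hK hz
  map_target' _ hw := by simpa using ⟨hK, hw⟩
  left_inv' _ _ := by rw [div_div_cancel₀ hK, add_sub_cancel_right]
  right_inv' _ _ := by rw [sub_add_cancel, div_div_cancel₀ hK]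
  open_source := isOpen_ne_fun (by fun_prop) continuous_const
  open_target := isOpen_compl_singleton
  continuousOn_toFun := ContinuousOn.div (by fun_prop) (by fun_prop) fun _ hz => hz
  continuousOn_invFun := ContinuousOn.sub (ContinuousOn.div (by fun_prop) (by fun_prop)
    fun _ hw => hw) (by fun_prop)

theorem tendsto_divAdd_cobounded (K c : ℂ) (hK : K ≠ 0) :
    Tendsto (divAdd K c hK) (Bornology.cobounded ℂ) (𝓝 0) := by
  have h := (tendsto_inv₀_cobounded.comp (tendsto_add_const_cobounded c)).const_mul K
  rw [mul_zero] at h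
  exact h

namespace IsAdmissible

variable {n : ℕ} {τ : ℂ} {σ : Fin n → ℂ} {lam : Fin n → ℝ} {f G : ℂ → ℂ} {P Q : ℂ × ℂ}

theorem one_sub_sq_norm_ne_zero (h : IsAdmissible τ σ lam) : ((1 - ‖τ‖ ^ 2 : ℝ) : ℂ) ≠ 0 :=
  ofReal_ne_zero.mpr (one_sub_sq_norm_pos h.mem).ne'

/-- The map taking the values `(f 0, f τ)` of the remainder to the value at `0` and the spectral
value of `genOfRemainder τ σ lam f`. -/
noncomputable def toValue (h : IsAdmissible τ σ lam) : OpenPartialHomeomorph (ℂ × ℂ) (ℂ × ℂ) :=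
  (divAdd τ (sumAlpha τ σ lam) h.ne_zero).prod
    (divAdd ((1 - ‖τ‖ ^ 2 : ℝ) : ℂ) (p₀ τ σ lam τ) h.one_sub_sq_norm_ne_zero)

theorem toValue_apply (h : IsAdmissible τ σ lam) (Q : ℂ × ℂ) : h.toValue Q =
    (τ / (Q.1 + sumAlpha τ σ lam), ((1 - ‖τ‖ ^ 2 : ℝ) : ℂ) / (Q.2 + p₀ τ σ lam τ)) := rfl

theorem toValue_symm_apply (h : IsAdmissible τ σ lam) (P : ℂ × ℂ) : h.toValue.symm P =
    (ell τ σ lam P.1, ((1 - ‖τ‖ ^ 2 : ℝ) : ℂ) / P.2 - p₀ τ σ lam τ) := rfl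

theorem schwarzPickRegion_subset_source (h : IsAdmissible τ σ lam) :
    schwarzPickRegion ‖τ‖ ⊆ h.toValue.source := by
  refine fun Q hQ => ⟨fun h1 => ?_, fun h2 => ?_⟩
  · have hre := congrArg re h1
    rw [add_re, ofReal_re, zero_re] at hre
    linarith [hQ.1, h.sumAlpha_pos]
  · have hre := congrArg re h2
    rw [add_re, zero_re] at hre
    linarith [h.p₀_re_pos h.mem, re_snd_nonneg_of_mem_schwarzPickRegion (norm_nonneg τ)
      (mem_ball_zero_iff.mp h.mem) hQ]

theorem delivers_iff (h : IsAdmissible τ σ lam) (hf : IsCaratheodory f)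
    (hG : EqOn G (genOfRemainder τ σ lam f) unitDisk) :
    Delivers τ G P ↔ h.toValue (f 0, f τ) = P := by
  rw [Delivers, hG (by simp), h.genOfRemainder_zero, hasSpectralValue_congr hG,
    h.hasSpectralValue_genOfRemainder_iff hf, h.toValue_apply, Prod.ext_iff, eq_comm (a := P.2)]

theorem delivers_iff_of_eqOn_zero (h : IsAdmissible τ σ lam) (hG : EqOn G 0 unitDisk) :
    Delivers τ G P ↔ P = 0 := by
  rw [Delivers, hG (by simp), hasSpectralValue_iff_of_eqOn_zero h.mem hG, Prod.ext_iff,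
    eq_comm (b := P.1)]
  rfl

theorem valueRegion_eq_insert_image (h : IsAdmissible τ σ lam) :
    valueRegion τ σ lam = insert 0 (h.toValue '' schwarzPickRegion ‖τ‖) := by
  ext P
  constructor
  · rintro ⟨G, hG, hGP⟩
    by_cases hG0 : EqOn G 0 unitDisk
    · exact Or.inl ((h.delivers_iff_of_eqOn_zero hG0).mp hGP)
    · obtain ⟨f, hf, hGf⟩ := h.exists_eqOn_genOfRemainder hG hG0
      exact Or.inr ⟨_, hf.mem_schwarzPickRegion h.mem, (h.delivers_iff hf hGf).mp hGP⟩
  · rintro (rfl | ⟨Q, hQ, rfl⟩)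
    · exact ⟨0, h.mem_gen_of_eqOn_zero (eqOn_refl _ _),
        (h.delivers_iff_of_eqOn_zero (eqOn_refl _ _)).mpr rfl⟩
    · obtain ⟨κ, hκ, hκτ⟩ := exists_herglotz_eq h.mem h.ne_zero hQ.2
      refine ⟨_, h.mem_gen_of_eqOn_herglotz hQ.1 hκ (eqOn_refl _ _),
        (h.delivers_iff (isCaratheodory_herglotz hQ.1 hκ) (eqOn_refl _ _)).mpr ?_⟩
      rw [herglotz_zero, hκτ]

theorem tendsto_toValue_cocompact (h : IsAdmissible τ σ lam) :
    Tendsto (fun Q : schwarzPickRegion ‖τ‖ => h.toValue Q) (cocompact _) (𝓝 0) := by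
  have hpos : 0 < (1 - ‖τ‖) / (1 + ‖τ‖) :=
    div_pos (sub_pos.mpr (mem_ball_zero_iff.mp h.mem)) (by positivity)
  have hQ : Tendsto (fun Q : schwarzPickRegion ‖τ‖ => (1 - ‖τ‖) / (1 + ‖τ‖) * ‖(Q : ℂ × ℂ)‖)
      (cocompact _) atTop :=
    (tendsto_norm_cocompact_atTop.comp (isClosed_schwarzPickRegion
      ‖τ‖).isClosedEmbedding_subtypeVal.tendsto_cocompact).const_mul_atTop hpos
  have hle := fun Q : schwarzPickRegion ‖τ‖ =>
    mul_norm_le_of_mem_schwarzPickRegion (norm_nonneg τ) Q.2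
  have h1 : Tendsto (fun Q : schwarzPickRegion ‖τ‖ => (Q : ℂ × ℂ).1) (cocompact _)
      (Bornology.cobounded ℂ) := by
    refine tendsto_norm_atTop_iff_cobounded.mp (tendsto_atTop_mono (fun Q => ?_) hQ)
    rw [div_mul_eq_mul_div, div_le_iff₀' (by positivity)]
    exact (hle Q).1
  have h2 : Tendsto (fun Q : schwarzPickRegion ‖τ‖ => (Q : ℂ × ℂ).2) (cocompact _)
      (Bornology.cobounded ℂ) := by
    refine tendsto_norm_atTop_iff_cobounded.mp (tendsto_atTop_mono (fun Q => ?_) hQ)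
    rw [div_mul_eq_mul_div, div_le_iff₀' (by positivity)]
    exact (hle Q).2
  exact ((tendsto_divAdd_cobounded _ _ h.ne_zero).comp h1).prodMk_nhds
    ((tendsto_divAdd_cobounded _ _ h.one_sub_sq_norm_ne_zero).comp h2)

theorem isCompact_valueRegion (h : IsAdmissible τ σ lam) : IsCompact (valueRegion τ σ lam) := by
  rw [h.valueRegion_eq_insert_image, ← range_domRestrict]
  exact h.tendsto_toValue_cocompact.isCompact_insert_range_of_cocompact
    (h.toValue.continuousOn.mono h.schwarzPickRegion_subset_source).domRestrict

theorem zero_mem_valueRegion (h : IsAdmissible τ σ lam) : 0 ∈ valueRegion τ σ lam :=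
  h.valueRegion_eq_insert_image ▸ mem_insert _ _

theorem mem_target_of_mem_valueRegion (h : IsAdmissible τ σ lam)
    (hP : P ∈ valueRegion τ σ lam) (hP0 : P ≠ 0) : P ∈ h.toValue.target := by
  rw [h.valueRegion_eq_insert_image] at hP
  obtain ⟨Q, hQ, rfl⟩ := hP.resolve_left hP0
  exact h.toValue.map_source (h.schwarzPickRegion_subset_source hQ)

theorem isImage_toValue (h : IsAdmissible τ σ lam) :
    h.toValue.IsImage (schwarzPickRegion ‖τ‖) (valueRegion τ σ lam) := by
  have hzero : (0 : ℂ × ℂ) ∉ h.toValue.target := fun h0 => h0.1 rfl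
  refine .of_image_eq ?_
  rw [h.valueRegion_eq_insert_image, inter_eq_right.mpr h.schwarzPickRegion_subset_source,
    inter_insert_of_notMem hzero, inter_eq_right.mpr]
  exact (h.toValue.mapsTo.mono_left h.schwarzPickRegion_subset_source).image_subset

theorem toValue_mem_frontier_valueRegion_iff (h : IsAdmissible τ σ lam)
    (hf : IsCaratheodory f) : h.toValue (f 0, f τ) ∈ frontier (valueRegion τ σ lam) ↔
      (f 0, f τ) ∈ frontier (schwarzPickRegion ‖τ‖) :=
  h.isImage_toValue.frontier.apply_mem_iff
    (h.schwarzPickRegion_subset_source (hf.mem_schwarzPickRegion h.mem))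

theorem zero_mem_frontier_valueRegion (h : IsAdmissible τ σ lam) :
    0 ∈ frontier (valueRegion τ σ lam) := by
  refine h.isCompact_valueRegion.isClosed.frontier_eq ▸ ⟨h.zero_mem_valueRegion, fun h0 => ?_⟩
  have hcont : ContinuousAt (fun w : ℂ => ((0 : ℂ), w)) 0 := by fun_prop
  have hnhds := hcont.preimage_mem_nhds (mem_interior_iff_mem_nhds.mp h0)
  obtain ⟨w, hw, hw0⟩ := Filter.nonempty_of_mem
    (inter_mem (nhdsWithin_le_nhds hnhds) (self_mem_nhdsWithin (s := {0}ᶜ)))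
  exact (h.mem_target_of_mem_valueRegion hw fun h0 => hw0 (congrArg Prod.snd h0)).1 rfl

end IsAdmissible

/-! ### The disks `Z` and `Ω_ζ` -/

theorem sq_norm_sub_sub_sq_eq_of_mul_eq (a w : ℂ) {K R t : ℝ} (hK : t * (‖a‖ ^ 2 - R ^ 2) = K) :
    (‖a‖ ^ 2 - R ^ 2) * (‖w - (t : ℂ) * conj a‖ ^ 2 - (t * R) ^ 2) =
      ‖(K : ℂ) - a * w‖ ^ 2 - (R * ‖w‖) ^ 2 := by
  rw [← hK, mul_pow R]
  simp only [Complex.sq_norm, normSq_apply, sub_re, sub_im, mul_re, mul_im, ofReal_re, ofReal_im,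
    conj_re, conj_im]
  ring

theorem norm_sub_ofReal_mul_conj_le_iff (w : ℂ) {a : ℂ} {K R : ℝ} (hK : 0 < K) (hR : 0 ≤ R)
    (ha : R < ‖a‖) :
    ‖w - ((K / (‖a‖ ^ 2 - R ^ 2) : ℝ) : ℂ) * conj a‖ ≤ K / (‖a‖ ^ 2 - R ^ 2) * R ↔
      ‖(K : ℂ) - a * w‖ ≤ R * ‖w‖ := by
  have hd : 0 < ‖a‖ ^ 2 - R ^ 2 := sub_pos.mpr (pow_lt_pow_left₀ ha hR two_ne_zero)
  rw [← pow_le_pow_iff_left₀ (norm_nonneg _) (by positivity) two_ne_zero,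
    ← pow_le_pow_iff_left₀ (norm_nonneg ((K : ℂ) - a * w)) (by positivity) two_ne_zero,
    ← sub_nonpos, ← sub_nonpos (a := ‖(K : ℂ) - a * w‖ ^ 2),
    ← sq_norm_sub_sub_sq_eq_of_mul_eq a w (div_mul_cancel₀ K hd.ne'),
    mul_nonpos_iff_pos_imp_nonpos]
  simp [hd, hd.le]

theorem setOf_norm_div_sub_le_eq_closedBall {a : ℂ} {K R : ℝ} (hK : 0 < K) (hR : 0 ≤ R)
    (ha : R < ‖a‖) :
    {w : ℂ | w ≠ 0 ∧ ‖(K : ℂ) / w - a‖ ≤ R} =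
      Metric.closedBall (((K / (‖a‖ ^ 2 - R ^ 2) : ℝ) : ℂ) * conj a)
        (K / (‖a‖ ^ 2 - R ^ 2) * R) := by
  ext w
  rw [mem_closedBall_iff_norm, norm_sub_ofReal_mul_conj_le_iff w hK hR ha, mem_ofPred_eq]
  rcases eq_or_ne w 0 with rfl | hw
  · simp [hK.ne']
  · have hfactor : (K : ℂ) - a * w = (K / w - a) * w := by rw [sub_mul, div_mul_cancel₀ _ hw]
    rw [hfactor, norm_mul, mul_le_mul_iff_of_pos_right (norm_pos_iff.mpr hw)]
    exact and_iff_right hw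

namespace IsAdmissible

variable {n : ℕ} {τ : ℂ} {σ : Fin n → ℂ} {lam : Fin n → ℝ} {ζ w : ℂ}

theorem regionZ_eq_closedBall (h : IsAdmissible τ σ lam) : regionZ τ σ lam =
    Metric.closedBall (τ / (2 * sumAlpha τ σ lam : ℝ)) (‖τ‖ / (2 * sumAlpha τ σ lam)) := by
  have hA := h.sumAlpha_pos
  have hA' : (sumAlpha τ σ lam : ℂ) ≠ 0 := ofReal_ne_zero.mpr hA.ne'
  have hτ := h.ne_zero
  ext ζ
  have hfactor : 2 * τ⁻¹ * (sumAlpha τ σ lam : ℂ) * ζ - 1 =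
      (ζ - τ / (2 * sumAlpha τ σ lam : ℝ)) / (τ / (2 * sumAlpha τ σ lam : ℝ)) := by
    push_cast
    field_simp
  rw [regionZ, mem_ofPred_eq, hfactor, norm_div, norm_div, Complex.norm_of_nonneg (by positivity),
    div_le_one (div_pos (norm_pos_iff.mpr hτ) (by positivity)), mem_closedBall_iff_norm]

theorem ell_re_mul_sq_norm (h : IsAdmissible τ σ lam) (hζ : ζ ≠ 0) :
    (ell τ σ lam ζ).re * ‖ζ‖ ^ 2 = sumAlpha τ σ lam *
      ((‖τ‖ / (2 * sumAlpha τ σ lam)) ^ 2 - ‖ζ - τ / (2 * sumAlpha τ σ lam : ℝ)‖ ^ 2) := by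
  have hA := h.sumAlpha_pos.ne'
  have hre : (τ / ζ).re * ‖ζ‖ ^ 2 = τ.re * ζ.re + τ.im * ζ.im := by
    have hζ' := normSq_pos.mpr hζ
    rw [div_re, Complex.sq_norm]
    field_simp
  rw [ell, sub_re, sub_mul, hre, ofReal_re, div_pow]
  simp only [Complex.sq_norm, normSq_apply, sub_re, sub_im, div_ofReal_re, div_ofReal_im]
  field_simp
  ring

theorem mem_regionZ_iff (h : IsAdmissible τ σ lam) (hζ : ζ ≠ 0) :
    ζ ∈ regionZ τ σ lam ↔ 0 ≤ (ell τ σ lam ζ).re := by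
  have hA := h.sumAlpha_pos
  rw [h.regionZ_eq_closedBall, mem_closedBall_iff_norm,
    ← mul_nonneg_iff_of_pos_right (pow_pos (norm_pos_iff.mpr hζ) 2), h.ell_re_mul_sq_norm hζ,
    mul_nonneg_iff_of_pos_left hA, sub_nonneg,
    pow_le_pow_iff_left₀ (norm_nonneg _) (by positivity) two_ne_zero]

theorem mem_interior_regionZ_iff (h : IsAdmissible τ σ lam) :
    ζ ∈ interior (regionZ τ σ lam) ↔ ζ ≠ 0 ∧ 0 < (ell τ σ lam ζ).re := by
  have hA := h.sumAlpha_pos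
  rw [h.regionZ_eq_closedBall, interior_closedBall _
    (div_pos (norm_pos_iff.mpr h.ne_zero) (by positivity)).ne', mem_ball_iff_norm]
  rcases eq_or_ne ζ 0 with rfl | hζ
  · simp [abs_of_pos hA]
  · rw [and_iff_right hζ, ← mul_pos_iff_of_pos_right (pow_pos (norm_pos_iff.mpr hζ) 2),
      h.ell_re_mul_sq_norm hζ, mul_pos_iff_of_pos_left hA, sub_pos,
      pow_lt_pow_iff_left₀ (norm_nonneg _) (by positivity) two_ne_zero]

theorem mem_frontier_regionZ_iff (h : IsAdmissible τ σ lam) (hζ : ζ ≠ 0) :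
    ζ ∈ frontier (regionZ τ σ lam) ↔ (ell τ σ lam ζ).re = 0 := by
  have hclosed : IsClosed (regionZ τ σ lam) := h.regionZ_eq_closedBall ▸ Metric.isClosed_closedBall
  rw [hclosed.frontier_eq, Set.mem_sdiff, h.mem_regionZ_iff hζ, h.mem_interior_regionZ_iff,
    and_iff_right hζ, not_lt, le_antisymm_iff, and_comm]

theorem regionΩ_eq_closedBall (h : IsAdmissible τ σ lam) (hζ : ζ ≠ 0)
    (hre : 0 ≤ (ell τ σ lam ζ).re) : ∃ c : ℂ, ∃ t : ℝ, 0 < t ∧ regionΩ τ σ lam ζ =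
      Metric.closedBall c (t * (2 * ‖τ‖ / (1 - ‖τ‖ ^ 2) * (ell τ σ lam ζ).re)) := by
  have hD := one_sub_sq_norm_pos h.mem
  have hR : 0 ≤ 2 * ‖τ‖ / (1 - ‖τ‖ ^ 2) * (ell τ σ lam ζ).re := by positivity
  have hlt : 2 * ‖τ‖ / (1 - ‖τ‖ ^ 2) * (ell τ σ lam ζ).re < ‖centerA τ σ lam ζ‖ :=
    calc
      2 * ‖τ‖ / (1 - ‖τ‖ ^ 2) * (ell τ σ lam ζ).re
        ≤ (1 + ‖τ‖ ^ 2) / (1 - ‖τ‖ ^ 2) * (ell τ σ lam ζ).re := by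
          gcongr
          linarith [two_mul_le_add_sq 1 ‖τ‖]
      _ < (1 + ‖τ‖ ^ 2) / (1 - ‖τ‖ ^ 2) * (ell τ σ lam ζ).re + (p₀ τ σ lam τ).re :=
          lt_add_of_pos_right _ (h.p₀_re_pos h.mem)
      _ = (centerA τ σ lam ζ).re := by
          rw [centerA, add_re, add_re, ofReal_re, re_mul_ofReal, I_re, zero_mul, add_zero]
      _ ≤ ‖centerA τ σ lam ζ‖ := re_le_norm _
  have hden := sub_pos.mpr (pow_lt_pow_left₀ hlt hR two_ne_zero)
  exact ⟨_, _, div_pos hD hden,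
    (if_neg hζ).trans (setOf_norm_div_sub_le_eq_closedBall hD hR hlt)⟩

theorem exists_regionΩ_eq_closedBall (h : IsAdmissible τ σ lam)
    (hζ : ζ ∈ interior (regionZ τ σ lam)) :
    ∃ c : ℂ, ∃ r : ℝ, 0 < r ∧ regionΩ τ σ lam ζ = Metric.closedBall c r := by
  obtain ⟨hζ0, hre⟩ := h.mem_interior_regionZ_iff.mp hζ
  obtain ⟨c, t, ht, heq⟩ := h.regionΩ_eq_closedBall hζ0 hre.le
  have hτ := norm_pos_iff.mpr h.ne_zero
  have hD := one_sub_sq_norm_pos h.mem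
  exact ⟨c, _, by positivity, heq⟩

theorem exists_regionΩ_eq_singleton (h : IsAdmissible τ σ lam)
    (hζ : ζ ∈ frontier (regionZ τ σ lam)) : ∃ c : ℂ, regionΩ τ σ lam ζ = {c} := by
  rcases eq_or_ne ζ 0 with rfl | hζ0
  · exact ⟨0, if_pos rfl⟩
  · have hre := (h.mem_frontier_regionZ_iff hζ0).mp hζ
    obtain ⟨c, t, -, heq⟩ := h.regionΩ_eq_closedBall hζ0 hre.ge
    exact ⟨c, by rw [heq, hre, mul_zero, mul_zero, Metric.closedBall_zero]⟩

theorem mem_regionΩ_iff (h : IsAdmissible τ σ lam) (hζ : ζ ≠ 0) (hre : 0 ≤ (ell τ σ lam ζ).re) :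
    w ∈ regionΩ τ σ lam ζ ↔ w ≠ 0 ∧ h.toValue.symm (ζ, w) ∈ schwarzPickRegion ‖τ‖ := by
  rw [regionΩ, if_neg hζ, mem_ofPred_eq, toValue_symm_apply, schwarzPickRegion, mem_ofPred_eq,
    and_iff_right hre, norm_sub_le_mul_iff _ (norm_nonneg τ) (mem_ball_zero_iff.mp h.mem) hre,
    centerA, sub_sub _ (p₀ τ σ lam τ), add_comm (p₀ τ σ lam τ)]

theorem valueRegion_eq (h : IsAdmissible τ σ lam) :
    valueRegion τ σ lam = {P | P.1 ∈ regionZ τ σ lam ∧ P.2 ∈ regionΩ τ σ lam P.1} := by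
  ext ⟨ζ, w⟩
  rw [mem_ofPred_eq]
  rcases eq_or_ne ζ 0 with rfl | hζ
  · have h0 : (0 : ℂ) ∈ regionZ τ σ lam := by simp [regionZ]
    rw [regionΩ, if_pos rfl, and_iff_right h0, mem_singleton_iff]
    refine ⟨fun hP => ?_, by rintro rfl; exact h.zero_mem_valueRegion⟩
    by_contra hw
    exact (h.mem_target_of_mem_valueRegion hP fun hP0 => hw (congrArg Prod.snd hP0)).1 rfl
  · rw [h.valueRegion_eq_insert_image, h.mem_regionZ_iff hζ, mem_insert_iff,
      or_iff_right fun hP0 => hζ (congrArg Prod.fst hP0),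
      h.toValue.image_eq_target_inter_inv_preimage h.schwarzPickRegion_subset_source]
    refine ⟨fun hP => ⟨hP.2.1, (h.mem_regionΩ_iff hζ hP.2.1).mpr ⟨hP.1.2, hP.2⟩⟩, fun hP => ?_⟩
    obtain ⟨hw, hP'⟩ := (h.mem_regionΩ_iff hζ hP.1).mp hP.2
    exact ⟨⟨hζ, hw⟩, hP'⟩

theorem p₀_re (h : IsAdmissible τ σ lam) :
    (p₀ τ σ lam τ).re = (1 - ‖τ‖ ^ 2) / 2 * ∑ k, 1 / |lam k| := by
  rw [p₀, re_sum, Finset.mul_sum]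
  refine Finset.sum_congr rfl fun k _ => ?_
  have hd := h.norm_sub_pos k
  have hlam := abs_pos.mpr (h.neg k).ne
  rw [re_ofReal_mul, re_add_div_sub, h.norm_eq, alpha, norm_sub_rev (σ k)]
  field_simp

theorem p₀_im (h : IsAdmissible τ σ lam) : (p₀ τ σ lam τ).im = sumB τ σ lam := by
  rw [p₀, im_sum, sumB]
  refine Finset.sum_congr rfl fun k _ => ?_
  have hd := h.norm_sub_pos k
  have hlam := abs_pos.mpr (h.neg k).ne
  have him : ((σ k + τ) / (σ k - τ)).im = 2 * (conj (σ k) * τ).im / ‖τ - σ k‖ ^ 2 := by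
    rw [norm_sub_rev, Complex.sq_norm, div_im, ← sub_div]
    congr 1
    simp only [add_re, add_im, sub_re, sub_im, mul_im, conj_re, conj_im]
    ring
  rw [im_ofReal_mul, him, alpha]
  field_simp

end IsAdmissible

/-! ### The extremal generators -/

namespace IsAdmissible

variable {n : ℕ} {τ : ℂ} {σ : Fin n → ℂ} {lam : Fin n → ℝ} {f g G : ℂ → ℂ} {s L : ℂ} {P : ℂ × ℂ}

theorem add_sumAlpha_ne_zero (h : IsAdmissible τ σ lam) (hL : 0 ≤ L.re) :
    L + sumAlpha τ σ lam ≠ 0 := fun h0 => by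
  have hre := congrArg re h0
  rw [add_re, ofReal_re, zero_re] at hre
  linarith [h.sumAlpha_pos]

theorem ell_div_add_sumAlpha (h : IsAdmissible τ σ lam) (L : ℂ) :
    ell τ σ lam (τ / (L + sumAlpha τ σ lam)) = L := by
  rw [ell, div_div_cancel₀ h.ne_zero, add_sub_cancel_right]

theorem extremalInt_eq_genOfRemainder (hs : ‖s‖ = 1) (ζ : ℂ) : extremalInt τ σ lam ζ s =
    genOfRemainder τ σ lam (herglotz (ell τ σ lam ζ) (conj s)) := by
  funext z
  rw [extremalInt, genOfRemainder, berksonPorta, Pi.inv_apply, Pi.add_apply, herglotz,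
    add_div_sub_eq hs, div_eq_mul_inv]

theorem extremalBdry_eq_genOfRemainder {ζ : ℂ} (hζ : (ell τ σ lam ζ).re = 0) (κ : ℂ) :
    extremalBdry τ σ lam ζ = genOfRemainder τ σ lam (herglotz (ell τ σ lam ζ) κ) := by
  funext z
  rw [extremalBdry, genOfRemainder, berksonPorta, Pi.inv_apply, Pi.add_apply, herglotz, hζ,
    ofReal_zero, mul_zero, zero_add, div_eq_mul_inv]

theorem isExtremalInt_iff (h : IsAdmissible τ σ lam) (hs : ‖s‖ = 1) : IsExtremalInt τ σ lam s G ↔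
    ∃ L : ℂ, 0 < L.re ∧ EqOn G (genOfRemainder τ σ lam (herglotz L (conj s))) unitDisk := by
  constructor
  · rintro ⟨ζ, hζ, hG⟩
    exact ⟨_, (h.mem_interior_regionZ_iff.mp hζ).2, extremalInt_eq_genOfRemainder hs ζ ▸ hG⟩
  · rintro ⟨L, hL, hG⟩
    have hell := h.ell_div_add_sumAlpha L
    refine ⟨τ / (L + sumAlpha τ σ lam), h.mem_interior_regionZ_iff.mpr
      ⟨div_ne_zero h.ne_zero (h.add_sumAlpha_ne_zero hL.le), hell.symm ▸ hL⟩, ?_⟩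
    rwa [extremalInt_eq_genOfRemainder hs, hell]

theorem isExtremalBdry_iff (h : IsAdmissible τ σ lam) (κ : ℂ) : IsExtremalBdry τ σ lam G ↔
    ∃ L : ℂ, L.re = 0 ∧ EqOn G (genOfRemainder τ σ lam (herglotz L κ)) unitDisk := by
  constructor
  · rintro ⟨ζ, hζ, hζ0, hG⟩
    have hre := (h.mem_frontier_regionZ_iff hζ0).mp hζ
    exact ⟨_, hre, extremalBdry_eq_genOfRemainder hre κ ▸ hG⟩
  · rintro ⟨L, hL, hG⟩
    have hell := h.ell_div_add_sumAlpha L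
    have hζ0 := div_ne_zero h.ne_zero (h.add_sumAlpha_ne_zero hL.ge)
    refine ⟨_, (h.mem_frontier_regionZ_iff hζ0).mpr (hell.symm ▸ hL), hζ0, ?_⟩
    rwa [extremalBdry_eq_genOfRemainder (hell.symm ▸ hL) κ, hell]

theorem isExtremalBdry_or_isExtremalInt_iff (h : IsAdmissible τ σ lam) (hs : ‖s‖ = 1) :
    IsExtremalBdry τ σ lam G ∨ IsExtremalInt τ σ lam s G ↔
      ∃ L : ℂ, 0 ≤ L.re ∧ EqOn G (genOfRemainder τ σ lam (herglotz L (conj s))) unitDisk := by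
  simp only [h.isExtremalBdry_iff (conj s), h.isExtremalInt_iff hs, ← exists_or, ← or_and_right,
    le_iff_eq_or_lt, eq_comm (a := (0 : ℝ))]

theorem isExtremal_iff (h : IsAdmissible τ σ lam) : IsExtremal τ σ lam G ↔
    EqOn G 0 unitDisk ∨ ∃ L κ : ℂ, 0 ≤ L.re ∧ ‖κ‖ = 1 ∧
      EqOn G (genOfRemainder τ σ lam (herglotz L κ)) unitDisk := by
  constructor
  · rintro (⟨s, hs, hG⟩ | hG | hG)
    · obtain ⟨L, hL, hG⟩ := (h.isExtremalInt_iff hs).mp hG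
      exact Or.inr ⟨L, conj s, hL.le, (Complex.norm_conj s).trans hs, hG⟩
    · obtain ⟨L, hL, hG⟩ := (h.isExtremalBdry_iff 1).mp hG
      exact Or.inr ⟨L, 1, hL.ge, norm_one, hG⟩
    · exact Or.inl hG
  · rintro (hG | ⟨L, κ, hL, hκ, hG⟩)
    · exact Or.inr (Or.inr hG)
    · have hs : ‖conj κ‖ = 1 := (Complex.norm_conj κ).trans hκ
      rw [← conj_conj κ] at hG
      rcases (h.isExtremalBdry_or_isExtremalInt_iff hs).mpr ⟨L, hL, hG⟩ with hB | hI
      · exact Or.inr (Or.inl hB)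
      · exact Or.inl ⟨conj κ, hs, hI⟩

theorem herglotz_mem_frontier_schwarzPickRegion (h : IsAdmissible τ σ lam) {κ : ℂ}
    (hL : 0 ≤ L.re) (hκ : ‖κ‖ = 1) :
    (herglotz L κ 0, herglotz L κ τ) ∈ frontier (schwarzPickRegion ‖τ‖) := by
  rw [mem_frontier_schwarzPickRegion_iff (norm_pos_iff.mpr h.ne_zero)
    (mem_ball_zero_iff.mp h.mem), herglotz_zero]
  exact ⟨hL, norm_herglotz_sub hκ h.mem⟩

theorem mem_gen_and_mem_frontier_of_isExtremal (h : IsAdmissible τ σ lam)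
    (hG : IsExtremal τ σ lam G) :
    G ∈ Gen τ σ lam ∧ ∀ P, Delivers τ G P → P ∈ frontier (valueRegion τ σ lam) := by
  rcases h.isExtremal_iff.mp hG with hG0 | ⟨L, κ, hL, hκ, hG⟩
  · refine ⟨h.mem_gen_of_eqOn_zero hG0, fun P hP => ?_⟩
    rw [(h.delivers_iff_of_eqOn_zero hG0).mp hP]
    exact h.zero_mem_frontier_valueRegion
  · have hf := isCaratheodory_herglotz hL hκ.le
    refine ⟨h.mem_gen_of_eqOn_herglotz hL hκ.le hG, fun P hP => ?_⟩
    rw [← (h.delivers_iff hf hG).mp hP, h.toValue_mem_frontier_valueRegion_iff hf]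
    exact h.herglotz_mem_frontier_schwarzPickRegion hL hκ

theorem eqOn_zero_of_delivers_zero (h : IsAdmissible τ σ lam) (hG : G ∈ Gen τ σ lam)
    (hG0 : Delivers τ G 0) : EqOn G 0 unitDisk := by
  by_contra hne
  obtain ⟨f, hf, hGf⟩ := h.exists_eqOn_genOfRemainder hG hne
  have hmem := h.toValue.map_source
    (h.schwarzPickRegion_subset_source (hf.mem_schwarzPickRegion h.mem))
  rw [(h.delivers_iff hf hGf).mp hG0] at hmem
  exact hmem.1 rfl

theorem eq_of_toValue_eq (h : IsAdmissible τ σ lam) (hf : IsCaratheodory f)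
    (hg : IsCaratheodory g) (heq : h.toValue (f 0, f τ) = h.toValue (g 0, g τ)) :
    (f 0, f τ) = (g 0, g τ) :=
  h.toValue.injOn (h.schwarzPickRegion_subset_source (hf.mem_schwarzPickRegion h.mem))
    (h.schwarzPickRegion_subset_source (hg.mem_schwarzPickRegion h.mem)) heq

theorem isExtremal_of_delivers_mem_frontier (h : IsAdmissible τ σ lam) (hG : G ∈ Gen τ σ lam)
    (hP : P ∈ frontier (valueRegion τ σ lam)) (hGP : Delivers τ G P) : IsExtremal τ σ lam G := by
  refine h.isExtremal_iff.mpr (or_iff_not_imp_left.mpr fun hG0 => ?_)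
  obtain ⟨f, hf, hGf⟩ := h.exists_eqOn_genOfRemainder hG hG0
  rw [← (h.delivers_iff hf hGf).mp hGP, h.toValue_mem_frontier_valueRegion_iff hf] at hP
  obtain ⟨κ, hκ, hfκ⟩ := hf.exists_eqOn_herglotz_of_mem_frontier h.mem h.ne_zero hP
  exact ⟨f 0, κ, hf.re_nonneg 0 (by simp), hκ, hGf.trans (eqOn_genOfRemainder_congr hfκ)⟩

theorem eqOn_of_delivers_mem_frontier (h : IsAdmissible τ σ lam) {G' : ℂ → ℂ}
    (hP : P ∈ frontier (valueRegion τ σ lam)) (hG : G ∈ Gen τ σ lam) (hGP : Delivers τ G P)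
    (hG' : G' ∈ Gen τ σ lam) (hGP' : Delivers τ G' P) : EqOn G' G unitDisk := by
  rcases eq_or_ne P 0 with rfl | hP0
  · exact (h.eqOn_zero_of_delivers_zero hG' hGP').trans (h.eqOn_zero_of_delivers_zero hG hGP).symm
  have hne : ∀ {G}, Delivers τ G P → ¬ EqOn G 0 unitDisk := fun hGP hG0 =>
    hP0 ((h.delivers_iff_of_eqOn_zero hG0).mp hGP)
  obtain ⟨f, hf, hGf⟩ := h.exists_eqOn_genOfRemainder hG (hne hGP)
  obtain ⟨f', hf', hGf'⟩ := h.exists_eqOn_genOfRemainder hG' (hne hGP')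
  have hval := (h.delivers_iff hf hGf).mp hGP
  have hval' := (h.delivers_iff hf' hGf').mp hGP'
  rw [← hval', h.toValue_mem_frontier_valueRegion_iff hf'] at hP
  have hff := hf'.eqOn_of_mem_frontier hf h.mem h.ne_zero
    (h.eq_of_toValue_eq hf' hf (hval'.trans hval.symm)) hP
  exact hGf'.trans ((eqOn_genOfRemainder_congr hff).trans hGf.symm)

theorem exists_isExtremal_of_mem_frontier (h : IsAdmissible τ σ lam)
    (hP : P ∈ frontier (valueRegion τ σ lam)) : ∃ G ∈ Gen τ σ lam,
      IsExtremal τ σ lam G ∧ Delivers τ G P ∧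
      ∀ G' ∈ Gen τ σ lam, Delivers τ G' P → EqOn G' G unitDisk := by
  obtain ⟨G, hG, hGP⟩ := h.isCompact_valueRegion.isClosed.frontier_subset hP
  exact ⟨G, hG, h.isExtremal_of_delivers_mem_frontier hG hP hGP, hGP, fun G' hG' hGP' =>
    h.eqOn_of_delivers_mem_frontier hP hG hGP hG' hGP'⟩

theorem mem_genExact_of_isExtremalBdry (h : IsAdmissible τ σ lam)
    (hG : IsExtremalBdry τ σ lam G) : G ∈ GenExact τ σ lam := by
  obtain ⟨L, hL, hG⟩ := (h.isExtremalBdry_iff 1).mp hG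
  exact h.mem_genExact_of_eqOn_herglotz hL.ge norm_one.le (fun _ _ => hL) hG

theorem mem_genExact_of_isExtremalInt (h : IsAdmissible τ σ lam) (hs : ‖s‖ = 1)
    (hsσ : s ∉ range σ) (hG : IsExtremalInt τ σ lam s G) : G ∈ GenExact τ σ lam := by
  obtain ⟨L, hL, hG⟩ := (h.isExtremalInt_iff hs).mp hG
  refine h.mem_genExact_of_eqOn_herglotz hL.le ((Complex.norm_conj s).trans hs).le
    (fun k hk => (hsσ ⟨k, ?_⟩).elim) hG
  have hss := conj_mul_self_of_norm_eq_one hs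
  exact mul_left_cancel₀ (left_ne_zero_of_mul_eq_one hss) (hk.trans hss.symm)

theorem existsUnique_hasSpectralValue (h : IsAdmissible τ σ lam) (hG : G ∈ Gen τ σ lam) :
    ∃! w : ℂ, HasSpectralValue G τ w := by
  obtain ⟨φ, hg, hdw, -⟩ := hG
  have h0 := hg.apply_eq_zero h.mem fun t ht => hdw.apply_eq_self h.mem ht
  simp only [hg.hasSpectralValue_iff h.mem h0, existsUnique_eq]

end IsAdmissible

/-! ### The sharp inequalities -/

theorem re_conj_mul_eq_iff {d η : ℂ} {ρ : ℝ} (hη : ‖η‖ = 1) (hd : ‖d‖ ≤ ρ) :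
    (conj η * d).re = ρ ↔ d = ρ * η := by
  constructor
  · intro h
    have hsq : ‖d - ρ * η‖ ^ 2 = ‖d‖ ^ 2 + ρ ^ 2 - 2 * ρ * (conj η * d).re := by
      have hη2 : η.re * η.re + η.im * η.im = 1 := by
        rw [← normSq_apply, ← Complex.sq_norm, hη, one_pow]
      simp only [Complex.sq_norm, normSq_apply, sub_re, sub_im, mul_re, mul_im, conj_re, conj_im,
        ofReal_re, ofReal_im]
      linear_combination ρ ^ 2 * hη2
    refine sub_eq_zero.mp (norm_eq_zero.mp (pow_eq_zero_iff two_ne_zero |>.mp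
      (le_antisymm ?_ (sq_nonneg _))))
    nlinarith [norm_nonneg d]
  · rintro rfl
    rw [mul_left_comm, conj_mul_self_of_norm_eq_one hη, mul_one, ofReal_re]

/-- Parametrization of the unit circle by the directions `η` in the Schwarz-Pick disk: the Herglotz
function with pole at `τ / ‖τ‖ * circleParam ‖τ‖ η` takes at `τ` the boundary value of that disk in
the direction `η`. -/
noncomputable def circleParam (r : ℝ) (η : ℂ) : ℂ := (r + conj η) / (1 + r * conj η)

section

variable {r : ℝ}

theorem one_add_ofReal_mul_ne_zero (hr0 : 0 ≤ r) (hr : r < 1) {η : ℂ} (hη : ‖η‖ = 1) :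
    1 + (r : ℂ) * η ≠ 0 := by
  have hmem : (r : ℂ) ∈ unitDisk := by rwa [mem_ball_zero_iff, Complex.norm_of_nonneg hr0]
  have h := one_sub_mul_ne_zero ((norm_neg η).trans hη).le hmem
  rwa [neg_mul, sub_neg_eq_add, mul_comm] at h

theorem norm_circleParam (hr0 : 0 ≤ r) (hr : r < 1) {η : ℂ} (hη : ‖η‖ = 1) :
    ‖circleParam r η‖ = 1 := by
  have hconj : ‖conj η‖ = 1 := (Complex.norm_conj η).trans hη
  have hfactor : (r : ℂ) + conj η = conj (1 + r * conj η) * conj η := by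
    rw [map_add, map_one, map_mul, conj_ofReal, conj_conj]
    linear_combination -(r : ℂ) * conj_mul_self_of_norm_eq_one hη
  rw [circleParam, hfactor, norm_div, norm_mul, Complex.norm_conj, hconj, mul_one,
    div_self (norm_ne_zero_iff.mpr (one_add_ofReal_mul_ne_zero hr0 hr hconj))]

theorem circleParam_one (hr0 : 0 ≤ r) (hr : r < 1) : circleParam r 1 = 1 := by
  have hne := one_add_ofReal_mul_ne_zero hr0 hr norm_one
  rw [circleParam, map_one, div_eq_one_iff_eq hne, mul_one, add_comm]

theorem circleParam_neg_one (hr : r < 1) : circleParam r (-1) = -1 := by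
  have hne : (1 : ℂ) - r ≠ 0 := sub_ne_zero.mpr (by exact_mod_cast hr.ne')
  rw [circleParam, map_neg, map_one, mul_neg_one, ← sub_eq_add_neg, ← sub_eq_add_neg,
    div_eq_iff hne]
  ring

theorem circleParam_I (hr0 : 0 ≤ r) (hr : r < 1) :
    circleParam r I = (2 * r - I * (1 - r ^ 2)) / (1 + r ^ 2) := by
  have hsq : (1 : ℂ) + r ^ 2 ≠ 0 := by exact_mod_cast (by positivity : 1 + r ^ 2 ≠ 0)
  rw [circleParam, div_eq_div_iff (one_add_ofReal_mul_ne_zero hr0 hr (by simp)) hsq, conj_I]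
  linear_combination (-(r : ℂ) + r ^ 3) * I_sq

theorem circleParam_neg_I (hr0 : 0 ≤ r) (hr : r < 1) :
    circleParam r (-I) = (2 * r + I * (1 - r ^ 2)) / (1 + r ^ 2) := by
  have hsq : (1 : ℂ) + r ^ 2 ≠ 0 := by exact_mod_cast (by positivity : 1 + r ^ 2 ≠ 0)
  rw [circleParam, div_eq_div_iff (one_add_ofReal_mul_ne_zero hr0 hr (by simp)) hsq, map_neg,
    conj_I, neg_neg]
  linear_combination (-(r : ℂ) + r ^ 3) * I_sq

end

section

variable {τ : ℂ}

theorem norm_div_norm_mul_circleParam (hτ : τ ∈ unitDisk) (hτ0 : τ ≠ 0) {η : ℂ} (hη : ‖η‖ = 1) :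
    ‖τ / ‖τ‖ * circleParam ‖τ‖ η‖ = 1 := by
  rw [norm_mul, norm_circleParam (norm_nonneg τ) (mem_ball_zero_iff.mp hτ) hη, norm_div, norm_real,
    norm_norm, div_self (norm_ne_zero_iff.mpr hτ0), mul_one]

theorem conj_div_norm_mul_circleParam_mul (τ η : ℂ) :
    conj (τ / ‖τ‖ * circleParam ‖τ‖ η) * τ = ‖τ‖ * (‖τ‖ + η) / (1 + ‖τ‖ * η) := by
  rcases eq_or_ne τ 0 with rfl | hτ0
  · simp
  have hτ' : (‖τ‖ : ℂ) ≠ 0 := ofReal_ne_zero.mpr (norm_ne_zero_iff.mpr hτ0)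
  simp only [circleParam, map_mul, map_div₀, map_add, map_one, conj_ofReal, conj_conj]
  rw [mul_right_comm, div_mul_eq_mul_div, conj_mul', sq, mul_div_cancel_right₀ _ hτ', mul_div_assoc]

theorem herglotz_circleParam (hτ : τ ∈ unitDisk) {η : ℂ} (hη : ‖η‖ = 1) (L : ℂ) :
    herglotz L (conj (τ / ‖τ‖ * circleParam ‖τ‖ η)) τ =
      (((1 + ‖τ‖ ^ 2) / (1 - ‖τ‖ ^ 2) * L.re : ℝ) + I * L.im)
        + (2 * ‖τ‖ / (1 - ‖τ‖ ^ 2) * L.re : ℝ) * η := by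
  have hden : (1 : ℂ) + ‖τ‖ * η ≠ 0 :=
    one_add_ofReal_mul_ne_zero (norm_nonneg τ) (mem_ball_zero_iff.mp hτ) hη
  have hnorm : (1 : ℂ) - ‖τ‖ ^ 2 ≠ 0 := by exact_mod_cast (one_sub_sq_norm_pos hτ).ne'
  have hadd : 1 + (‖τ‖ : ℂ) * (‖τ‖ + η) / (1 + ‖τ‖ * η)
      = (1 + ‖τ‖ ^ 2 + 2 * ‖τ‖ * η) / (1 + ‖τ‖ * η) := by
    rw [add_div' _ _ _ hden]
    ring
  have hsub : 1 - (‖τ‖ : ℂ) * (‖τ‖ + η) / (1 + ‖τ‖ * η) = (1 - ‖τ‖ ^ 2) / (1 + ‖τ‖ * η) := by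
    rw [sub_div' hden]
    ring
  rw [herglotz, conj_div_norm_mul_circleParam_mul, hadd, hsub, div_div_div_cancel_right₀ hden]
  push_cast
  field_simp
  ring

end

namespace IsAdmissible

variable {n : ℕ} {τ : ℂ} {σ : Fin n → ℂ} {lam : Fin n → ℝ} {f g G : ℂ → ℂ}

theorem values_eq_of_eqOn_genOfRemainder (h : IsAdmissible τ σ lam) (hf : IsCaratheodory f)
    (hg : IsCaratheodory g) (hGf : EqOn G (genOfRemainder τ σ lam f) unitDisk)
    (hGg : EqOn G (genOfRemainder τ σ lam g) unitDisk) : f 0 = g 0 ∧ f τ = g τ :=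
  Prod.mk.inj (h.eq_of_toValue_eq hf hg
    ((h.delivers_iff hf hGf).mp ((h.delivers_iff hg hGg).mpr rfl)))

theorem isExtremalBdry_iff_re_eq_zero (h : IsAdmissible τ σ lam) (hf : IsCaratheodory f)
    (hG : EqOn G (genOfRemainder τ σ lam f) unitDisk) :
    IsExtremalBdry τ σ lam G ↔ (f 0).re = 0 := by
  rw [h.isExtremalBdry_iff 1]
  constructor
  · rintro ⟨L, hL, hGL⟩
    rw [(h.values_eq_of_eqOn_genOfRemainder hf
      (isCaratheodory_herglotz hL.ge norm_one.le) hG hGL).1, herglotz_zero, hL]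
  · intro hre
    refine ⟨f 0, hre, hG.trans (eqOn_genOfRemainder_congr ?_)⟩
    rw [herglotz_of_re_eq_zero hre]
    exact hf.eqOn_const_of_re_eq_zero (by simp) hre

theorem isExtremalBdry_or_isExtremalInt_iff_apply_eq (h : IsAdmissible τ σ lam)
    (hf : IsCaratheodory f) (hG : EqOn G (genOfRemainder τ σ lam f) unitDisk) {s : ℂ}
    (hs : ‖s‖ = 1) : IsExtremalBdry τ σ lam G ∨ IsExtremalInt τ σ lam s G ↔
      f τ = herglotz (f 0) (conj s) τ := by
  have hκ : ‖conj s‖ = 1 := (Complex.norm_conj s).trans hs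
  have hL := hf.re_nonneg 0 (by simp)
  rw [h.isExtremalBdry_or_isExtremalInt_iff hs]
  constructor
  · rintro ⟨L, hL, hGL⟩
    obtain ⟨h0, hτ⟩ :=
      h.values_eq_of_eqOn_genOfRemainder hf (isCaratheodory_herglotz hL hκ.le) hG hGL
    rw [hτ, h0, herglotz_zero]
  · intro hτ
    refine ⟨f 0, hL, hG.trans (eqOn_genOfRemainder_congr ?_)⟩
    have hval : (f 0, f τ) = (herglotz (f 0) (conj s) 0, herglotz (f 0) (conj s) τ) := by
      rw [herglotz_zero, ← hτ]
    exact hf.eqOn_of_mem_frontier (isCaratheodory_herglotz hL hκ.le) h.mem h.ne_zero hval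
      (hval ▸ h.herglotz_mem_frontier_schwarzPickRegion hL hκ)

/-- The support function of the Schwarz-Pick disk in the direction `η`; each of the inequalities
(b) and (c) is the case of one of the four directions `±1`, `±I`. -/
theorem re_conj_mul_le (h : IsAdmissible τ σ lam) (hf : IsCaratheodory f)
    (hG : EqOn G (genOfRemainder τ σ lam f) unitDisk) {η : ℂ} (hη : ‖η‖ = 1) :
    (conj η * (f τ - (((1 + ‖τ‖ ^ 2) / (1 - ‖τ‖ ^ 2) * (f 0).re : ℝ) + I * (f 0).im))).re
        ≤ 2 * ‖τ‖ / (1 - ‖τ‖ ^ 2) * (f 0).re ∧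
      ((conj η * (f τ - (((1 + ‖τ‖ ^ 2) / (1 - ‖τ‖ ^ 2) * (f 0).re : ℝ) + I * (f 0).im))).re
        = 2 * ‖τ‖ / (1 - ‖τ‖ ^ 2) * (f 0).re ↔
        IsExtremalBdry τ σ lam G ∨
          IsExtremalInt τ σ lam (τ / ‖τ‖ * circleParam ‖τ‖ η) G) := by
  have hdisk := (norm_sub_le_mul_iff (f τ) (norm_nonneg τ) (mem_ball_zero_iff.mp h.mem)
    (hf.re_nonneg 0 (by simp))).mp (hf.norm_sub_apply_zero_le h.mem)
  refine ⟨(re_le_norm _).trans ?_, ?_⟩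
  · rwa [norm_mul, Complex.norm_conj, hη, one_mul]
  · rw [re_conj_mul_eq_iff hη hdisk, h.isExtremalBdry_or_isExtremalInt_iff_apply_eq hf hG
      (norm_div_norm_mul_circleParam h.mem h.ne_zero hη), herglotz_circleParam h.mem hη,
      sub_eq_iff_eq_add']

theorem mul_re_le_re (h : IsAdmissible τ σ lam) (hf : IsCaratheodory f)
    (hG : EqOn G (genOfRemainder τ σ lam f) unitDisk) :
    (1 - ‖τ‖) / (1 + ‖τ‖) * (f 0).re ≤ (f τ).re ∧
      ((1 - ‖τ‖) / (1 + ‖τ‖) * (f 0).re = (f τ).re ↔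
        IsExtremalBdry τ σ lam G ∨ IsExtremalInt τ σ lam (-(τ / ‖τ‖)) G) := by
  have hcoef : (1 - ‖τ‖) / (1 + ‖τ‖) * (f 0).re =
      (1 + ‖τ‖ ^ 2) / (1 - ‖τ‖ ^ 2) * (f 0).re - 2 * ‖τ‖ / (1 - ‖τ‖ ^ 2) * (f 0).re := by
    have hsq := (one_sub_sq_norm_pos h.mem).ne'
    have hadd : 1 + ‖τ‖ ≠ 0 := by positivity
    field_simp
    ring
  have hdir := h.re_conj_mul_le hf hG (η := -1) (by simp)
  rw [circleParam_neg_one (mem_ball_zero_iff.mp h.mem), mul_neg_one] at hdir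
  simp only [map_neg, map_one, neg_mul, one_mul, neg_re, sub_re, add_re, ofReal_re, mul_re, I_re,
    I_im, ofReal_im, zero_mul, mul_zero, sub_zero, add_zero] at hdir
  rw [hcoef, ← hdir.2]
  exact ⟨by linarith [hdir.1], by constructor <;> intro <;> linarith⟩

theorem re_le_mul_re (h : IsAdmissible τ σ lam) (hf : IsCaratheodory f)
    (hG : EqOn G (genOfRemainder τ σ lam f) unitDisk) :
    (f τ).re ≤ (1 + ‖τ‖) / (1 - ‖τ‖) * (f 0).re ∧
      ((f τ).re = (1 + ‖τ‖) / (1 - ‖τ‖) * (f 0).re ↔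
        IsExtremalBdry τ σ lam G ∨ IsExtremalInt τ σ lam (τ / ‖τ‖) G) := by
  have hcoef : (1 + ‖τ‖) / (1 - ‖τ‖) * (f 0).re =
      (1 + ‖τ‖ ^ 2) / (1 - ‖τ‖ ^ 2) * (f 0).re + 2 * ‖τ‖ / (1 - ‖τ‖ ^ 2) * (f 0).re := by
    have hsq := (one_sub_sq_norm_pos h.mem).ne'
    have hsub : 1 - ‖τ‖ ≠ 0 := sub_ne_zero.mpr (mem_ball_zero_iff.mp h.mem).ne'
    field_simp
    ring
  have hdir := h.re_conj_mul_le hf hG norm_one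
  rw [circleParam_one (norm_nonneg τ) (mem_ball_zero_iff.mp h.mem), mul_one] at hdir
  simp only [map_one, one_mul, sub_re, add_re, ofReal_re, mul_re, I_re, I_im, ofReal_im, zero_mul,
    mul_zero, sub_zero, add_zero] at hdir
  rw [hcoef, ← hdir.2]
  exact ⟨by linarith [hdir.1], by constructor <;> intro <;> linarith⟩

theorem abs_im_sub_le (h : IsAdmissible τ σ lam) (hf : IsCaratheodory f)
    (hG : EqOn G (genOfRemainder τ σ lam f) unitDisk) :
    |(f τ - f 0).im| ≤ 2 * ‖τ‖ / (1 - ‖τ‖ ^ 2) * (f 0).re ∧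
      (|(f τ - f 0).im| = 2 * ‖τ‖ / (1 - ‖τ‖ ^ 2) * (f 0).re ↔
        IsExtremalBdry τ σ lam G ∨
        IsExtremalInt τ σ lam
          (τ / ‖τ‖ * ((2 * ‖τ‖ + I * (1 - ‖τ‖ ^ 2)) / (1 + ‖τ‖ ^ 2))) G ∨
        IsExtremalInt τ σ lam
          (τ / ‖τ‖ * ((2 * ‖τ‖ - I * (1 - ‖τ‖ ^ 2)) / (1 + ‖τ‖ ^ 2))) G) := by
  have hlt := mem_ball_zero_iff.mp h.mem
  have hup := h.re_conj_mul_le hf hG norm_I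
  have hdown := h.re_conj_mul_le hf hG ((norm_neg I).trans norm_I)
  rw [circleParam_I (norm_nonneg τ) hlt] at hup
  rw [circleParam_neg_I (norm_nonneg τ) hlt] at hdown
  simp only [map_neg, conj_I, neg_mul, neg_neg, neg_re, I_mul_re, sub_im, add_im, ofReal_im,
    mul_im, I_re, I_im, ofReal_re, zero_mul, one_mul, zero_add] at hup hdown
  have hρ : 0 ≤ 2 * ‖τ‖ / (1 - ‖τ‖ ^ 2) * (f 0).re := by
    have := one_sub_sq_norm_pos h.mem
    have := hf.re_nonneg 0 (by simp)
    positivity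
  rw [or_or_distrib_left, ← hup.2, ← hdown.2, sub_im, abs_le, abs_eq hρ]
  exact ⟨⟨by linarith [hdown.1], hup.1⟩, by grind⟩

theorem exists_remainder_of_hasSpectralValue (h : IsAdmissible τ σ lam)
    (hG : G ∈ Gen τ σ lam) (hG0 : ¬ EqOn G 0 unitDisk) {w : ℂ} (hw : HasSpectralValue G τ w) :
    G 0 ≠ 0 ∧ w ≠ 0 ∧ ∃ f, IsCaratheodory f ∧ EqOn G (genOfRemainder τ σ lam f) unitDisk ∧
      τ / G 0 = f 0 + sumAlpha τ σ lam ∧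
      ((1 - ‖τ‖ ^ 2 : ℝ) : ℂ) / w = f τ + p₀ τ σ lam τ := by
  obtain ⟨f, hf, hGf⟩ := h.exists_eqOn_genOfRemainder hG hG0
  have hval : G 0 = τ / (f 0 + sumAlpha τ σ lam) :=
    (hGf (by simp)).trans (h.genOfRemainder_zero f)
  have hwval := (h.hasSpectralValue_genOfRemainder_iff hf).mp ((hasSpectralValue_congr hGf).mp hw)
  refine ⟨?_, ?_, f, hf, hGf, ?_, ?_⟩
  · exact hval ▸ div_ne_zero h.ne_zero (h.add_sumAlpha_ne_zero (hf.re_nonneg 0 (by simp)))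
  · exact hwval ▸ div_ne_zero h.one_sub_sq_norm_ne_zero (h.add_p₀_ne_zero hf h.mem)
  · rw [hval, div_div_cancel₀ h.ne_zero]
  · rw [hwval, div_div_cancel₀ h.one_sub_sq_norm_ne_zero]

end IsAdmissible

end HolGen

theorem mainTheorem2 {n : ℕ} (hn : 0 < n) (τ : ℂ) (hτ : ‖τ‖ < 1) (hτ0 : τ ≠ 0)
    (σ : Fin n → ℂ) (hσ : ∀ k, ‖σ k‖ = 1) (hσinj : Function.Injective σ)
    (lam : Fin n → ℝ) (hlam : ∀ k, lam k < 0) :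
    -- the spectral value at `τ` is well defined on the class
    (∀ G ∈ Gen τ σ lam, ∃! w : ℂ, HasSpectralValue G τ w) ∧
    -- the value region
    valueRegion τ σ lam = {P | P.1 ∈ regionZ τ σ lam ∧ P.2 ∈ regionΩ τ σ lam P.1} ∧
    -- `Z` and `Ω_ζ` are closed disks, the latter degenerate exactly for boundary points `ζ`
    regionZ τ σ lam =
      Metric.closedBall (τ / (2 * sumAlpha τ σ lam : ℝ)) (‖τ‖ / (2 * sumAlpha τ σ lam)) ∧
    (∀ ζ ∈ interior (regionZ τ σ lam), ∃ c : ℂ, ∃ r : ℝ, 0 < r ∧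
      regionΩ τ σ lam ζ = Metric.closedBall c r) ∧
    (∀ ζ ∈ frontier (regionZ τ σ lam), ∃ c : ℂ, regionΩ τ σ lam ζ = {c}) ∧
    -- each boundary point is delivered by a unique generator, which is explicit
    (∀ P ∈ frontier (valueRegion τ σ lam), ∃ G ∈ Gen τ σ lam,
      IsExtremal τ σ lam G ∧ Delivers τ G P ∧
      ∀ G' ∈ Gen τ σ lam, Delivers τ G' P → EqOn G' G unitDisk) ∧
    -- conversely, all the explicit functions are in the class and deliver boundary points
    (∀ G, IsExtremal τ σ lam G → G ∈ Gen τ σ lam ∧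
      ∀ P, Delivers τ G P → P ∈ frontier (valueRegion τ σ lam)) ∧
    -- except when `s` is one of the `σ k`, their spectral values at the `σ k` equal `lam k`
    (∀ G, IsExtremalBdry τ σ lam G → G ∈ GenExact τ σ lam) ∧
    (∀ G s, ‖s‖ = 1 → s ∉ Set.range σ → IsExtremalInt τ σ lam s G → G ∈ GenExact τ σ lam) ∧
    -- the inequalities, with the generators for which equality occurs
    (∀ G ∈ Gen τ σ lam, ¬ EqOn G 0 unitDisk → ∀ w : ℂ, HasSpectralValue G τ w →
      G 0 ≠ 0 ∧ w ≠ 0 ∧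
      (sumAlpha τ σ lam ≤ (τ / G 0).re ∧
        ((τ / G 0).re = sumAlpha τ σ lam ↔ IsExtremalBdry τ σ lam G)) ∧
      ((1 - ‖τ‖) / (1 + ‖τ‖) * ((τ / G 0).re - sumAlpha τ σ lam)
          ≤ (((1 - ‖τ‖ ^ 2 : ℝ) : ℂ) / w).re - (1 - ‖τ‖ ^ 2) / 2 * ∑ k, 1 / |lam k| ∧
        ((1 - ‖τ‖) / (1 + ‖τ‖) * ((τ / G 0).re - sumAlpha τ σ lam)
          = (((1 - ‖τ‖ ^ 2 : ℝ) : ℂ) / w).re - (1 - ‖τ‖ ^ 2) / 2 * ∑ k, 1 / |lam k| ↔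
          IsExtremalBdry τ σ lam G ∨ IsExtremalInt τ σ lam (-(τ / ‖τ‖)) G)) ∧
      ((((1 - ‖τ‖ ^ 2 : ℝ) : ℂ) / w).re - (1 - ‖τ‖ ^ 2) / 2 * ∑ k, 1 / |lam k|
          ≤ (1 + ‖τ‖) / (1 - ‖τ‖) * ((τ / G 0).re - sumAlpha τ σ lam) ∧
        ((((1 - ‖τ‖ ^ 2 : ℝ) : ℂ) / w).re - (1 - ‖τ‖ ^ 2) / 2 * ∑ k, 1 / |lam k|
          = (1 + ‖τ‖) / (1 - ‖τ‖) * ((τ / G 0).re - sumAlpha τ σ lam) ↔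
          IsExtremalBdry τ σ lam G ∨ IsExtremalInt τ σ lam (τ / ‖τ‖) G)) ∧
      (|(((1 - ‖τ‖ ^ 2 : ℝ) : ℂ) / w - τ / G 0).im - sumB τ σ lam|
          ≤ 2 * ‖τ‖ / (1 - ‖τ‖ ^ 2) * ((τ / G 0).re - sumAlpha τ σ lam) ∧
        (|(((1 - ‖τ‖ ^ 2 : ℝ) : ℂ) / w - τ / G 0).im - sumB τ σ lam|
          = 2 * ‖τ‖ / (1 - ‖τ‖ ^ 2) * ((τ / G 0).re - sumAlpha τ σ lam) ↔
          IsExtremalBdry τ σ lam G ∨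
          IsExtremalInt τ σ lam
            (τ / ‖τ‖ * ((2 * ‖τ‖ + I * (1 - ‖τ‖ ^ 2)) / (1 + ‖τ‖ ^ 2))) G ∨
          IsExtremalInt τ σ lam
            (τ / ‖τ‖ * ((2 * ‖τ‖ - I * (1 - ‖τ‖ ^ 2)) / (1 + ‖τ‖ ^ 2))) G))) := by
  have h : IsAdmissible τ σ lam := ⟨hn, mem_ball_zero_iff.mpr hτ, hτ0, hσ, hσinj, hlam⟩
  refine ⟨fun G => h.existsUnique_hasSpectralValue, h.valueRegion_eq, h.regionZ_eq_closedBall,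
    fun ζ => h.exists_regionΩ_eq_closedBall, fun ζ => h.exists_regionΩ_eq_singleton,
    fun P => h.exists_isExtremal_of_mem_frontier, fun G => h.mem_gen_and_mem_frontier_of_isExtremal,
    fun G => h.mem_genExact_of_isExtremalBdry, fun G s => h.mem_genExact_of_isExtremalInt,
    fun G hG hG0 w hw => ?_⟩
  obtain ⟨hG0', hw0, f, hf, hGf, hval, hspec⟩ := h.exists_remainder_of_hasSpectralValue hG hG0 hw
  have hre : (τ / G 0).re = (f 0).re + sumAlpha τ σ lam := by rw [hval, add_re, ofReal_re]
  have hre' : (((1 - ‖τ‖ ^ 2 : ℝ) : ℂ) / w).re - (1 - ‖τ‖ ^ 2) / 2 * ∑ k, 1 / |lam k|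
      = (f τ).re := by
    rw [hspec, add_re, h.p₀_re, add_sub_cancel_right]
  have him : (((1 - ‖τ‖ ^ 2 : ℝ) : ℂ) / w - τ / G 0).im - sumB τ σ lam = (f τ - f 0).im := by
    rw [hspec, hval, sub_im, sub_im, add_im, add_im, ofReal_im, h.p₀_im]
    ring
  rw [hre', him, hre, add_sub_cancel_right, le_add_iff_nonneg_left, add_eq_right]
  exact ⟨hG0', hw0, ⟨hf.re_nonneg 0 (by simp), (h.isExtremalBdry_iff_re_eq_zero hf hGf).symm⟩,
    h.mul_re_le_re hf hGf, h.re_le_mul_re hf hGf, h.abs_im_sub_le hf hGf⟩
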